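/- Let $A$ be a Hopf algebra over a commutative ring $k$ with coproduct $\Delta$, counit $\epsilon$ and antipode $s$, which is quasitriangular with Yang–Baxter element $\rho=\sum e\otimes e'$ ($\rho$ invertible, $\rho\Delta(x)=\Delta'(x)\rho$, $\rho_{13}\rho_{12}=(1\otimes\Delta)\rho$, $\rho_{13}\rho_{23}=(\Delta\otimes1)\rho$) and augmented, i.e. it has a grouplike element $G$ with $s^2(x)=GxG^{-1}$ for all $x$. Let $T$ be a 1-1 tangle diagram in vertical position, that is, a composition of layers, each consisting of one cup, one cap or one crossing $R$ or $L$ between vertical lines, with one lower and one upper end. A trace on $A$ is a linear $\mathrm{tr}:A\to k$ with $\mathrm{tr}(xy)=\mathrm{tr}(yx)$ and $\mathrm{tr}(s(x))=\mathrm{tr}(x)$; choose one for each closed component of $T$. *The element $a(T)$.* Place beads $e,e'$ (left, right) just above each crossing $R$ and $s(e),e'$ just below each crossing $L$, and sum over the terms of $\rho$ at each crossing. For each component, go along it once from a base point, starting upward (the lower end for the open strand), with $w=1$, $i=0$ initially; replace $w$ by $w\,s^i(b)$ at each bead $b$, and $i$ by $i+1$ ($i-1$) at each maximum or minimum passed clockwise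 (counterclockwise). If $i=2d$ at the end, so that $d$ is the Whitney degree, the component has the content $wG^d$. Then $a(T)$ is the sum, over all choices of terms, of the product of the traces of the contents of the closed components times the content of the open strand. In the same way every diagram with further beads from $A$ on it has a value in $A$. *Pushing.* Let $C$ be a finite set of points (on edges, away from crossings, maxima and minima) such that cutting the flat diagram of $T$ at the points of $C$ leaves a connected tree, containing all crossings and both legs. Put a bead $a\in A$ on the lower leg and push it through the tree. A bead slid around a maximum or minimum is acted on by $s$ if it moves counterclockwise and by $s^{-1}$ if it moves clockwise. At a crossing of either type, a bead $s^p(a_w)$ arriving along one leg is replaced, following the bead-push identities such as $ae\otimes e'=ea_2\otimes s(a_1)e'a_3$, by beads carrying $a_{w1},a_{w2},a_{w3}$ on the other three legs in clockwise order, with antipode power $p+1$ or $p-1$ on a leg reached by a counterclockwise or clockwise half turn (from one lower leg to the other or from one upper leg to the other) and $p$ on the remaining two. A bead stops at a cut and at the upper end of $T$. Then for every such $T$ and $C$: 1. Pushing, in whatever order, can be continued to one and the same final position, in which nothing can be pushed further. In it there is exactly one bead on each twig: one on each side of every cut and one on the upper leg. Listed in the order of the iterated coproduct they carry, the beads are in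 lexicographic order of their indices. 2. Two paired beads (on the two sides of one cut) carry powers of the antipode that differ by exactly one. 3. In this order the pairs form well-nested parentheses, separately before and after the bead on the upper leg, and that bead carries the power $0$ of the antipode. 4. The pairs can be cancelled in sequence, each time a pair of beads adjacent in the order whose product along the edge is of the form $s^p(x_1s(x_2))$ or $s^p(x_2s^{-1}(x_1))$ with $p$ even, hence $\epsilon(x)$, until only the bead on the upper leg is left, carrying $a$. 5. For every $a\in A$, every push and every such cancellation leaves the value of the diagram (summed over the iterated coproduct of $a$) unchanged. The initial value is $a\cdot a(T)$ and the final one is $a(T)\cdot a$; hence $a\cdot a(T)=a(T)\cdot a$. -/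

import Mathlib

open scoped TensorProduct

namespace BeadPush

/-! ## Tangle diagrams in vertical position -/

/-- The elementary tangles. In `R` the overcrossing line goes upward from right to left,
in `L` it goes upward from left to right. -/
inductive Gen
  | cup | cap | R | L
  deriving DecidableEq

/-- Number of lower ends. -/
def Gen.src : Gen → ℕ
  | .cup => 0
  | .cap => 2
  | .R => 2
  | .L => 2

/-- Number of upper ends. -/
def Gen.tgt : Gen → ℕ
  | .cup => 2
  | .cap => 0
  | .R => 2
  | .L => 2

def Gen.isCrossing : Gen → Bool
  | .cup => false
  | .cap => false
  | .R => true
  | .L => true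

/-- The tangle `1 ⊗ ⋯ ⊗ 1 ⊗ gen ⊗ 1 ⊗ ⋯ ⊗ 1`, with `left` vertical lines on the left of the
generator and `right` vertical lines on its right. -/
structure Layer where
  left : ℕ
  gen : Gen
  right : ℕ

def Layer.src (l : Layer) : ℕ := l.left + l.gen.src + l.right

def Layer.tgt (l : Layer) : ℕ := l.left + l.gen.tgt + l.right

/-- A list of layers, read from bottom to top, is a tangle diagram with `n` lower and `m` upper
ends: a factorization into elementary tangles, equivalently a diagram in general position with
respect to the vertical direction, up to planar isotopy preserving the order of heights. -/
def IsTangle : ℕ → List Layer → ℕ → Prop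
  | n, [], m => n = m
  | n, l :: ls, m => l.src = n ∧ IsTangle l.tgt ls m

/-- The number of strands of a diagram with one lower end at level `t`: level `t` is the
horizontal line just above the first `t` layers. -/
def width (T : List Layer) : ℕ → ℕ
  | 0 => 1
  | t + 1 => match T[t]? with
    | some l => l.tgt
    | none => 0

/-- The points in which the diagram meets the levels: `(t, j)` is the `j`-th point from the left
on level `t`, counted from `0`. -/
def points (T : List Layer) : Finset (ℕ × ℕ) :=
  (Finset.range (T.length + 1)).biUnion fun t => (Finset.range (width T t)).image (Prod.mk t)

/-- A point of the diagram together with a direction of motion along the strand. -/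
structure Loc where
  level : ℕ
  pos : ℕ
  up : Bool
  deriving DecidableEq

def Loc.point (x : Loc) : ℕ × ℕ := (x.level, x.pos)

def Loc.rev (x : Loc) : Loc := ⟨x.level, x.pos, !x.up⟩

/-- The four legs of a crossing: lower left, upper left, upper right, lower right.
A cap has the two lower legs only, a cup the two upper legs only. -/
inductive Leg
  | ll | ul | ur | lr
  deriving DecidableEq

/-- The next leg in clockwise order around the crossing. -/
def Leg.cw : Leg → Leg
  | .ll => .ul
  | .ul => .ur
  | .ur => .lr
  | .lr => .ll

/-- The position reached by leaving the generator of layer number `t`, with `left` lines on its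
left, along the given leg. -/
def Leg.out (t left : ℕ) : Leg → Loc
  | .ll => ⟨t, left, false⟩
  | .lr => ⟨t, left + 1, false⟩
  | .ul => ⟨t + 1, left, true⟩
  | .ur => ⟨t + 1, left + 1, true⟩

/-- The number of counterclockwise half turns of the motion that enters a generator along the
first leg and leaves it along the second: passing from one lower leg to the other is passing a
maximum, passing from one upper leg to the other is passing a minimum. -/
def turn : Leg → Leg → ℤ
  | .lr, .ll => 1
  | .ll, .lr => -1
  | .ul, .ur => 1
  | .ur, .ul => -1
  | _, _ => 0

/-- What is met when one leaves a point in a given direction: an end of the diagram, a vertical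
segment up to a point on an adjacent level, or the generator of layer `l`, which is layer
number `t`, entered along a leg. -/
inductive Passage
  | exit
  | plain (y : Loc)
  | node (t : ℕ) (l : Layer) (leg : Leg)

def passUp (t : ℕ) (l : Layer) (j : ℕ) : Passage :=
  if j < l.left then .plain ⟨t + 1, j, true⟩
  else if l.left + l.gen.src ≤ j then .plain ⟨t + 1, j + l.gen.tgt - l.gen.src, true⟩
  else if j = l.left then .node t l .ll
  else .node t l .lr

def passDown (t : ℕ) (l : Layer) (j : ℕ) : Passage :=
  if j < l.left then .plain ⟨t, j, false⟩
  else if l.left + l.gen.tgt ≤ j then .plain ⟨t, j + l.gen.src - l.gen.tgt, false⟩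
  else if j = l.left then .node t l .ul
  else .node t l .ur

def passage (T : List Layer) : Loc → Passage
  | ⟨t, j, true⟩ => match T[t]? with
    | some l => passUp t l j
    | none => .exit
  | ⟨0, _, false⟩ => .exit
  | ⟨t + 1, j, false⟩ => match T[t]? with
    | some l => passDown t l j
    | none => .exit

/-- The leg along which the strand that enters along the given leg leaves the generator. -/
def Gen.strand : Gen → Leg → Leg
  | .cap, .ll => .lr
  | .cap, _ => .ll
  | .cup, .ul => .ur
  | .cup, _ => .ul
  | .R, g => g.cw.cw
  | .L, g => g.cw.cw

/-! ## Trees cut from the flat diagram -/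

/-- Vertices of the cut flat diagram. Each point is divided into its lower and its upper half:
`half x` is the half adjacent to what lies ahead of `x`, hence the upper half if `x.up`. Moreover
there is a vertex for the generator of each layer. -/
inductive Vertex
  | half (x : Loc)
  | node (t : ℕ)

def Vertex.valid (T : List Layer) : Vertex → Prop
  | .half x => x.point ∈ points T
  | .node t => t < T.length

/-- The immediate connections in the flat diagram cut at the points of `C`: all four legs of a
crossing are joined at the crossing, and the two halves of a point are joined unless the
point belongs to `C`. -/
def joined (T : List Layer) (C : Finset (ℕ × ℕ)) : Vertex → Vertex → Prop
  | .half x, .half y => (y = x.rev ∧ x.point ∉ C) ∨ passage T x = .plain y.rev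
  | .half x, .node t => ∃ l leg, passage T x = .node t l leg
  | .node _, _ => False

def cutGraph (T : List Layer) (C : Finset (ℕ × ℕ)) : SimpleGraph {v : Vertex // v.valid T} :=
  SimpleGraph.fromRel fun v w => joined T C v.1 w.1

/-- Cutting the edges of the flat diagram at the points of `C` leaves a connected tree, which
contains all crossings and both legs of the tangle. -/
def IsTreeCut (T : List Layer) (C : Finset (ℕ × ℕ)) : Prop :=
  C ⊆ points T ∧ (cutGraph T C).IsTree

/-! ## Pushing beads -/

/-- A bead: it carries `s ^ pow` applied to one of the tensor factors of an iterated coproduct of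
the element `a` that is pushed. It lies on the lower half of its point if `loc.up`, and
on the upper half otherwise. The label is the index of the factor: the factors of the
coproduct of `a_w` are `a_{w1}, a_{w2}, a_{w3}`. -/
structure Bead where
  loc : Loc
  pow : ℤ
  label : List ℕ

/-- The bead sent out along the leg `leg'` of layer number `t` by a bead arriving at `leg`. -/
def sendBead (b : Bead) (t : ℕ) (l : Layer) (leg leg' : Leg) (label : List ℕ) : Bead :=
  ⟨leg'.out t l.left, b.pow + turn leg leg', label⟩

/-- The beads that result from pushing a bead into a generator along a leg. At a maximum or a
minimum the bead slides around it. At a crossing of either type it is replaced by three beads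
on the other legs, indexed clockwise. In both cases a counterclockwise half turn applies `s` and
a clockwise one applies the inverse of `s`.

On a bead arriving from below at the lower right leg this is
`a e ⊗ e' = e a_2 ⊗ s(a_1) e' a_3`, and likewise for the other legs and the other crossing. -/
def pushNode (b : Bead) (t : ℕ) (l : Layer) (leg : Leg) : List Bead :=
  if l.gen.isCrossing then
    [sendBead b t l leg leg.cw (b.label ++ [1]), sendBead b t l leg leg.cw.cw (b.label ++ [2]),
      sendBead b t l leg leg.cw.cw.cw (b.label ++ [3])]
  else [sendBead b t l leg (l.gen.strand leg) b.label]

/-- The result of pushing a bead; a bead on a twig (at a cut or at an end of the tangle) is not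
pushed further. -/
def advance (T : List Layer) (C : Finset (ℕ × ℕ)) (b : Bead) : Option (List Bead) :=
  if b.loc.point ∈ C then none
  else match passage T b.loc with
    | .exit => none
    | .plain y => some [⟨y, b.pow, b.label⟩]
    | .node t l leg => some (pushNode b t l leg)

/-- One push. The beads are listed in the order of the coproduct factors they carry. -/
inductive Push (T : List Layer) (C : Finset (ℕ × ℕ)) : List Bead → List Bead → Prop
  | mk (x : List Bead) (b : Bead) (bs y : List Bead) (h : advance T C b = some bs) :
      Push T C (x ++ b :: y) (x ++ bs ++ y)

/-- The bead `a` on the lower leg of the tangle. -/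
def startBead : Bead := ⟨⟨0, 0, true⟩, 0, []⟩

/-- The end of the upper leg of the tangle. -/
def topLoc (T : List Layer) : Loc := ⟨T.length, 0, true⟩

/-- The two beads lie on the two twigs of the same cut. -/
def Paired (b c : Bead) : Prop := c.loc = b.loc.rev

/-- Well-formed parentheses, paired by the relation `P`. -/
inductive WellNested {β : Type*} (P : β → β → Prop) : List β → Prop
  | nil : WellNested P []
  | wrap (b c : β) (m n : List β) (h : P b c) (hm : WellNested P m) (hn : WellNested P n) :
      WellNested P (b :: (m ++ c :: n))

/-- Two beads carrying consecutive factors `x_1`, `x_2` of a coproduct, in this order, lie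
on the two twigs of one cut, and their product along the upward edge has the form
`s^p(x_1) s^(p+1)(x_2) = s^p(x_1 s(x_2))` or `s^p(x_2) s^(p-1)(x_1) = s^p(x_2 s⁻¹(x_1))`
with `p` even, hence is the counit of `x`. -/
def Cancels (b c : Bead) : Prop :=
  Paired b c ∧
    ((b.loc.up = true ∧ Even b.pow ∧ c.pow = b.pow + 1) ∨
      (c.loc.up = true ∧ Even c.pow ∧ b.pow = c.pow - 1))

/-- One cancellation of two beads that are adjacent in the order of coproduct factors. -/
inductive Cancel : List Bead → List Bead → Prop
  | mk (x : List Bead) (b c : Bead) (y : List Bead) (h : Cancels b c) :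
      Cancel (x ++ b :: c :: y) (x ++ y)

/-! ## Hopf algebras -/

section Algebra

variable (k : Type*) {A : Type*} [CommRing k] [Ring A] [HopfAlgebra k A]

/-- `ρ` makes the Hopf algebra `A` quasitriangular. -/
structure IsQuasitriangular (ρ : A ⊗[k] A) : Prop where
  isUnit : IsUnit ρ
  comul_comm : ∀ x : A, ρ * Coalgebra.comul x =
    TensorProduct.comm k A A (Coalgebra.comul x) * ρ
  /-- `ρ₁₃ ρ₁₂ = (1 ⊗ Δ) ρ` -/
  lTensor_comul :
    Algebra.TensorProduct.map (AlgHom.id k A)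
        (Algebra.TensorProduct.includeRight : A →ₐ[k] A ⊗[k] A) ρ *
      Algebra.TensorProduct.map (AlgHom.id k A)
        (Algebra.TensorProduct.includeLeft : A →ₐ[k] A ⊗[k] A) ρ =
    (Coalgebra.comul (R := k) (A := A)).lTensor A ρ
  /-- `ρ₁₃ ρ₂₃ = (Δ ⊗ 1) ρ` -/
  rTensor_comul :
    Algebra.TensorProduct.map (AlgHom.id k A)
        (Algebra.TensorProduct.includeRight : A →ₐ[k] A ⊗[k] A) ρ * ((1 : A) ⊗ₜ[k] ρ) =
    TensorProduct.assoc k A A A ((Coalgebra.comul (R := k) (A := A)).rTensor A ρ)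

variable (A) in
/-- The structure of an augmented Hopf algebra: a grouplike element `G` such that the square of
the antipode is conjugation by `G`. -/
structure Augmentation where
  G : Aˣ
  isGroupLike : IsGroupLikeElem k (G : A)
  antipode_sq : ∀ x : A, HopfAlgebra.antipode k (HopfAlgebra.antipode k x) = G * x * (G⁻¹ : Aˣ)

/-- A trace function. -/
structure IsTrace (tr : A →ₗ[k] k) : Prop where
  mul_comm : ∀ x y : A, tr (x * y) = tr (y * x)
  antipode : ∀ x : A, tr (HopfAlgebra.antipode k x) = tr x

variable {k}

theorem Augmentation.antipode_bijective (g : Augmentation k A) :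
    Function.Bijective (HopfAlgebra.antipode k : A →ₗ[k] A) := by
  constructor
  · intro x y h
    have h2 := congrArg (HopfAlgebra.antipode k : A →ₗ[k] A) h
    rw [g.antipode_sq, g.antipode_sq] at h2
    simpa using h2
  · intro y
    refine ⟨HopfAlgebra.antipode k ((g.G⁻¹ : Aˣ) * y * g.G : A), ?_⟩
    rw [g.antipode_sq]
    simp [mul_assoc]

/-- The antipode `s` as a bijection. -/
noncomputable def Augmentation.s (g : Augmentation k A) : A ≃ₗ[k] A :=
  LinearEquiv.ofBijective (HopfAlgebra.antipode k : A →ₗ[k] A) g.antipode_bijective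

/-- The Sweedler sum `∑ f [a_1, …, a_n]` over the iterated coproduct of `a` with `n` factors (the
counit if `n = 0`), for an expression `f` that is linear in each of the `n` entries. -/
noncomputable def sweedler (k : Type*) {A : Type*} [CommRing k] [Ring A] [HopfAlgebra k A] :
    ℕ → A → (List A → A) → A
  | 0, a, f => Coalgebra.counit (R := k) a • f []
  | n + 1, a, f => ∑ i ∈ (Coalgebra.Repr.arbitrary k a).index,
      sweedler k n ((Coalgebra.Repr.arbitrary k a).right i)
        fun v => f ((Coalgebra.Repr.arbitrary k a).left i :: v)

end Algebra

/-! ## The element of a 1-1 tangle -/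

/-- The move along the strand to the next point, with the number of counterclockwise half turns. -/
def next (T : List Layer) (x : Loc) : Option (Loc × ℤ) :=
  match passage T x with
  | .exit => none
  | .plain y => some (y, 0)
  | .node t l leg => some ((l.gen.strand leg).out t l.left, turn leg (l.gen.strand leg))

/-- Follow the strand from `x`, until its end or until the return to `base`, for at most the given
number of points. The exponent `i` of the antipode increases by one at each clockwise half turn
and decreases by one at each counterclockwise one. The result lists the points met with the
exponents there, and the final exponent. -/
def walk (T : List Layer) (base : Loc) : ℕ → Loc → ℤ → List (Loc × ℤ) × ℤ
  | 0, _, i => ([], i)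
  | n + 1, x, i => match next T x with
    | none => ([(x, i)], i)
    | some (y, δ) =>
      if y = base then ([(x, i)], i - δ)
      else ((x, i) :: (walk T base n y (i - δ)).1, (walk T base n y (i - δ)).2)

/-- The strand through the point `p`, followed from `p` upward. -/
def strand (T : List Layer) (p : ℕ × ℕ) : List (Loc × ℤ) × ℤ :=
  walk T ⟨p.1, p.2, true⟩ (points T).card ⟨p.1, p.2, true⟩ 0

/-- One point on each closed component of the diagram: its leftmost lowest point. -/
def closedBases (T : List Layer) : Finset (ℕ × ℕ) :=
  (points T).filter fun p =>
    (∀ y ∈ (strand T (0, 0)).1, y.1.point ≠ p) ∧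
    ∀ y ∈ (strand T p).1, p.1 < y.1.level ∨ (p.1 = y.1.level ∧ p.2 ≤ y.1.pos)

/-- The numbers of the layers that are crossings. -/
def crossings (T : List Layer) : Finset ℕ :=
  (Finset.range T.length).filter fun t => (T[t]?).any fun l => l.gen.isCrossing

section Evaluation

variable {k A ι : Type*} [CommRing k] [Ring A] [HopfAlgebra k A]

/-- The bead of the Yang-Baxter element `∑ e ⊗ e'` (with `f` for `e'`) on the strand that enters a
crossing along a leg: `e ⊗ e'` above a crossing `R`, `s(e) ⊗ e'` below a crossing `L`. -/
noncomputable def crossingBead (g : Augmentation k A) (e f : ι → A) (i : ι) : Gen → Leg → A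
  | .R, .lr => e i
  | .R, .ul => e i
  | .R, .ll => f i
  | .R, .ur => f i
  | .L, .ll => g.s (e i)
  | .L, .ur => g.s (e i)
  | .L, .lr => f i
  | .L, .ul => f i
  | .cup, _ => 1
  | .cap, _ => 1

/-- The bead of the Yang-Baxter element met when leaving a point in a given direction, where
`σ` selects a term of `∑ e ⊗ e'` at each crossing. -/
noncomputable def strandBead (g : Augmentation k A) (e f : ι → A) (T : List Layer)
    (σ : crossings T → ι) (x : Loc) : A :=
  match passage T x with
  | .node t l leg => if h : t ∈ crossings T then crossingBead g e f (σ ⟨t, h⟩) l.gen leg else 1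
  | _ => 1

/-- The element `w G ^ d` of the strand through `p`, where `w` is obtained by concentrating the
algebra on the strand at `p` and `d` is the Whitney degree, for the diagram with additional
beads `D`. Each full turn changes the exponent of the antipode by two. At a point the beads
on the lower half come before those on the upper half in upward motion, and after
them in downward motion. -/
noncomputable def content (g : Augmentation k A) (e f : ι → A) (T : List Layer)
    (σ : crossings T → ι) (D : Loc → List A) (p : ℕ × ℕ) : A :=
  ((strand T p).1.map fun y =>
      ((D y.1 ++ D y.1.rev ++ [strandBead g e f T σ y.1]).map fun c => (g.s ^ y.2) c).prod).prod *
    ((g.G ^ ((strand T p).2 / 2) : Aˣ) : A)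

/-- The element of `A` that belongs to the 1-1 tangle `T` decorated with additional beads `D`.
The closed component with base point `p` is evaluated by the trace `tr p`. -/
noncomputable def evalTangle [Fintype ι] (g : Augmentation k A) (e f : ι → A)
    (tr : ℕ × ℕ → A →ₗ[k] k) (T : List Layer) (D : Loc → List A) : A :=
  ∑ σ : crossings T → ι,
    (∏ p ∈ closedBases T, tr p (content g e f T σ D p)) • content g e f T σ D (0, 0)

/-- The element `a(T)` of the 1-1 tangle `T`. -/
noncomputable def tangleElement [Fintype ι] (g : Augmentation k A) (e f : ι → A)
    (tr : ℕ × ℕ → A →ₗ[k] k) (T : List Layer) : A :=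
  evalTangle g e f tr T fun _ => []

/-- The decoration of the diagram in which the beads of the list carry the given elements. -/
noncomputable def decoration (g : Augmentation k A) (bs : List Bead) (v : List A) (x : Loc) :
    List A :=
  ((bs.zip v).filter fun q => q.1.loc = x).map fun q => (g.s ^ q.1.pow) q.2

/-- The value of the diagram `T` with additional beads carrying the factors, in the order of
the list, of the iterated coproduct of `a`. -/
noncomputable def value [Fintype ι] (g : Augmentation k A) (e f : ι → A)
    (tr : ℕ × ℕ → A →ₗ[k] k) (T : List Layer) (a : A) (bs : List Bead) : A :=
  sweedler k bs.length a fun v => evalTangle g e f tr T (decoration g bs v)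

end Evaluation

end BeadPush

open BeadPush

namespace BeadPush

/-! ## Layers, points and passages -/

/-! The flat diagram cut at `C` is a planar tree, and pushing distributes the factors of the
iterated coproduct over its twigs in the order of a clockwise walk around the tree. Two independent
facts carry the theorem: the shape of the final sequence of beads, and the invariance of the value
under one push or one cancellation.

Combinatorics. With the tree rooted at the lower end, beads only move away from the root, and where
they go depends on the position alone. `pushOut` computes the final beads, and its concatenation
over a list is unchanged by a push (`push_invariant`); this is confluence. The walk around the tree
passes every point once in each direction (`nodup_contour`, `mem_contour_start`), so each twig
receives one bead. Consecutive final beads border a common face of the uncut flat diagram, and their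
exponents measure the turning along that face (`pushOut_linked`).

Faces are the components of a graph of gaps between neighbouring points. The inequality V ≤ E + 1
for a connected graph already bounds the turning number of an inner face by two and of the two outer
faces by zero (`sum_layerTurn_le`). No Jordan curve theorem enters: each bead contributes one to the
sum over all faces, so counting produces an inner face that lies to the left of exactly one bead
(`exists_inner_face`). That bead directly follows its partner. Removing such pairs inductively
forces all bounds to be equalities (`exists_collapse`), which says that paired exponents differ by
exactly one. Read backwards, the removals build the parentheses.

Algebra. Strands are orbits of `follow`, a bijection of the directed points that closes up the two
ends of the tangle. A local change of beads affects a content only in two consecutive factors, or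
across the base point of a closed component, where the trace and conjugation by `G` compensate. At a
crossing the value is a linear function of one product in `A ⊗ A` (`evalPoints_crossing`). Hence a
push reduces to the four identities `push_lr`, `push_ll`, `push_ul`, `push_ur`, consequences of the
intertwining property, coassociativity and the antipode axiom. For `L` the tensor is the flip of the
inverse of `ρ`. Finally `sweedler_replace` confines each step to consecutive coproduct factors. -/

theorem mem_points {T : List Layer} {t j : ℕ} :
    (t, j) ∈ points T ↔ t ≤ T.length ∧ j < width T t := by
  simp [points]

theorem IsTangle.src_succ : ∀ {T : List Layer} {n m : ℕ}, IsTangle n T m →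
    ∀ {t : ℕ} {l l' : Layer}, T[t]? = some l → T[t + 1]? = some l' → l'.src = l.tgt
  | [], _, _, _, _, _, _, h, _ => by simp at h
  | [_], _, _, _, _, _, _, _, h => by simp at h
  | a :: b :: T, n, m, hT, 0, l, l', h, h' => by
      obtain ⟨-, hT⟩ := hT
      obtain ⟨hb, -⟩ := hT
      simp at h h'
      subst h h'
      exact hb
  | a :: b :: T, n, m, hT, t + 1, l, l', h, h' => hT.2.src_succ (t := t) (by simpa using h)
      (by simpa using h')

theorem IsTangle.src_zero {T : List Layer} {n m : ℕ} (hT : IsTangle n T m) {l : Layer}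
    (h : T[0]? = some l) : l.src = n := by
  cases T with
  | nil => simp at h
  | cons a T =>
    simp at h
    subst h
    exact hT.1

theorem width_succ {T : List Layer} {t : ℕ} {l : Layer} (h : T[t]? = some l) :
    width T (t + 1) = l.left + l.gen.tgt + l.right := by
  simp [width, h, Layer.tgt]

theorem IsTangle.width_eq {T : List Layer} {m : ℕ} (hT : IsTangle 1 T m) {t : ℕ} {l : Layer}
    (h : T[t]? = some l) : width T t = l.left + l.gen.src + l.right := by
  cases t with
  | zero => rw [← Layer.src, hT.src_zero h, width]
  | succ t =>
    obtain ⟨l', h'⟩ : ∃ l', T[t]? = some l' := by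
      have := (List.getElem?_eq_some_iff.1 h).1
      exact ⟨T[t], List.getElem?_eq_getElem (by omega)⟩
    rw [width_succ h', ← Layer.src, hT.src_succ h' h, Layer.tgt]

theorem IsTangle.width_last : ∀ {T : List Layer} {n m : ℕ}, IsTangle n T m →
    T = [] ∧ n = m ∨ ∃ l, T[T.length - 1]? = some l ∧ l.tgt = m ∧ T ≠ []
  | [], _, _, h => Or.inl ⟨rfl, h⟩
  | a :: T, n, m, h => by
      right
      rcases h.2.width_last with ⟨rfl, h'⟩ | ⟨l, hl, hm, hne⟩
      · exact ⟨a, by simp, h', by simp⟩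
      · refine ⟨l, ?_, hm, by simp⟩
        obtain ⟨b, T, rfl⟩ := List.exists_cons_of_ne_nil hne
        simpa using hl

theorem IsTangle.width_length {T : List Layer} (hT : IsTangle 1 T 1) : width T T.length = 1 := by
  rcases hT.width_last with ⟨rfl, -⟩ | ⟨l, hl, hm, hne⟩
  · rfl
  · obtain ⟨b, T, rfl⟩ := List.exists_cons_of_ne_nil hne
    simp only [List.length_cons, Nat.add_sub_cancel] at hl ⊢
    rw [width_succ hl, ← Layer.tgt, hm]

/-- The point of the diagram at which `x` lies exists. -/
def Loc.Valid (T : List Layer) (x : Loc) : Prop := x.point ∈ points T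

theorem Loc.valid_iff {T : List Layer} {x : Loc} :
    x.Valid T ↔ x.level ≤ T.length ∧ x.pos < width T x.level := mem_points

@[simp] theorem Loc.rev_rev (x : Loc) : x.rev.rev = x := by simp [Loc.rev]

@[simp] theorem Loc.point_rev (x : Loc) : x.rev.point = x.point := rfl

@[simp] theorem Loc.up_rev (x : Loc) : x.rev.up = !x.up := rfl

theorem Loc.rev_ne (x : Loc) : x.rev ≠ x := fun h => by
  simpa using congrArg Loc.up h

theorem Loc.rev_injective : Function.Injective Loc.rev := fun x y h => by
  simpa using congrArg Loc.rev h

theorem Loc.valid_rev {T : List Layer} {x : Loc} : x.rev.Valid T ↔ x.Valid T := Iff.rfl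

theorem Loc.eq_or_eq_rev {x y : Loc} (h : x.point = y.point) : x = y ∨ x = y.rev := by
  obtain ⟨t, j, u⟩ := x
  obtain ⟨t', j', u'⟩ := y
  simp only [Loc.point, Prod.mk.injEq] at h
  obtain ⟨rfl, rfl⟩ := h
  cases u <;> cases u' <;> simp [Loc.rev]

/-- The lower end of the lower leg. -/
def bottomLoc : Loc := ⟨0, 0, false⟩

/-- The generator has the given leg. -/
def Gen.HasLeg : Gen → Leg → Prop
  | .cup, g => g = .ul ∨ g = .ur
  | .cap, g => g = .ll ∨ g = .lr
  | .R, _ => True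
  | .L, _ => True

/-- `x` and `y` are the lower and the upper point of a vertical line of layer number `t`. -/
inductive VLine (t : ℕ) (l : Layer) : Loc → Loc → Prop
  | left (j : ℕ) (h : j < l.left) : VLine t l ⟨t, j, true⟩ ⟨t + 1, j, true⟩
  | right (j : ℕ) (h : j < l.right) :
      VLine t l ⟨t, l.left + l.gen.src + j, true⟩ ⟨t + 1, l.left + l.gen.tgt + j, true⟩

section Passage

variable {T : List Layer} (hT : IsTangle 1 T 1)
include hT

omit hT in
theorem start_valid : (⟨0, 0, true⟩ : Loc).Valid T :=
  Loc.valid_iff.2 ⟨Nat.zero_le _, by simp [width]⟩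

theorem IsTangle.topLoc_valid : (topLoc T).Valid T :=
  Loc.valid_iff.2 ⟨le_rfl, by simp [topLoc, hT.width_length]⟩

/-- `VLine` and `Leg.out` replace the truncated subtractions of `passUp` and `passDown` by explicit
offsets. In the generator case the position is recovered from the leg, which makes motion
reversible. -/
theorem IsTangle.passage_cases {x : Loc} (hx : x.Valid T) :
    (passage T x = .exit ∧ (x = topLoc T ∨ x = bottomLoc)) ∨
    (∃ t l y, T[t]? = some l ∧ passage T x = .plain y ∧ (VLine t l x y ∨ VLine t l y.rev x.rev)) ∨
    (∃ t l leg, T[t]? = some l ∧ l.gen.HasLeg leg ∧ passage T x = .node t l leg ∧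
      x = (leg.out t l.left).rev) := by
  obtain ⟨t, j, u⟩ := x
  obtain ⟨ht, hj⟩ := Loc.valid_iff.1 hx
  simp only at ht hj
  have key : ∀ {t : ℕ}, t < T.length → ∃ l, T[t]? = some l := fun h =>
    ⟨_, List.getElem?_eq_getElem h⟩
  cases u with
  | true =>
    rcases ht.eq_or_lt with rfl | ht
    · left
      rw [hT.width_length] at hj
      exact ⟨by simp [passage], Or.inl (by simp [topLoc]; omega)⟩
    · right
      obtain ⟨l, hl⟩ := key ht
      rw [hT.width_eq hl] at hj
      simp only [passage, hl, passUp]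
      split_ifs with h1 h2 h3
      · exact Or.inl ⟨t, l, _, hl, rfl, Or.inl (.left j h1)⟩
      · refine Or.inl ⟨t, l, _, hl, rfl, Or.inl ?_⟩
        obtain ⟨i, rfl⟩ := Nat.exists_eq_add_of_le h2
        have : l.left + l.gen.src + i + l.gen.tgt - l.gen.src = l.left + l.gen.tgt + i := by omega
        rw [this]
        exact .right i (by omega)
      · refine Or.inr ⟨t, l, .ll, hl, ?_, rfl, by simp [Leg.out, Loc.rev, h3]⟩
        rcases l with ⟨_, _ | _ | _ | _, _⟩ <;> simp [Gen.HasLeg, Gen.src] at h1 h2 ⊢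
        omega
      · refine Or.inr ⟨t, l, .lr, hl, ?_, rfl, ?_⟩
        all_goals
          rcases l with ⟨_, _ | _ | _ | _, _⟩ <;>
            simp [Gen.HasLeg, Gen.src, Leg.out, Loc.rev] at h1 h2 h3 ⊢ <;> omega
  | false =>
    cases t with
    | zero =>
      left
      simp only [width] at hj
      exact ⟨by simp [passage], Or.inr (by simp [bottomLoc]; omega)⟩
    | succ t =>
      right
      obtain ⟨l, hl⟩ := key (t := t) (by omega)
      rw [width_succ hl] at hj
      simp only [passage, hl, passDown]
      split_ifs with h1 h2 h3
      · exact Or.inl ⟨t, l, _, hl, rfl, Or.inr (.left j h1)⟩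
      · refine Or.inl ⟨t, l, _, hl, rfl, Or.inr ?_⟩
        obtain ⟨i, rfl⟩ := Nat.exists_eq_add_of_le h2
        have : l.left + l.gen.tgt + i + l.gen.src - l.gen.tgt = l.left + l.gen.src + i := by omega
        rw [this]
        exact .right i (by omega)
      · refine Or.inr ⟨t, l, .ul, hl, ?_, rfl, by simp [Leg.out, Loc.rev, h3]⟩
        rcases l with ⟨_, _ | _ | _ | _, _⟩ <;> simp [Gen.HasLeg, Gen.tgt] at h1 h2 ⊢
        omega
      · refine Or.inr ⟨t, l, .ur, hl, ?_, rfl, ?_⟩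
        all_goals
          rcases l with ⟨_, _ | _ | _ | _, _⟩ <;>
            simp [Gen.HasLeg, Gen.tgt, Leg.out, Loc.rev] at h1 h2 h3 ⊢ <;> omega

omit hT in
theorem passage_vline {t : ℕ} {l : Layer} (hl : T[t]? = some l) {x y : Loc} (h : VLine t l x y) :
    passage T x = .plain y ∧ passage T y.rev = .plain x.rev := by
  cases h with
  | left j h => simp [passage, hl, passUp, passDown, h, Loc.rev]
  | right j h =>
    have h1 : ¬ l.left + l.gen.src + j < l.left := by omega
    have h2 : ¬ l.left + l.gen.tgt + j < l.left := by omega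
    have h3 : l.left + l.gen.src + j + l.gen.tgt - l.gen.src = l.left + l.gen.tgt + j := by omega
    have h4 : l.left + l.gen.tgt + j + l.gen.src - l.gen.tgt = l.left + l.gen.src + j := by omega
    simp [passage, hl, passUp, passDown, h1, h2, h3, h4, Loc.rev]

omit hT in
theorem passage_out {t : ℕ} {l : Layer} {leg : Leg} (hl : T[t]? = some l) (h : l.gen.HasLeg leg) :
    passage T (leg.out t l.left).rev = .node t l leg := by
  rcases l with ⟨a, _ | _ | _ | _, b⟩ <;> cases leg <;>
    simp [passage, hl, passUp, passDown, Loc.rev, Leg.out, Gen.src, Gen.tgt,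
      Gen.HasLeg] at h ⊢

theorem IsTangle.valid_vline {t : ℕ} {l : Layer} (hl : T[t]? = some l) {x y : Loc}
    (h : VLine t l x y) : x.Valid T ∧ y.Valid T := by
  have := (List.getElem?_eq_some_iff.1 hl).1
  cases h with
  | left j h =>
    simp only [Loc.valid_iff, hT.width_eq hl, width_succ hl]
    omega
  | right j h =>
    simp only [Loc.valid_iff, hT.width_eq hl, width_succ hl]
    omega

theorem IsTangle.valid_out {t : ℕ} {l : Layer} {leg : Leg} (hl : T[t]? = some l)
    (h : l.gen.HasLeg leg) : (leg.out t l.left).Valid T := by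
  have := (List.getElem?_eq_some_iff.1 hl).1
  have h1 := hT.width_eq hl
  have h2 := width_succ hl
  rcases l with ⟨a, _ | _ | _ | _, b⟩ <;> cases leg <;>
    simp [Loc.valid_iff, Leg.out, Gen.HasLeg, Gen.src, Gen.tgt] at h h1 h2 ⊢ <;> omega

theorem IsTangle.passage_exit {x : Loc} (hx : x.Valid T) :
    passage T x = .exit ↔ x = topLoc T ∨ x = bottomLoc := by
  constructor
  · intro h
    rcases hT.passage_cases hx with h1 | ⟨_, _, _, _, h1, _⟩ | ⟨_, _, _, _, _, h1, _⟩
    · exact h1.2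
    all_goals rw [h] at h1; cases h1
  · rintro (rfl | rfl)
    · simp [passage, topLoc]
    · simp [passage, bottomLoc]

theorem IsTangle.passage_plain {x y : Loc} (hx : x.Valid T) (h : passage T x = .plain y) :
    ∃ t l, T[t]? = some l ∧ (VLine t l x y ∨ VLine t l y.rev x.rev) := by
  rcases hT.passage_cases hx with h1 | ⟨t, l, y', hl, h1, h2⟩ | ⟨_, _, _, _, _, h1, _⟩
  · rw [h] at h1; cases h1.1
  · rw [h] at h1
    cases h1
    exact ⟨t, l, hl, h2⟩
  · rw [h] at h1; cases h1

theorem IsTangle.passage_plain_rev {x y : Loc} (hx : x.Valid T) (h : passage T x = .plain y) :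
    y.Valid T ∧ passage T y.rev = .plain x.rev := by
  obtain ⟨t, l, hl, h1 | h1⟩ := hT.passage_plain hx h
  · exact ⟨(hT.valid_vline hl h1).2, (passage_vline hl h1).2⟩
  · exact ⟨(hT.valid_vline hl h1).1, (passage_vline hl h1).1⟩

theorem IsTangle.passage_node {x : Loc} (hx : x.Valid T) {t : ℕ} {l : Layer} {leg : Leg}
    (h : passage T x = .node t l leg) :
    T[t]? = some l ∧ l.gen.HasLeg leg ∧ x = (leg.out t l.left).rev := by
  rcases hT.passage_cases hx with h1 | ⟨_, _, _, _, h1, _⟩ | ⟨t', l', leg', hl, hleg, h1, h2⟩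
  · rw [h] at h1; cases h1.1
  · rw [h] at h1; cases h1
  · rw [h] at h1
    cases h1
    exact ⟨hl, hleg, h2⟩

end Passage

theorem Leg.out_injective {t left : ℕ} : Function.Injective (Leg.out t left) := by
  intro a b h
  cases a <;> cases b <;> simp [Leg.out] at h ⊢

theorem Leg.out_point_injective {t left : ℕ} {a b : Leg}
    (h : (a.out t left).point = (b.out t left).point) : a = b := by
  cases a <;> cases b <;> simp [Leg.out, Loc.point] at h ⊢

theorem turn_swap (a b : Leg) : turn b a = -turn a b := by
  cases a <;> cases b <;> rfl

end BeadPush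

namespace BeadPush

/-! ## Collapsing lists of paired beads -/

section Nesting

variable {Φ : Type*} (lab : Loc → Φ)

/-- Consecutive beads of the list are joined by paths that keep the label, from `a` to `b`. -/
def Linked : Φ → List Bead → Φ → Prop
  | a, [], b => a = b
  | a, x :: l, b => lab x.loc = a ∧ Linked (lab x.loc.rev) l b

theorem linked_append {l₁ l₂ : List Bead} {a b : Φ} :
    Linked lab a (l₁ ++ l₂) b ↔ ∃ c, Linked lab a l₁ c ∧ Linked lab c l₂ b := by
  induction l₁ generalizing a with
  | nil => simp [Linked]
  | cons x l ih => simp [Linked, ih, and_assoc]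

open Classical in
/-- The contribution of a bead to the turning number of the face with label `f`. -/
noncomputable def beadTurn (f : Φ) (d : Bead) : ℤ :=
  (if lab d.loc = f then d.pow + 1 else 0) - (if lab d.loc.rev = f then d.pow else 0)

/-- The turning number along the face with label `f`, expressed by the beads. -/
noncomputable def faceTurn (f : Φ) (l : List Bead) : ℤ := (l.map (beadTurn lab f)).sum

@[simp] theorem faceTurn_nil (f : Φ) : faceTurn lab f [] = 0 := rfl

@[simp] theorem faceTurn_cons (f : Φ) (d : Bead) (l : List Bead) :
    faceTurn lab f (d :: l) = beadTurn lab f d + faceTurn lab f l := by simp [faceTurn]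

@[simp] theorem faceTurn_append (f : Φ) (l₁ l₂ : List Bead) :
    faceTurn lab f (l₁ ++ l₂) = faceTurn lab f l₁ + faceTurn lab f l₂ := by simp [faceTurn]

variable {lab}

/-- Only the last bead lacks a successor, and its right-hand label is the final label; any other
bead hands its right-hand label to the next one. -/
theorem Linked.exists_of_mem {a b : Φ} {l : List Bead} (h : Linked lab a l b) {c : Bead}
    (hc : c ∈ l) (hb : lab c.loc.rev ≠ b) :
    ∃ U e V, l = U ++ c :: e :: V ∧ lab e.loc = lab c.loc.rev := by
  obtain ⟨U, V, rfl⟩ := List.append_of_mem hc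
  obtain ⟨m, -, -, h2⟩ := (linked_append lab).1 h
  cases V with
  | nil => exact absurd h2 hb
  | cons e V => exact ⟨U, e, V, rfl, h2.1⟩

theorem Linked.mem_labels {a b : Φ} {l : List Bead} (h : Linked lab a l b) {c : Bead}
    (hc : c ∈ l) : lab c.loc.rev = b ∨ ∃ e ∈ l, lab e.loc = lab c.loc.rev := by
  by_cases hb : lab c.loc.rev = b
  · exact Or.inl hb
  · obtain ⟨U, e, V, rfl, he⟩ := h.exists_of_mem hc hb
    exact Or.inr ⟨e, by simp, he⟩

theorem eq_of_countP_eq_one {α : Type*} {p : α → Bool} {l : List α} (h : l.countP p = 1) {a b : α}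
    (ha : a ∈ l) (hb : b ∈ l) (hpa : p a) (hpb : p b) : a = b := by
  rw [List.countP_eq_length_filter, List.length_eq_one_iff] at h
  obtain ⟨x, hx⟩ := h
  have h1 : a ∈ l.filter p := List.mem_filter.2 ⟨ha, hpa⟩
  have h2 : b ∈ l.filter p := List.mem_filter.2 ⟨hb, hpb⟩
  rw [hx, List.mem_singleton] at h1 h2
  rw [h1, h2]

/-- The removal of two adjacent paired beads whose exponents differ by one. -/
inductive Collapse : List Bead → List Bead → Prop
  | mk (x : List Bead) (b c : Bead) (y : List Bead) (h : Paired b c) (hp : c.pow = b.pow + 1) :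
      Collapse (x ++ b :: c :: y) (x ++ y)

open Classical in
/-- The turning number of a disc, corrected at the two outer faces. -/
noncomputable def faceBound (L R f : Φ) : ℤ := if f = L then 1 else if f = R then 0 else 2

-- The exponents cancel: a bead adds `pow + 1` to the face on its left and `-pow` to the face on its
-- right, hence one in total.
open Classical in
theorem sum_faceTurn {Λ : Finset Φ} {l : List Bead}
    (h : ∀ d ∈ l, lab d.loc ∈ Λ ∧ lab d.loc.rev ∈ Λ) :
    ∑ f ∈ Λ, faceTurn lab f l = l.length := by
  induction l with
  | nil => simp
  | cons d l ih =>
    simp only [faceTurn_cons, Finset.sum_add_distrib]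
    rw [ih fun d hd => h d (List.mem_cons_of_mem _ hd)]
    obtain ⟨h1, h2⟩ := h d (by simp)
    simp [beadTurn, Finset.sum_sub_distrib, h1, h2]
    ring

open Classical in
theorem sum_countP {Λ : Finset Φ} {l : List Bead} (h : ∀ d ∈ l, lab d.loc ∈ Λ) :
    ∑ f ∈ Λ, (l.countP (fun d => lab d.loc = f) : ℤ) = l.length := by
  induction l with
  | nil => simp
  | cons d l ih =>
    simp only [List.countP_cons, Nat.cast_add, Finset.sum_add_distrib]
    rw [ih fun d hd => h d (List.mem_cons_of_mem _ hd)]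
    simp [h d (by simp)]

-- A counting argument. Turning numbers and left-hand incidences both sum to the number of beads. If
-- no inner face had exactly one incidence, every face would have at least as many incidences as its
-- turning number, hence exactly as many. Then `L` is met once, by the first bead, which must be
-- `z`, and `R` is never met, so nothing can follow `z`.
open Classical in
theorem exists_inner_face {l : List Bead} {z : Bead} {L R : Φ} (hLR : L ≠ R) (hz : z ∈ l)
    (hl : Linked lab L l R) (hzL : lab z.loc = L) (hzR : lab z.loc.rev = R)
    (hW : ∀ f, faceTurn lab f l ≤ faceBound L R f) (hne : l ≠ [z]) :
    ∃ f, f ≠ L ∧ f ≠ R ∧ l.countP (fun d => lab d.loc = f) = 1 := by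
  by_contra! hcon
  set Λ : Finset Φ := insert R (l.map fun d => lab d.loc).toFinset with hΛ
  have hmem : ∀ d ∈ l, lab d.loc ∈ Λ := fun d hd => by
    simp only [hΛ, Finset.mem_insert, List.mem_toFinset, List.mem_map]
    exact Or.inr ⟨d, hd, rfl⟩
  -- A right-hand face is the left-hand face of the next bead, or `R` after the last one; so `Λ`
  -- contains all faces involved.
  have hmem' : ∀ d ∈ l, lab d.loc.rev ∈ Λ := fun d hd => by
    rcases hl.mem_labels hd with h | ⟨e, he, h⟩
    · rw [h]; simp [hΛ]
    · rw [← h]; exact hmem e he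
  have hpos : ∀ d ∈ l, 0 < l.countP (fun e => lab e.loc = lab d.loc) := fun d hd =>
    List.countP_pos_iff.2 ⟨d, hd, by simp⟩
  have hnonneg : ∀ f ∈ Λ, 0 ≤ (l.countP (fun d => lab d.loc = f) : ℤ) - faceTurn lab f l := by
    intro f hf
    have hb := hW f
    unfold faceBound at hb
    by_cases h1 : f = L
    · have := hpos z hz
      rw [hzL, ← h1] at this
      rw [if_pos h1] at hb
      omega
    · rw [if_neg h1] at hb
      by_cases h2 : f = R
      · rw [if_pos h2] at hb
        omega
      · rw [if_neg h2] at hb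
        simp only [hΛ, Finset.mem_insert, h2, List.mem_toFinset, List.mem_map, false_or] at hf
        obtain ⟨d, hd, rfl⟩ := hf
        have := hpos d hd
        have := hcon _ h1 h2
        omega
  have hsum : ∑ f ∈ Λ, ((l.countP (fun d => lab d.loc = f) : ℤ) - faceTurn lab f l) = 0 := by
    rw [Finset.sum_sub_distrib, sum_countP hmem, sum_faceTurn fun d hd => ⟨hmem d hd, hmem' d hd⟩,
      sub_self]
  have hzero := (Finset.sum_eq_zero_iff_of_nonneg hnonneg).1 hsum
  have hL := hzero L (hzL ▸ hmem z hz)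
  have hR := hzero R (by simp [hΛ])
  have hbL := hW L
  have hbR := hW R
  rw [faceBound, if_pos rfl] at hbL
  rw [faceBound, if_neg hLR.symm, if_pos rfl] at hbR
  have hL1 : l.countP (fun d => lab d.loc = L) = 1 := by
    have := hpos z hz
    rw [hzL] at this
    omega
  have hR0 : l.countP (fun d => lab d.loc = R) = 0 := by omega
  cases l with
  | nil => simp at hz
  | cons d l =>
    -- The list starts with label `L`, so its head is the only bead with that label.
    obtain rfl : d = z := eq_of_countP_eq_one hL1 (by simp) hz (by simpa using hl.1) (by simpa)
    cases l with
    | nil => exact hne rfl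
    | cons e l =>
      have : lab e.loc = R := hl.2.1.trans hzR
      simp [this] at hR0

-- Induction on the number of beads, removing a pair at an inner face met once. The upper bounds
-- survive the removal, and the induction returns them as equalities on the faces still in use.
-- These equalities leave room only for exponents that differ by exactly one. The last conclusion is
-- what the induction feeds on.
open Classical in
theorem exists_collapse {l : List Bead} {z : Bead} {L R : Φ} (hLR : L ≠ R) (hz : z ∈ l)
    (hl : Linked lab L l R) (hzL : lab z.loc = L) (hzR : lab z.loc.rev = R)
    (hnd : (l.map Bead.loc).Nodup)
    (hpair : ∀ d ∈ l, d ≠ z → ∃ c ∈ l, c ≠ z ∧ c.loc = d.loc.rev)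
    (hW : ∀ f, faceTurn lab f l ≤ faceBound L R f) :
    Relation.ReflTransGen Collapse l [z] ∧ z.pow = 0 ∧
      (∀ f, f = R ∨ (∃ d ∈ l, lab d.loc = f) → faceTurn lab f l = faceBound L R f) := by
  induction hn : l.length using Nat.strong_induction_on generalizing l with
  | _ n ih =>
  by_cases hne : l = [z]
  · subst hne
    have h1 := hW L
    have h2 := hW R
    simp [beadTurn, hzL, hzR, hLR, hLR.symm, faceBound] at h1 h2
    have hz0 : z.pow = 0 := by omega
    refine ⟨.refl, hz0, ?_⟩
    rintro f (rfl | ⟨d, hd, rfl⟩)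
    · simp [beadTurn, hzL, hzR, hLR, hLR.symm, faceBound, hz0]
    · rw [List.mem_singleton] at hd
      subst hd
      simp [beadTurn, hzL, hzR, hLR.symm, faceBound, hz0]
  obtain ⟨f, hfL, hfR, hf1⟩ := exists_inner_face hLR hz hl hzL hzR hW hne
  obtain ⟨d, hd, hdf⟩ := List.countP_pos_iff.1 (hf1 ▸ Nat.one_pos)
  replace hdf : lab d.loc = f := by simpa using hdf
  have hdz : d ≠ z := by rintro rfl; exact hfL (hdf ▸ hzL)
  obtain ⟨c, hc, hcz, hcd⟩ := hpair d hd hdz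
  have hcf : lab c.loc.rev = f := by rw [hcd, Loc.rev_rev, hdf]
  obtain ⟨U, e, V, hlU, he⟩ := hl.exists_of_mem hc (hcf ▸ hfR)
  have hel : e ∈ l := by rw [hlU]; simp
  -- The partner `c` has `f` on its right, so the bead after it has `f` on its left and is `d`
  -- itself: the pair is adjacent.
  obtain rfl : e = d := eq_of_countP_eq_one hf1 hel hd (by simp [he, hcf]) (by simp [hdf])
  have hedge : e.loc.rev = c.loc := hcd.symm
  subst hlU
  have hnd' : ∀ x ∈ U ++ V, x.loc ≠ c.loc ∧ x.loc ≠ e.loc := by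
    have hperm : (U ++ c :: e :: V).Perm (c :: e :: (U ++ V)) :=
      List.perm_middle.trans ((List.perm_middle).cons _)
    have := (hperm.map Bead.loc).nodup_iff.1 hnd
    simp only [List.map_cons, List.nodup_cons, List.mem_cons, List.mem_map, not_or] at this
    intro x hx
    exact ⟨fun h => this.1.2 ⟨x, hx, h⟩, fun h => this.2.1 ⟨x, hx, h⟩⟩
  have hsub : (U ++ V).Sublist (U ++ c :: e :: V) :=
    ((List.sublist_cons_self _ _).trans (List.sublist_cons_self _ _)).append_left _
  have hl' : Linked lab L (U ++ V) R := by
    obtain ⟨m, h1, rfl, h2, h3⟩ := (linked_append lab).1 hl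
    rw [hedge] at h3
    exact (linked_append lab).2 ⟨_, h1, h3⟩
  have hzmem : z ∈ U ++ V := by
    simp only [List.mem_append, List.mem_cons] at hz ⊢
    rcases hz with h | rfl | rfl | h
    · exact Or.inl h
    · exact absurd rfl hcz
    · exact absurd rfl hdz
    · exact Or.inr h
  have hFf : ∀ x ∈ U ++ V, lab x.loc ≠ f := by
    intro x hx h
    have := eq_of_countP_eq_one hf1 (hsub.subset hx) hel (by simpa using h) (by simpa using hdf)
    exact (hnd' x hx).2 (by rw [this])
  have hBf : ∀ x ∈ U ++ V, lab x.loc.rev ≠ f := by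
    intro x hx h
    rcases hl'.mem_labels hx with h1 | ⟨y, hy, h1⟩
    · exact hfR (h.symm.trans h1)
    · exact hFf y hy (h1.trans h)
  have hW0 : faceTurn lab f (U ++ V) = 0 := by
    refine List.sum_eq_zero fun x hx => ?_
    obtain ⟨y, hy, rfl⟩ := List.mem_map.1 hx
    simp [beadTurn, hFf y hy, hBf y hy]
  have hgf : lab c.loc ≠ f := by
    intro h
    have := eq_of_countP_eq_one hf1 hc hel (by simpa using h) (by simpa using hdf)
    rw [this] at hcd
    exact Loc.rev_ne _ hcd.symm
  -- The pair touches only `f` and the face across the cut, with contributions that sum to two.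
  have hsplit : ∀ x, faceTurn lab x (U ++ c :: e :: V) = faceTurn lab x (U ++ V) +
      ((if lab c.loc = x then c.pow + 1 - e.pow else 0) +
        if f = x then e.pow + 1 - c.pow else 0) := by
    intro x
    simp only [faceTurn_append, faceTurn_cons, beadTurn, hdf, hcf, hedge]
    split_ifs <;> ring
  -- The face `f` turns by `e.pow + 1 - c.pow`, at most two. So the removal can only lower the
  -- turning of the face across the cut, and the bounds persist.
  have hs : 0 ≤ c.pow + 1 - e.pow := by
    have := hsplit f
    rw [hW0, if_neg hgf, if_pos rfl] at this
    have hb := hW f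
    rw [faceBound, if_neg hfL, if_neg hfR] at hb
    omega
  have hW' : ∀ x, faceTurn lab x (U ++ V) ≤ faceBound L R x := by
    intro x
    by_cases hx : f = x
    · subst hx
      rw [hW0, faceBound, if_neg hfL, if_neg hfR]
      norm_num
    · have h1 := hsplit x
      have h2 := hW x
      rw [if_neg hx] at h1
      split_ifs at h1 <;> omega
  have hpair' : ∀ d ∈ U ++ V, d ≠ z → ∃ c ∈ U ++ V, c ≠ z ∧ c.loc = d.loc.rev := by
    intro x hx hxz
    obtain ⟨y, hy, hyz, hxy⟩ := hpair x (hsub.subset hx) hxz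
    refine ⟨y, ?_, hyz, hxy⟩
    simp only [List.mem_append, List.mem_cons] at hy ⊢
    rcases hy with h | rfl | rfl | h
    · exact Or.inl h
    · refine absurd ?_ (hnd' x hx).2
      rw [← Loc.rev_rev x.loc, ← hxy, hcd, Loc.rev_rev]
    · refine absurd ?_ (hnd' x hx).1
      rw [← Loc.rev_rev x.loc, ← hxy, hedge]
    · exact Or.inr h
  obtain ⟨hC, hz0, hEq⟩ := ih (U ++ V).length (by rw [← hn]; simp) hzmem hl'
    (hnd.sublist (hsub.map _)) hpair' hW' rfl
  -- After the removal this face is still the label of the next bead, or it is `R`; the induction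
  -- therefore gives equality, and the bound for the full list yields the reverse of `hs`.
  have hg : faceTurn lab (lab c.loc) (U ++ V) = faceBound L R (lab c.loc) := by
    apply hEq
    obtain ⟨m, -, -, -, h3⟩ := (linked_append lab).1 hl
    rw [hedge] at h3
    cases V with
    | nil => exact Or.inl h3
    | cons y V => exact Or.inr ⟨y, by simp, h3.1⟩
  have hs0 : e.pow = c.pow + 1 := by
    have h1 := hsplit (lab c.loc)
    have h2 := hW (lab c.loc)
    rw [if_pos rfl, if_neg hgf.symm] at h1
    omega
  refine ⟨.head (.mk U c e V (by rw [Paired, ← hedge, Loc.rev_rev]) hs0) hC, hz0, ?_⟩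
  intro x hx
  rw [hsplit x, hs0]
  by_cases hxf : f = x
  · subst hxf
    rw [hW0, if_neg hgf, faceBound, if_neg hfL, if_neg hfR]
    simp
    ring
  · rw [if_neg hxf, hEq x]
    · simp
    · rcases hx with h | ⟨d, hd, h⟩
      · exact Or.inl h
      · simp only [List.mem_append, List.mem_cons] at hd
        rcases hd with h' | rfl | rfl | h'
        · exact Or.inr ⟨d, by simp [h'], h⟩
        · obtain ⟨m, -, -, -, h3⟩ := (linked_append lab).1 hl
          rw [hedge] at h3
          cases V with
          | nil => exact Or.inl (h.symm.trans h3)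
          | cons y V => exact Or.inr ⟨y, by simp, h3.1.trans h⟩
        · exact absurd (hdf.symm.trans h) hxf
        · exact Or.inr ⟨d, by simp [h'], h⟩

end Nesting

/-- Undoes one cancellation. In the inductive step the insertion falls before the opening bead,
after the closing bead, or inside the bracket, the place just before the closing bead counting as
inside. -/
theorem WellNested.insert {β : Type*} {P : β → β → Prop} {b c : β} (hbc : P b c) :
    ∀ {m₁ m₂ : List β}, WellNested P (m₁ ++ m₂) → WellNested P (m₁ ++ b :: c :: m₂) := by
  have key : ∀ {m : List β}, WellNested P m → ∀ m₁ m₂, m = m₁ ++ m₂ →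
      WellNested P (m₁ ++ b :: c :: m₂) := by
    intro m hm
    induction hm with
    | nil =>
      intro m₁ m₂ h
      obtain ⟨rfl, rfl⟩ := List.append_eq_nil_iff.1 h.symm
      exact .wrap b c [] [] hbc .nil .nil
    | wrap b' c' m n h hm hn ihm ihn =>
      intro m₁ m₂ e
      cases m₁ with
      | nil =>
        simp only [List.nil_append] at e ⊢
        rw [← e]
        exact .wrap b c [] _ hbc .nil (.wrap b' c' m n h hm hn)
      | cons x m₁ =>
        simp only [List.cons_append, List.cons.injEq] at e
        obtain ⟨rfl, e⟩ := e
        rcases List.append_eq_append_iff.1 e with ⟨a, rfl, e'⟩ | ⟨a, rfl, rfl⟩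
        · cases a with
          | nil =>
            simp only [List.nil_append, List.append_nil] at e' ⊢
            rw [← e']
            have := WellNested.wrap b' c' _ n h (ihm m [] (by simp)) hn
            simpa using this
          | cons y a =>
            simp only [List.cons_append, List.cons.injEq] at e'
            obtain ⟨rfl, rfl⟩ := e'
            have := WellNested.wrap b' c' m _ h hm (ihn a m₂ rfl)
            simpa using this
        · have := WellNested.wrap b' c' _ n h (ihm m₁ a rfl) hn
          simpa using this
  intro m₁ m₂ h
  exact key h m₁ m₂ rfl

/-- The removals are replayed backwards. A removed pair was adjacent, so it is reinserted entirely
on one side of `z`. -/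
theorem wellNested_of_collapse {l : List Bead} {z : Bead}
    (h : Relation.ReflTransGen Collapse l [z]) :
    ∃ u v, l = u ++ z :: v ∧ WellNested Paired u ∧ WellNested Paired v := by
  induction h using Relation.ReflTransGen.head_induction_on with
  | refl => exact ⟨[], [], rfl, .nil, .nil⟩
  | head h _ ih =>
    obtain ⟨u, v, e, hu, hv⟩ := ih
    cases h with
    | mk x b c y hbc hp =>
      rcases List.append_eq_append_iff.1 e with ⟨a, rfl, rfl⟩ | ⟨a, rfl, e'⟩
      · exact ⟨x ++ b :: c :: a, v, by simp, hu.insert hbc, hv⟩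
      · cases a with
        | nil =>
          simp only [List.nil_append, List.append_nil] at e' hu ⊢
          subst e'
          have := WellNested.insert hbc (m₁ := u) (m₂ := []) (by simpa using hu)
          exact ⟨u ++ [b, c], v, by simp, this, hv⟩
        | cons w a =>
          simp only [List.cons_append, List.cons.injEq] at e'
          obtain ⟨rfl, rfl⟩ := e'
          exact ⟨u, a ++ b :: c :: y, by simp, hu, hv.insert hbc⟩

theorem abs_pow_sub_of_collapse {l : List Bead} {z : Bead}
    (h : Relation.ReflTransGen Collapse l [z]) (hnd : (l.map Bead.loc).Nodup) :
    ∀ b ∈ l, ∀ c ∈ l, Paired b c → |b.pow - c.pow| = 1 := by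
  induction h using Relation.ReflTransGen.head_induction_on with
  | refl =>
    intro b hb c hc h
    rw [List.mem_singleton] at hb hc
    subst hb hc
    exact absurd h.symm (Loc.rev_ne _)
  | head h _ ih =>
    cases h with
    | mk x b c y hbc hp =>
      have hperm : (x ++ b :: c :: y).Perm (b :: c :: (x ++ y)) :=
        List.perm_middle.trans ((List.perm_middle).cons _)
      have hnd' := (hperm.map Bead.loc).nodup_iff.1 hnd
      simp only [List.map_cons, List.nodup_cons, List.mem_cons, List.mem_map, not_or] at hnd'
      obtain ⟨⟨-, h1⟩, h2, h3⟩ := hnd'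
      replace hbc : c.loc = b.loc.rev := hbc
      intro b' hb' c' hc' h
      replace h : c'.loc = b'.loc.rev := h
      rw [hperm.mem_iff, List.mem_cons, List.mem_cons] at hb' hc'
      have e1 : b.pow - c.pow = -1 := by omega
      have e2 : c.pow - b.pow = 1 := by omega
      rcases hb' with rfl | rfl | hb' <;> rcases hc' with rfl | rfl | hc'
      · exact absurd h.symm (Loc.rev_ne _)
      · rw [e1]; rfl
      · exact absurd ⟨c', hc', h.trans hbc.symm⟩ h2
      · rw [e2]; rfl
      · exact absurd h.symm (Loc.rev_ne _)
      · exact absurd ⟨c', hc', by rw [h, hbc, Loc.rev_rev]⟩ h1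
      · refine absurd ⟨b', hb', ?_⟩ h2
        rw [hbc, h, Loc.rev_rev]
      · refine absurd ⟨b', hb', ?_⟩ h1
        rw [← Loc.rev_rev b'.loc, ← h, hbc, Loc.rev_rev]
      · exact ih h3 b' hb' c' hc' h

/-- The parity of the exponent is the direction of the bead, so direction decides which of the two
antipode forms occurs. -/
theorem cancels_of_paired {b c : Bead} (h : Paired b c) (hp : c.pow = b.pow + 1)
    (hb : b.loc.up = true ↔ Even b.pow) : Cancels b c := by
  refine ⟨h, ?_⟩
  have hup : c.loc.up = !b.loc.up := by rw [show c.loc = _ from h]; rfl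
  cases hu : b.loc.up with
  | true => exact Or.inl ⟨rfl, hb.1 hu, hp⟩
  | false =>
    refine Or.inr ⟨by simp [hup, hu], ?_, by omega⟩
    rw [hp, Int.even_add_one]
    intro h
    simp [hb.2 h] at hu

theorem cancel_of_collapse {l m : List Bead} (h : Relation.ReflTransGen Collapse l m)
    (hup : ∀ b ∈ l, (b.loc.up = true ↔ Even b.pow)) : Relation.ReflTransGen Cancel l m := by
  induction h using Relation.ReflTransGen.head_induction_on with
  | refl => exact .refl
  | head h _ ih =>
    cases h with
    | mk x b c y hbc hp =>
      refine .head (.mk x b c y (cancels_of_paired hbc hp (hup b (by simp)))) (ih ?_)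
      intro d hd
      apply hup d
      simp only [List.mem_append, List.mem_cons] at hd ⊢
      tauto

end BeadPush

namespace BeadPush

/-! ## Faces of the flat diagram -/

/-- Two gaps between the points of adjacent levels are connected along a layer. -/
def gapRel (T : List Layer) (p q : ℕ × ℕ) : Prop :=
  ∃ l, T[p.1]? = some l ∧ q.1 = p.1 + 1 ∧ ((p.2 ≤ l.left ∧ q.2 = p.2) ∨
    ∃ h ≤ l.right, p.2 = l.left + l.gen.src + h ∧ q.2 = l.left + l.gen.tgt + h)

/-- The graph of the gaps: `(t, j)` is the gap on level `t` to the left of point `j`. -/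
def gapGraph (T : List Layer) : SimpleGraph (ℕ × ℕ) := SimpleGraph.fromRel (gapRel T)

/-- The face to which a gap belongs. -/
def gapFace (T : List Layer) (p : ℕ × ℕ) : (gapGraph T).ConnectedComponent :=
  (gapGraph T).connectedComponentMk p

/-- The gap on the left of a moving point. -/
def leftGap (x : Loc) : ℕ × ℕ := (x.level, if x.up then x.pos else x.pos + 1)

/-- The face on the left of a moving point. -/
def faceLab (T : List Layer) (x : Loc) : (gapGraph T).ConnectedComponent := gapFace T (leftGap x)

/-- The leg along which the leftmost turn leaves a generator. -/
def Gen.leftmost (g : Gen) (leg : Leg) : Leg :=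
  if g.isCrossing then leg.cw else g.strand leg

/-- The number of counterclockwise half turns of the leftmost turn. -/
def leftTurn (T : List Layer) (x : Loc) : ℤ :=
  match passage T x with
  | .node _ l leg => turn leg (l.gen.leftmost leg)
  | _ => 0

variable {T : List Layer}

theorem gapRel.face_eq {p q : ℕ × ℕ} (h : gapRel T p q) : gapFace T p = gapFace T q := by
  apply SimpleGraph.ConnectedComponent.sound
  apply SimpleGraph.Adj.reachable
  refine (SimpleGraph.fromRel_adj _ _ _).2 ⟨?_, Or.inl h⟩
  rintro rfl
  obtain ⟨_, _, h, _⟩ := h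
  omega

theorem gapFace_left {t g : ℕ} {l : Layer} (hl : T[t]? = some l) (hg : g ≤ l.left) :
    gapFace T (t, g) = gapFace T (t + 1, g) :=
  gapRel.face_eq ⟨l, hl, rfl, Or.inl ⟨hg, rfl⟩⟩

theorem gapFace_right {t h : ℕ} {l : Layer} (hl : T[t]? = some l) (hh : h ≤ l.right) :
    gapFace T (t, l.left + l.gen.src + h) = gapFace T (t + 1, l.left + l.gen.tgt + h) :=
  gapRel.face_eq ⟨l, hl, rfl, Or.inr ⟨h, hh, rfl, rfl⟩⟩

theorem faceLab_vline {t : ℕ} {l : Layer} (hl : T[t]? = some l) {x y : Loc} (h : VLine t l x y) :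
    faceLab T x = faceLab T y ∧ faceLab T x.rev = faceLab T y.rev := by
  cases h with
  | left j h =>
    exact ⟨gapFace_left hl h.le, gapFace_left hl h⟩
  | right j h =>
    exact ⟨gapFace_right hl h.le, gapFace_right hl (h := j + 1) h⟩

/-- Between a leg and the next one clockwise no line of the generator intervenes, so a leftmost turn
keeps the same face on the left. -/
theorem faceLab_leftmost {t : ℕ} {l : Layer} (hl : T[t]? = some l) {leg : Leg}
    (h : l.gen.HasLeg leg) :
    faceLab T (leg.out t l.left).rev = faceLab T ((l.gen.leftmost leg).out t l.left) := by
  have h1 := gapFace_left hl (le_refl l.left)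
  have h2 := gapFace_right hl (Nat.zero_le l.right)
  rcases l with ⟨a, _ | _ | _ | _, b⟩ <;> cases leg <;>
    simp [Gen.HasLeg, Gen.leftmost, Gen.isCrossing, Leg.cw, Gen.strand, Leg.out, faceLab, leftGap,
      Loc.rev, Gen.src, Gen.tgt] at h h1 h2 ⊢ <;>
    first | exact h1 | exact h2 | exact h1.symm | exact h2.symm | exact h1.symm.trans h2 |
      exact h2.symm.trans h1 | exact h1.trans h2.symm

/-- Checkerboard colouring: every generator has zero or two ends on each side, so gap indices change
by an even number along a face. Its use is to separate the two outer faces. -/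
theorem even_of_gapFace_eq {p q : ℕ × ℕ} (h : gapFace T p = gapFace T q) :
    Even p.2 ↔ Even q.2 := by
  have hrel : ∀ {p q : ℕ × ℕ}, gapRel T p q → (Even p.2 ↔ Even q.2) := by
    rintro p q ⟨l, -, -, ⟨-, h⟩ | ⟨h, -, h1, h2⟩⟩
    · rw [h]
    · rw [h1, h2]
      rcases l with ⟨a, _ | _ | _ | _, b⟩ <;> simp [Gen.src, Gen.tgt, Nat.even_add]
  obtain ⟨w⟩ := SimpleGraph.ConnectedComponent.exact h
  induction w with
  | nil => rfl
  | cons hadj w ih =>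
    have := ih (SimpleGraph.ConnectedComponent.sound ⟨w⟩)
    rcases ((SimpleGraph.fromRel_adj _ _ _).1 hadj).2 with h' | h'
    · exact (hrel h').trans this
    · exact (hrel h').symm.trans this

/-- The gap exists in the diagram. -/
def GapValid (T : List Layer) (p : ℕ × ℕ) : Prop := p.1 ≤ T.length ∧ p.2 ≤ width T p.1

theorem IsTangle.gapValid_of_rel (hT : IsTangle 1 T 1) {p q : ℕ × ℕ} (h : gapRel T p q) :
    GapValid T p ∧ GapValid T q := by
  obtain ⟨t, i⟩ := p
  obtain ⟨t', j⟩ := q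
  obtain ⟨l, hl, rfl, h⟩ := h
  simp only at hl h ⊢
  have h1 := hT.width_eq hl
  have h2 := width_succ hl
  have h3 := (List.getElem?_eq_some_iff.1 hl).1
  simp only [GapValid, h1, h2]
  rcases h with ⟨h, rfl⟩ | ⟨h, hh, rfl, rfl⟩ <;> omega

theorem IsTangle.gapValid_of_face_eq (hT : IsTangle 1 T 1) {p q : ℕ × ℕ} (hp : GapValid T p)
    (h : gapFace T p = gapFace T q) : GapValid T q := by
  obtain ⟨w⟩ := SimpleGraph.ConnectedComponent.exact h
  induction w with
  | nil => exact hp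
  | cons hadj w ih =>
    refine ih ?_ (SimpleGraph.ConnectedComponent.sound ⟨w⟩)
    rcases ((SimpleGraph.fromRel_adj _ _ _).1 hadj).2 with h' | h'
    · exact (hT.gapValid_of_rel h').2
    · exact (hT.gapValid_of_rel h').1

open Classical in
/-- The indicator function of a face on the gaps. -/
noncomputable def gapInd (T : List Layer) (f : (gapGraph T).ConnectedComponent) (t g : ℕ) : ℤ :=
  if gapFace T (t, g) = f then 1 else 0

/-- The number of connections of layer number `t` that belong to a face. -/
noncomputable def layerEdges (T : List Layer) (f : (gapGraph T).ConnectedComponent) (t : ℕ) : ℤ :=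
  match T[t]? with
  | none => 0
  | some l => ∑ g ∈ Finset.range (l.left + 1), gapInd T f t g +
      ∑ h ∈ Finset.range (l.right + 1), gapInd T f t (l.left + l.gen.src + h)

/-- The number of gaps on level `t` that belong to a face. -/
noncomputable def levelGaps (T : List Layer) (f : (gapGraph T).ConnectedComponent) (t : ℕ) : ℤ :=
  ∑ g ∈ Finset.range (width T t + 1), gapInd T f t g

open Classical in
/-- The Euler characteristic of a face is at most one. -/
theorem IsTangle.euler_le (hT : IsTangle 1 T 1) (f : (gapGraph T).ConnectedComponent) :
    ∑ t ∈ Finset.range (T.length + 1), levelGaps T f t ≤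
      ∑ t ∈ Finset.range T.length, layerEdges T f t + 1 := by
  -- All edges of the face, layer by layer. Only an upper bound on their number is needed, so
  -- coincidences in the images are harmless.
  let Ed : Finset (Sym2 (ℕ × ℕ)) := (Finset.range T.length).biUnion fun t =>
    match T[t]? with
    | none => ∅
    | some l =>
      (((Finset.range (l.left + 1)).filter fun g => gapFace T (t, g) = f).image
        fun g => s((t, g), (t + 1, g))) ∪
      (((Finset.range (l.right + 1)).filter
        fun h => gapFace T (t, l.left + l.gen.src + h) = f).image
        fun h => s((t, l.left + l.gen.src + h), (t + 1, l.left + l.gen.tgt + h)))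
  have hEd : (Ed.card : ℤ) ≤ ∑ t ∈ Finset.range T.length, layerEdges T f t := by
    refine (Nat.cast_le.2 Finset.card_biUnion_le).trans ?_
    rw [Nat.cast_sum]
    refine Finset.sum_le_sum fun t _ => ?_
    unfold layerEdges
    cases T[t]? with
    | none => simp
    | some l =>
      refine (Nat.cast_le.2 ((Finset.card_union_le _ _).trans
        (add_le_add Finset.card_image_le Finset.card_image_le))).trans (le_of_eq ?_)
      simp only [gapInd, Finset.card_filter]
      push_cast
      rfl
  let Vt : Finset (ℕ × ℕ) := (Finset.range (T.length + 1)).biUnion fun t =>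
    ((Finset.range (width T t + 1)).filter fun g => gapFace T (t, g) = f).image (Prod.mk t)
  have hVt : ∑ t ∈ Finset.range (T.length + 1), levelGaps T f t = Vt.card := by
    rw [Finset.card_biUnion]
    · rw [Nat.cast_sum]
      refine Finset.sum_congr rfl fun t _ => ?_
      rw [Finset.card_image_of_injective _ (Prod.mk_right_injective t), Finset.card_filter]
      simp [levelGaps, gapInd]
    · intro a _ b _ hab
      rw [Function.onFun, Finset.disjoint_left]
      intro p hp hq
      simp only [Finset.mem_image] at hp hq
      obtain ⟨_, _, rfl⟩ := hp
      obtain ⟨_, _, h⟩ := hq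
      exact hab (congrArg Prod.fst h).symm
  have hmem : ∀ p, p ∈ Vt ↔ GapValid T p ∧ gapFace T p = f := by
    rintro ⟨t, g⟩
    simp only [Vt, Finset.mem_biUnion, Finset.mem_image, Finset.mem_filter, Finset.mem_range,
      GapValid, Prod.mk.injEq]
    constructor
    · rintro ⟨t', ht, g', ⟨hg, hf⟩, rfl, rfl⟩
      exact ⟨⟨by omega, by omega⟩, hf⟩
    · rintro ⟨⟨h1, h2⟩, h3⟩
      exact ⟨t, by omega, g, ⟨by omega, h3⟩, rfl, rfl⟩
  rw [hVt]
  -- The graph has all pairs of naturals as vertices; a component outside the diagram satisfies the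
  -- bound trivially. A component with one valid gap has only valid ones and is finite.
  rcases Vt.eq_empty_or_nonempty with h0 | ⟨p, hp⟩
  · rw [h0]
    have : (0 : ℤ) ≤ Ed.card := by positivity
    simp only [Finset.card_empty, Nat.cast_zero]
    omega
  obtain ⟨hpv, hpf⟩ := (hmem p).1 hp
  have hsupp : f.supp = (Vt : Set (ℕ × ℕ)) := by
    ext q
    rw [SimpleGraph.ConnectedComponent.mem_supp_iff, Finset.mem_coe, hmem]
    exact ⟨fun h => ⟨hT.gapValid_of_face_eq hpv (hpf.trans h.symm), h⟩, fun h => h.2⟩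
  -- The only topological input: a connected graph has at least as many edges as a spanning tree.
  have hcard := (f.connected_toSimpleGraph).card_vert_le_card_edgeSet_add_one
  have h1 : Nat.card f = Vt.card := by
    have : Nat.card f = Nat.card (f.supp : Set (ℕ × ℕ)) := rfl
    rw [this, hsupp]
    simp
  have h2 : Nat.card f.toSimpleGraph.edgeSet ≤ Ed.card := by
    have hinj : Function.Injective (Sym2.map (Subtype.val : f → ℕ × ℕ)) :=
      Sym2.map.injective Subtype.val_injective
    rw [Nat.card_coe_set_eq, ← Set.ncard_image_of_injective _ hinj, ← Set.ncard_coe_finset]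
    refine Set.ncard_le_ncard ?_ (Finset.finite_toSet _)
    have key : ∀ p q : ℕ × ℕ, gapRel T p q → gapFace T p = f → s(p, q) ∈ Ed := by
      rintro ⟨t, i⟩ ⟨t', j⟩ ⟨l, hl, rfl, h⟩ hf
      simp only at hl h
      have hlt := (List.getElem?_eq_some_iff.1 hl).1
      simp only [Ed, Finset.mem_biUnion, Finset.mem_range]
      refine ⟨t, hlt, ?_⟩
      rw [hl]
      rw [Finset.mem_union, Finset.mem_image, Finset.mem_image]
      rcases h with ⟨h, rfl⟩ | ⟨h, hh, rfl, rfl⟩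
      · exact Or.inl ⟨j, by simp [hf]; omega, rfl⟩
      · exact Or.inr ⟨h, by simp [hf]; omega, rfl⟩
    rintro _ ⟨e, he, rfl⟩
    induction e with
    | _ u v =>
      have hadj : (gapGraph T).Adj u.1 v.1 := he
      rw [Sym2.map_mk, Finset.mem_coe]
      rcases ((SimpleGraph.fromRel_adj _ _ _).1 hadj).2 with h | h
      · exact key _ _ h u.2
      · rw [Sym2.eq_swap]
        exact key _ _ h v.2
  rw [h1] at hcard
  have h3 : (Vt.card : ℤ) ≤ Ed.card + 1 := by exact_mod_cast hcard.trans (by omega)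
  omega

open Classical in
/-- The contribution of a step to the turning number of a face. -/
noncomputable def faceStep (T : List Layer) (f : (gapGraph T).ConnectedComponent) (x : Loc) : ℤ :=
  if faceLab T x = f then leftTurn T x else 0

theorem faceStep_up (f : (gapGraph T).ConnectedComponent) (t j : ℕ) :
    faceStep T f ⟨t, j, true⟩ = leftTurn T ⟨t, j, true⟩ * gapInd T f t j := by
  rw [gapInd, mul_ite, mul_one, mul_zero]
  rfl

theorem faceStep_down (f : (gapGraph T).ConnectedComponent) (t j : ℕ) :
    faceStep T f ⟨t, j, false⟩ = leftTurn T ⟨t, j, false⟩ * gapInd T f t (j + 1) := by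
  rw [gapInd, mul_ite, mul_one, mul_zero]
  rfl

/-- The contribution of a layer to the turning number of a face. -/
noncomputable def layerTurn (T : List Layer) (f : (gapGraph T).ConnectedComponent) (t : ℕ) : ℤ :=
  ∑ j ∈ Finset.range (width T t), faceStep T f ⟨t, j, true⟩ +
    ∑ j ∈ Finset.range (width T (t + 1)), faceStep T f ⟨t + 1, j, false⟩

theorem leftTurn_vline {t : ℕ} {l : Layer} (hl : T[t]? = some l) {x y : Loc} (h : VLine t l x y) :
    leftTurn T x = 0 ∧ leftTurn T y.rev = 0 := by
  obtain ⟨h1, h2⟩ := passage_vline hl h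
  simp [leftTurn, h1, h2]

theorem leftTurn_out {t : ℕ} {l : Layer} {leg : Leg} (hl : T[t]? = some l)
    (h : l.gen.HasLeg leg) :
    leftTurn T (leg.out t l.left).rev = turn leg (l.gen.leftmost leg) := by
  simp [leftTurn, passage_out hl h]

/-- On a side of the generator with two ends, the middle gap meets no connection of the layer; on a
side with none, one gap meets two. These discrepancies are the leftmost half turns at the generator:
`1` seen from a middle gap, `-1` seen from outside a maximum or minimum. -/
theorem IsTangle.layerTurn_eq (hT : IsTangle 1 T 1) (f : (gapGraph T).ConnectedComponent) {t : ℕ}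
    (ht : t < T.length) :
    levelGaps T f t + levelGaps T f (t + 1) - 2 * layerEdges T f t = layerTurn T f t := by
  obtain ⟨l, hl⟩ : ∃ l, T[t]? = some l := ⟨_, List.getElem?_eq_getElem ht⟩
  have hw1 := hT.width_eq hl
  have hw2 := width_succ hl
  have hE1 : layerEdges T f t = ∑ g ∈ Finset.range (l.left + 1), gapInd T f t g +
      ∑ h ∈ Finset.range (l.right + 1), gapInd T f t (l.left + l.gen.src + h) := by
    simp [layerEdges, hl]
  have hE2 : layerEdges T f t = ∑ g ∈ Finset.range (l.left + 1), gapInd T f (t + 1) g +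
      ∑ h ∈ Finset.range (l.right + 1), gapInd T f (t + 1) (l.left + l.gen.tgt + h) := by
    rw [hE1]
    congr 1
    · refine Finset.sum_congr rfl fun g hg => ?_
      rw [gapInd, gapInd, gapFace_left hl (by simpa [Nat.lt_succ_iff] using hg)]
    · refine Finset.sum_congr rfl fun h hh => ?_
      rw [gapInd, gapInd, gapFace_right hl (by simpa [Nat.lt_succ_iff] using hh)]
  -- Here `s` is the number of ends of the generator on the level in question; the last summand is
  -- the doubly counted gap or the middle gap.
  have hG : ∀ (s n : ℕ), s = 0 ∨ s = 2 →
      ∑ g ∈ Finset.range (l.left + s + l.right + 1), gapInd T f n g =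
      ∑ g ∈ Finset.range (l.left + 1), gapInd T f n g +
      ∑ h ∈ Finset.range (l.right + 1), gapInd T f n (l.left + s + h) +
      (if s = 0 then - gapInd T f n l.left else gapInd T f n (l.left + 1)) := by
    rintro s n (rfl | rfl)
    · rw [add_assoc, Finset.sum_range_add, Finset.sum_range_succ _ l.left]
      simp
      ring
    · have e : l.left + 2 + l.right + 1 = l.left + 1 + 1 + (l.right + 1) := by ring
      rw [e, Finset.sum_range_add, Finset.sum_range_succ _ (l.left + 1)]
      simp
      ring
  have hU : ∑ j ∈ Finset.range (width T t), faceStep T f ⟨t, j, true⟩ =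
      ∑ i ∈ Finset.range l.gen.src, faceStep T f ⟨t, l.left + i, true⟩ := by
    rw [hw1, Finset.sum_range_add, Finset.sum_range_add, Finset.sum_eq_zero, zero_add,
      add_eq_left]
    · refine Finset.sum_eq_zero fun j hj => ?_
      rw [faceStep, (leftTurn_vline hl (.right j (by simpa using hj))).1, ite_self]
    · intro j hj
      rw [faceStep, (leftTurn_vline hl (.left j (by simpa using hj))).1, ite_self]
  have hD : ∑ j ∈ Finset.range (width T (t + 1)), faceStep T f ⟨t + 1, j, false⟩ =
      ∑ i ∈ Finset.range l.gen.tgt, faceStep T f ⟨t + 1, l.left + i, false⟩ := by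
    rw [hw2, Finset.sum_range_add, Finset.sum_range_add, Finset.sum_eq_zero, zero_add,
      add_eq_left]
    · refine Finset.sum_eq_zero fun j hj => ?_
      have := (leftTurn_vline hl (.right j (by simpa using hj))).2
      simp only [Loc.rev, Bool.not_true] at this
      rw [faceStep, this, ite_self]
    · intro j hj
      have := (leftTurn_vline hl (.left j (by simpa using hj))).2
      simp only [Loc.rev, Bool.not_true] at this
      rw [faceStep, this, ite_self]
  have hlow := fun leg h => leftTurn_out (leg := leg) hl h
  have hs1 : l.gen.src = 0 ∨ l.gen.src = 2 := by cases l.gen <;> simp [Gen.src]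
  have hs2 : l.gen.tgt = 0 ∨ l.gen.tgt = 2 := by cases l.gen <;> simp [Gen.tgt]
  have e1 : levelGaps T f t = layerEdges T f t +
      (if l.gen.src = 0 then - gapInd T f t l.left else gapInd T f t (l.left + 1)) := by
    rw [levelGaps, hw1, hG _ _ hs1, ← hE1]
  have e2 : levelGaps T f (t + 1) = layerEdges T f t +
      (if l.gen.tgt = 0 then - gapInd T f (t + 1) l.left else gapInd T f (t + 1) (l.left + 1)) := by
    rw [levelGaps, hw2, hG _ _ hs2, ← hE2]
  have h1 := gapFace_left hl (le_refl l.left)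
  have h2 := gapFace_right hl (Nat.zero_le l.right)
  rw [e1, e2, layerTurn, hU, hD]
  have h3 := hlow .ll
  have h4 := hlow .lr
  have h5 := hlow .ul
  have h6 := hlow .ur
  rcases l with ⟨a, _ | _ | _ | _, b⟩ <;>
    simp only [Gen.HasLeg, Gen.leftmost, Gen.isCrossing, Leg.cw, Gen.strand, Leg.out,
      Loc.rev, Gen.src, Gen.tgt, turn, Bool.not_true, Bool.not_false, if_true, reduceCtorEq, or_true,
      or_false, forall_const, if_false, Bool.false_eq_true, IsEmpty.forall_iff,
      add_zero, OfNat.ofNat_ne_zero] at h1 h2 h3 h4 h5 h6 ⊢ <;>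
    simp only [Finset.sum_range_succ, Finset.sum_range_zero, faceStep_up, faceStep_down, h3, h4, h5,
      h6, add_zero, zero_add, add_assoc, Nat.reduceAdd]
  · have e : gapInd T f t a = gapInd T f (t + 1) (a + 2) := by rw [gapInd, gapInd, h2]
    rw [e]
    ring
  · have e : gapInd T f t a = gapInd T f (t + 1) a := by rw [gapInd, gapInd, h1]
    rw [e]
    ring
  · ring
  · ring

theorem IsTangle.gapFace_zero (hT : IsTangle 1 T 1) {t : ℕ} (ht : t ≤ T.length) :
    gapFace T (t, 0) = gapFace T (0, 0) ∧ gapFace T (t, width T t) = gapFace T (0, 1) := by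
  induction t with
  | zero => exact ⟨rfl, rfl⟩
  | succ t ih =>
    obtain ⟨l, hl⟩ : ∃ l, T[t]? = some l := ⟨_, List.getElem?_eq_getElem (by omega)⟩
    obtain ⟨h1, h2⟩ := ih (by omega)
    rw [← h1, ← h2, hT.width_eq hl, width_succ hl]
    exact ⟨(gapFace_left hl (Nat.zero_le _)).symm, (gapFace_right hl le_rfl).symm⟩

theorem gapFace_left_ne_right : gapFace T (0, 0) ≠ gapFace T (0, 1) := fun h => by
  simpa using even_of_gapFace_eq h

open Classical in
/-- The turning number of a face is at most two, and at most zero for the outer faces. -/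
theorem IsTangle.sum_layerTurn_le (hT : IsTangle 1 T 1) (f : (gapGraph T).ConnectedComponent) :
    ∑ t ∈ Finset.range T.length, layerTurn T f t + (if gapFace T (0, 0) = f then 1 else 0) ≤
      faceBound (gapFace T (0, 0)) (gapFace T (0, 1)) f := by
  -- Every level except the first and the last is counted twice. The sum is thus twice the Euler
  -- characteristic minus the gaps on the two end levels, and each end level has one gap in each
  -- outer face.
  have h1 : ∑ t ∈ Finset.range T.length, layerTurn T f t =
      ∑ t ∈ Finset.range T.length, levelGaps T f t +
      ∑ t ∈ Finset.range T.length, levelGaps T f (t + 1) -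
        2 * ∑ t ∈ Finset.range T.length, layerEdges T f t := by
    rw [← Finset.sum_add_distrib, Finset.mul_sum, ← Finset.sum_sub_distrib]
    exact Finset.sum_congr rfl fun t ht => (hT.layerTurn_eq f (by simpa using ht)).symm
  have h2 := hT.euler_le f
  have h3 := Finset.sum_range_succ (levelGaps T f) T.length
  have h4 := Finset.sum_range_succ' (levelGaps T f) T.length
  have h5 : ∀ t ≤ T.length, width T t = 1 → levelGaps T f t =
      (if gapFace T (0, 0) = f then 1 else 0) + (if gapFace T (0, 1) = f then 1 else 0) := by
    intro t ht hw
    obtain ⟨e1, e2⟩ := hT.gapFace_zero ht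
    rw [hw] at e2
    rw [levelGaps, hw, Finset.sum_range_succ, Finset.sum_range_one]
    simp only [gapInd, e1, e2]
  have h6 := h5 0 (Nat.zero_le _) rfl
  have h7 := h5 T.length le_rfl hT.width_length
  have h8 := gapFace_left_ne_right (T := T)
  rw [faceBound]
  by_cases hL : gapFace T (0, 0) = f
  · have hR : ¬ gapFace T (0, 1) = f := fun h => h8 (hL.trans h.symm)
    simp only [hL, hR, if_true, if_false] at h6 h7 ⊢
    omega
  · by_cases hR : gapFace T (0, 1) = f
    · simp only [hL, hR, if_true, if_false, Ne.symm hL] at h6 h7 ⊢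
      omega
    · simp only [hL, hR, if_false, Ne.symm hL, Ne.symm hR] at h6 h7 ⊢
      omega

end BeadPush

namespace BeadPush

/-! ## The cut diagram as a rooted tree -/

variable {T : List Layer} {C : Finset (ℕ × ℕ)}

/-- Adjacency of vertices of the cut diagram. -/
def VAdj (T : List Layer) (C : Finset (ℕ × ℕ)) (v w : Vertex) : Prop :=
  ∃ (hv : v.valid T) (hw : w.valid T), (cutGraph T C).Adj ⟨v, hv⟩ ⟨w, hw⟩

theorem VAdj.symm {v w : Vertex} (h : VAdj T C v w) : VAdj T C w v := by
  obtain ⟨hv, hw, h⟩ := h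
  exact ⟨hw, hv, h.symm⟩

theorem vadj_iff {v w : Vertex} : VAdj T C v w ↔
    v.valid T ∧ w.valid T ∧ v ≠ w ∧ (joined T C v w ∨ joined T C w v) := by
  simp only [VAdj, cutGraph, SimpleGraph.fromRel_adj, exists_prop, ne_eq, Subtype.mk.injEq]

open Classical in
/-- The distance of a vertex from the lower end of the diagram. -/
noncomputable def vdepth (T : List Layer) (C : Finset (ℕ × ℕ)) (v : Vertex) : ℕ :=
  if h : v.valid T then
    (cutGraph T C).dist ⟨.half bottomLoc, start_valid (T := T)⟩ ⟨v, h⟩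
  else 0

/-- `w` is the neighbour of `v` in the direction of the lower end. -/
def VUp (T : List Layer) (C : Finset (ℕ × ℕ)) (v w : Vertex) : Prop :=
  VAdj T C v w ∧ vdepth T C v = vdepth T C w + 1

theorem vdepth_eq {v : Vertex} (h : v.valid T) : vdepth T C v =
    (cutGraph T C).dist ⟨.half bottomLoc, start_valid (T := T)⟩ ⟨v, h⟩ := dif_pos h

/-- In a tree adjacent vertices are never equally far from the root. -/
theorem IsTreeCut.up_or_up (hC : IsTreeCut T C) {v w : Vertex} (h : VAdj T C v w) :
    VUp T C v w ∨ VUp T C w v := by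
  have h0 := h
  obtain ⟨hv, hw, h⟩ := h
  have h1 := hC.2.dist_ne_of_adj ⟨.half bottomLoc, start_valid (T := T)⟩ h
  have h2 := h.diff_dist_adj (u := ⟨.half bottomLoc, start_valid (T := T)⟩)
  rw [VUp, VUp, vdepth_eq hv, vdepth_eq hw]
  rcases h2 with h2 | h2 | h2
  · exact absurd h2.symm h1
  · exact Or.inr ⟨h0.symm, h2⟩
  · refine Or.inl ⟨h0, ?_⟩
    omega

theorem IsTreeCut.exists_up (hC : IsTreeCut T C) {v : Vertex} (hv : v.valid T)
    (h : v ≠ .half bottomLoc) : ∃ w, VUp T C v w := by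
  obtain ⟨p, hp⟩ := hC.2.connected.exists_walk_length_eq_dist ⟨v, hv⟩
    ⟨.half bottomLoc, start_valid (T := T)⟩
  cases p with
  | nil => exact absurd rfl h
  | @cons _ w _ hadj p =>
    refine ⟨w.1, ⟨hv, w.2, hadj⟩, ?_⟩
    rw [vdepth_eq hv, vdepth_eq w.2]
    rw [SimpleGraph.Walk.length_cons, SimpleGraph.dist_comm] at hp
    have h1 := SimpleGraph.dist_le p
    rw [SimpleGraph.dist_comm] at h1
    have h2 := hadj.diff_dist_adj (u := ⟨.half bottomLoc, start_valid (T := T)⟩)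
    rcases h2 with h2 | h2 | h2 <;> simp only [Subtype.coe_eta] at * <;> omega

-- Two parents would extend to two paths to the root with different second vertices, contrary to
-- acyclicity.
open Classical in
theorem IsTreeCut.up_unique (hC : IsTreeCut T C) {v u w : Vertex} (hu : VUp T C v u)
    (hw : VUp T C v w) : u = w := by
  obtain ⟨⟨hv, hu', hau⟩, hdu⟩ := hu
  obtain ⟨⟨_, hw', haw⟩, hdw⟩ := hw
  rw [vdepth_eq hv, vdepth_eq hu'] at hdu
  rw [vdepth_eq hv, vdepth_eq hw'] at hdw
  by_contra hne
  set r : {v : Vertex // v.valid T} := ⟨.half bottomLoc, start_valid (T := T)⟩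
  have key : ∀ {x : {v : Vertex // v.valid T}}, (cutGraph T C).Adj ⟨v, hv⟩ x →
      (cutGraph T C).dist r ⟨v, hv⟩ = (cutGraph T C).dist r x + 1 →
      ∃ p : (cutGraph T C).Path ⟨v, hv⟩ r, x ∈ p.1.support ∧ p.1.snd = x := by
    intro x hx hd
    obtain ⟨p, hp, hpl⟩ := hC.2.connected.exists_path_of_dist x r
    have hnot : (⟨v, hv⟩ : {v : Vertex // v.valid T}) ∉ p.support := by
      intro hmem
      have h1 := SimpleGraph.dist_le (p.dropUntil _ hmem)
      have h2 := p.length_dropUntil_le_length hmem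
      rw [SimpleGraph.dist_comm, hd] at h1
      rw [SimpleGraph.dist_comm] at hpl
      omega
    exact ⟨⟨.cons hx p, hp.cons hnot⟩, by simp, by simp⟩
  obtain ⟨p, -, hp⟩ := key hau hdu
  obtain ⟨q, -, hq⟩ := key haw hdw
  rw [(hC.2.isAcyclic.subsingleton_path _ _).elim p q, hq] at hp
  exact hne (congrArg Subtype.val hp).symm

theorem vadj_rev {x : Loc} (hx : x.Valid T) (h : x.point ∉ C) :
    VAdj T C (.half x) (.half x.rev) :=
  vadj_iff.2 ⟨hx, hx, fun e => Loc.rev_ne x (Vertex.half.inj e).symm, Or.inl (Or.inl ⟨rfl, h⟩)⟩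

theorem VLine.level_eq {t : ℕ} {l : Layer} {x y : Loc} (h : VLine t l x y) :
    x.level = t ∧ y.level = t + 1 := by
  cases h <;> exact ⟨rfl, rfl⟩

theorem IsTangle.level_ne_of_plain (hT : IsTangle 1 T 1) {x y : Loc} (hx : x.Valid T)
    (h : passage T x = .plain y) : y.level ≠ x.level := by
  obtain ⟨t, l, -, h' | h'⟩ := hT.passage_plain hx h
  · have := h'.level_eq
    omega
  · have := h'.level_eq
    simp only [Loc.rev] at this
    omega

theorem IsTangle.vadj_plain (hT : IsTangle 1 T 1) {x y : Loc} (hx : x.Valid T)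
    (h : passage T x = .plain y) : VAdj T C (.half x) (.half y.rev) := by
  refine vadj_iff.2 ⟨hx, (hT.passage_plain_rev hx h).1, fun e => ?_, Or.inl (Or.inr ?_)⟩
  · exact hT.level_ne_of_plain hx h (congrArg Loc.level (Vertex.half.inj e)).symm
  · rw [Loc.rev_rev, h]

theorem IsTangle.vadj_node (hT : IsTangle 1 T 1) {x : Loc} (hx : x.Valid T) {t : ℕ} {l : Layer}
    {leg : Leg} (h : passage T x = .node t l leg) : VAdj T C (.half x) (.node t) :=
  vadj_iff.2 ⟨hx, (List.getElem?_eq_some_iff.1 (hT.passage_node hx h).1).1, by simp,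
    Or.inl ⟨l, leg, h⟩⟩

theorem IsTangle.vadj_half_cases (hT : IsTangle 1 T 1) {x : Loc} {v : Vertex}
    (h : VAdj T C (.half x) v) : (x.point ∉ C ∧ v = .half x.rev) ∨
      (∃ y, passage T x = .plain y ∧ v = .half y.rev) ∨
      ∃ t l leg, passage T x = .node t l leg ∧ v = .node t := by
  obtain ⟨hx, hv, -, h⟩ := vadj_iff.1 h
  cases v with
  | half y =>
    rcases h with (⟨e, h'⟩ | h') | (⟨e, h'⟩ | h')
    · exact Or.inl ⟨h', by rw [e]⟩
    · exact Or.inr (Or.inl ⟨_, h', by simp⟩)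
    · refine Or.inl ⟨?_, by simp [e]⟩
      rwa [e, Loc.point_rev]
    · refine Or.inr (Or.inl ⟨y.rev, ?_, by simp⟩)
      have := (hT.passage_plain_rev hv h').2
      simpa using this
  | node t =>
    rcases h with ⟨l, leg, h⟩ | h
    · exact Or.inr (Or.inr ⟨t, l, leg, h, rfl⟩)
    · exact h.elim

theorem vadj_node_cases {t : ℕ} {v : Vertex}
    (h : VAdj T C (.node t) v) : ∃ x l leg, x.Valid T ∧ passage T x = .node t l leg ∧
      v = .half x := by
  obtain ⟨-, hv, -, h⟩ := vadj_iff.1 h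
  cases v with
  | half y =>
    rcases h with h | ⟨l, leg, h⟩
    · exact h.elim
    · exact ⟨y, l, leg, hv, h, rfl⟩
  | node t => rcases h with h | h <;> exact h.elim

theorem finite_valid (T : List Layer) : {v : Vertex | v.valid T}.Finite := by
  have : {v : Vertex | v.valid T} ⊆
      ((fun q : (ℕ × ℕ) × Bool => Vertex.half ⟨q.1.1, q.1.2, q.2⟩) ''
        ((points T ×ˢ Finset.univ : Finset ((ℕ × ℕ) × Bool)) : Set ((ℕ × ℕ) × Bool))) ∪
      (Vertex.node '' (Finset.range T.length : Set ℕ)) := by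
    rintro (x | t) h
    · exact Or.inl ⟨(x.point, x.up), by simpa using (show x.point ∈ points T from h), rfl⟩
    · exact Or.inr ⟨t, by simpa using (show t < T.length from h), rfl⟩
  exact ((Finset.finite_toSet _).image _ |>.union ((Finset.finite_toSet _).image _)).subset this

/-- The bound serves as fuel for `pushOut` and `contour`. -/
theorem exists_vdepth_lt (T : List Layer) (C : Finset (ℕ × ℕ)) : ∃ N, ∀ v, vdepth T C v < N := by
  obtain ⟨N, hN⟩ := ((finite_valid T).image (vdepth T C)).bddAbove
  refine ⟨N + 1, fun v => ?_⟩
  by_cases hv : v.valid T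
  · exact Nat.lt_succ_of_le (hN ⟨v, hv, rfl⟩)
  · simp [vdepth, hv]

/-- `w` is reached from `v` in the direction of the lower end. -/
def VAbove (T : List Layer) (C : Finset (ℕ × ℕ)) : Vertex → Vertex → Prop :=
  Relation.ReflTransGen (VUp T C)

theorem VAbove.depth_le {v w : Vertex} (h : VAbove T C v w) : vdepth T C w ≤ vdepth T C v := by
  induction h with
  | refl => rfl
  | tail _ h ih =>
    have := h.2
    omega

theorem VAbove.eq_of_depth {v w : Vertex} (h : VAbove T C v w)
    (hd : vdepth T C w = vdepth T C v) : v = w := by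
  rcases Relation.ReflTransGen.cases_head h with rfl | ⟨u, h1, h2⟩
  · rfl
  · have := VAbove.depth_le h2
    have := h1.2
    omega

/-- The ancestors of a vertex form a chain on which the depth is injective. This separates the
subtrees of siblings. -/
theorem IsTreeCut.above_unique (hC : IsTreeCut T C) {v u w : Vertex} (hu : VAbove T C v u)
    (hw : VAbove T C v w) (hd : vdepth T C u = vdepth T C w) : u = w := by
  rcases Relation.ReflTransGen.total_of_right_unique (r := VUp T C)
    (fun a b c h h' => hC.up_unique h h') hu hw with h | h
  · exact VAbove.eq_of_depth h hd.symm
  · exact (VAbove.eq_of_depth h hd).symm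

/-! ## Pushing through the tree -/

/-- The results of pushing a bead at `x`: the positions of the new beads, the changes of the
exponent and the extensions of the label. There are none if nothing can be pushed. -/
def kids (T : List Layer) (C : Finset (ℕ × ℕ)) (x : Loc) : List (Loc × ℤ × List ℕ) :=
  if x.point ∈ C then [] else
    match passage T x with
    | .exit => []
    | .plain y => [(y, 0, [])]
    | .node t l leg =>
      if l.gen.isCrossing then
        [(leg.cw.out t l.left, turn leg leg.cw, [1]),
          (leg.cw.cw.out t l.left, turn leg leg.cw.cw, [2]),
          (leg.cw.cw.cw.out t l.left, turn leg leg.cw.cw.cw, [3])]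
      else [((l.gen.strand leg).out t l.left, turn leg (l.gen.strand leg), [])]

/-- The bead that results from a bead by one of the moves of `kids`. -/
def Bead.step (b : Bead) (k : Loc × ℤ × List ℕ) : Bead := ⟨k.1, b.pow + k.2.1, b.label ++ k.2.2⟩

/-- Where beads go depends only on the position; exponents and labels are carried along. The tree
arguments can therefore be made for positions. -/
theorem advance_eq_some {b : Bead} {bs : List Bead} : advance T C b = some bs ↔
    kids T C b.loc ≠ [] ∧ bs = (kids T C b.loc).map b.step := by
  unfold advance kids
  split_ifs with h
  · simp
  · cases passage T b.loc with
    | exit => simp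
    | plain y => simp [Bead.step, eq_comm]
    | node t l leg =>
      by_cases hc : l.gen.isCrossing <;> simp [Bead.step, pushNode, sendBead, hc, eq_comm (b := bs)]

theorem kids_eq_nil {x : Loc} : kids T C x = [] ↔ x.point ∈ C ∨ passage T x = .exit := by
  unfold kids
  split_ifs with h
  · simp [h]
  · cases passage T x with
    | exit => simp
    | plain y => simp [h]
    | node t l leg => by_cases hc : l.gen.isCrossing <;> simp [hc, h]

theorem Gen.leg_cases {g : Gen} {leg leg' : Leg} (h : g.HasLeg leg) (h' : g.HasLeg leg')
    (hne : leg' ≠ leg) :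
    if g.isCrossing then leg' = leg.cw ∨ leg' = leg.cw.cw ∨ leg' = leg.cw.cw.cw
      else leg' = g.strand leg := by
  cases g <;> cases leg <;> cases leg' <;>
    simp [HasLeg, isCrossing, Leg.cw, strand] at h h' hne ⊢

theorem IsTangle.mem_kids (hT : IsTangle 1 T 1) {x : Loc} (hx : x.Valid T)
    {k : Loc × ℤ × List ℕ} (hk : k ∈ kids T C x) : x.point ∉ C ∧ (passage T x = .plain k.1 ∨
      ∃ t l leg leg', passage T x = .node t l leg ∧ l.gen.HasLeg leg' ∧ leg' ≠ leg ∧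
        k.1 = leg'.out t l.left) := by
  unfold kids at hk
  split_ifs at hk with h
  · simp at hk
  refine ⟨h, ?_⟩
  cases hp : passage T x with
  | exit => simp [hp] at hk
  | plain y =>
    left
    simp only [hp, List.mem_singleton] at hk
    rw [hk]
  | node t l leg =>
    right
    have hleg := (hT.passage_node hx hp).2.1
    simp only [hp] at hk
    rcases l with ⟨a, _ | _ | _ | _, b⟩ <;>
      simp [Gen.isCrossing, Gen.HasLeg] at hk hleg
    · rcases hleg with rfl | rfl
      · exact ⟨t, _, _, .ur, rfl, Or.inr rfl, by simp, by rw [hk]; rfl⟩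
      · exact ⟨t, _, _, .ul, rfl, Or.inl rfl, by simp, by rw [hk]; rfl⟩
    · rcases hleg with rfl | rfl
      · exact ⟨t, _, _, .lr, rfl, Or.inr rfl, by simp, by rw [hk]; rfl⟩
      · exact ⟨t, _, _, .ll, rfl, Or.inl rfl, by simp, by rw [hk]; rfl⟩
    all_goals
      rcases hk with rfl | rfl | rfl <;>
        exact ⟨t, _, _, _, rfl, trivial, by cases leg <;> simp [Leg.cw], rfl⟩

theorem IsTangle.exists_kid (hT : IsTangle 1 T 1) {x : Loc} (hx : x.Valid T) (hxC : x.point ∉ C)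
    {t : ℕ} {l : Layer} {leg leg' : Leg} (hp : passage T x = .node t l leg)
    (hleg' : l.gen.HasLeg leg') (hne : leg' ≠ leg) :
    ∃ k ∈ kids T C x, k.1 = leg'.out t l.left := by
  have := Gen.leg_cases (hT.passage_node hx hp).2.1 hleg' hne
  unfold kids
  rw [if_neg hxC, hp]
  simp only
  split_ifs at this ⊢ with hc
  · rcases this with rfl | rfl | rfl <;> simp
  · simp [this]

theorem kids_of_plain {x y : Loc} (hxC : x.point ∉ C) (hp : passage T x = .plain y) :
    kids T C x = [(y, 0, [])] := by simp [kids, hxC, hp]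

theorem IsTangle.kid_valid (hT : IsTangle 1 T 1) {x : Loc} (hx : x.Valid T)
    {k : Loc × ℤ × List ℕ} (hk : k ∈ kids T C x) : k.1.Valid T := by
  rcases hT.mem_kids hx hk with ⟨-, h | ⟨t, l, leg, leg', h, h1, -, h2⟩⟩
  · exact (hT.passage_plain_rev hx h).1
  · rw [h2]
    exact hT.valid_out (hT.passage_node hx h).1 h1

theorem IsTangle.passage_kid_rev (hT : IsTangle 1 T 1) {x : Loc} (hx : x.Valid T)
    {k : Loc × ℤ × List ℕ} (hk : k ∈ kids T C x) : passage T k.1.rev ≠ .exit := by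
  rcases hT.mem_kids hx hk with ⟨-, h | ⟨t, l, leg, leg', h, h1, -, h2⟩⟩
  · rw [(hT.passage_plain_rev hx h).2]; simp
  · rw [h2, passage_out (hT.passage_node hx h).1 h1]; simp

/-- `x` is a valid position at which a bead can arrive when it is pushed away from the lower
end of the tree. -/
def Outward (T : List Layer) (C : Finset (ℕ × ℕ)) (x : Loc) : Prop :=
  x.Valid T ∧ (x.point ∉ C → VUp T C (.half x) (.half x.rev))

section

variable (hT : IsTangle 1 T 1) (hC : IsTreeCut T C)
include hT hC

/-- The outer half of an end point has only the other half as a possible neighbour, so a cut there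
would isolate it and disconnect the tree. -/
theorem IsTreeCut.not_mem_of_exit {x : Loc} (hx : x.Valid T) (h : passage T x = .exit) :
    x.point ∉ C := by
  intro hxC
  have hiso : ∀ v, ¬ VAdj T C (.half x) v := by
    intro v hv
    rcases hT.vadj_half_cases hv with ⟨h', _⟩ | ⟨y, h', _⟩ | ⟨t, l, leg, h', _⟩
    · exact h' hxC
    · rw [h] at h'; cases h'
    · rw [h] at h'; cases h'
  by_cases hroot : Vertex.half x = .half bottomLoc
  · have hne : Vertex.half x.rev ≠ .half bottomLoc := by
      rw [← hroot]
      exact fun e => Loc.rev_ne x (Vertex.half.inj e)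
    have hreach := hC.2.connected.preconnected ⟨.half x, hx⟩ ⟨.half x.rev, hx⟩
    obtain ⟨p⟩ := hreach
    have hnil : ¬ p.Nil := SimpleGraph.Walk.not_nil_of_ne fun e =>
      hne ((congrArg Subtype.val e).symm.trans hroot)
    exact hiso _ ⟨hx, p.snd.2, p.adj_snd hnil⟩
  · obtain ⟨w, hw⟩ := hC.exists_up (v := .half x) hx hroot
    exact hiso w hw.1

omit hT in
theorem IsTreeCut.outward_start : Outward T C ⟨0, 0, true⟩ := by
  refine ⟨start_valid, fun h => ?_⟩
  have hadj := vadj_rev (x := ⟨0, 0, true⟩) (T := T) (C := C) start_valid h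
  rcases hC.up_or_up hadj with h' | h'
  · exact h'
  · have h1 := h'.2
    have h2 : vdepth T C (.half (Loc.rev ⟨0, 0, true⟩)) = 0 := by
      rw [vdepth_eq (v := .half (Loc.rev ⟨0, 0, true⟩)) (start_valid (T := T))]
      exact SimpleGraph.dist_self
    omega

omit hT hC in
theorem vdepth_bottom : vdepth T C (.half bottomLoc) = 0 := by
  rw [vdepth_eq (v := .half bottomLoc) (start_valid (T := T))]
  exact SimpleGraph.dist_self

omit hT in
/-- A step away from the lower end leads to a vertex from which only the way back leads
towards the lower end. -/
theorem IsTreeCut.up_of_adj {u v w : Vertex} (h : VUp T C v u) (hw : VAdj T C w v) (hne : w ≠ u) :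
    VUp T C w v := by
  rcases hC.up_or_up hw with h' | h'
  · exact h'
  · exact absurd (hC.up_unique h' h) hne

/-- Pushing continues away from the root because the way back is the only edge to a parent. The
equal depth of siblings is recorded for `above_unique`. -/
theorem IsTreeCut.kid_outward {x : Loc} (hx : Outward T C x) {k : Loc × ℤ × List ℕ}
    (hk : k ∈ kids T C x) : Outward T C k.1 ∧ VAbove T C (.half k.1.rev) (.half x) ∧
      vdepth T C (.half k.1.rev) > vdepth T C (.half x) ∧
      ∀ k' ∈ kids T C x, vdepth T C (.half k'.1.rev) = vdepth T C (.half k.1.rev) := by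
  have hv := hT.kid_valid hx.1 hk
  have hout : ∀ {v}, VUp T C (.half k.1.rev) v → v ≠ .half k.1 → Outward T C k.1 := by
    intro v hup hne
    exact ⟨hv, fun hkC => hC.up_of_adj hup (vadj_rev hv hkC) hne.symm⟩
  obtain ⟨hxC, h | ⟨t, l, leg, leg', h, h1, h2, h3⟩⟩ := hT.mem_kids hx.1 hk
  · have hup : VUp T C (.half k.1.rev) (.half x) := by
      refine hC.up_of_adj (hx.2 hxC) (hT.vadj_plain hx.1 h).symm fun e => ?_
      exact hT.level_ne_of_plain hx.1 h
        (congrArg Loc.level (Loc.rev_injective (Vertex.half.inj e)))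
    refine ⟨hout hup fun e => ?_, .single hup, by rw [hup.2]; omega, ?_⟩
    · exact hT.level_ne_of_plain hx.1 h (congrArg Loc.level (Vertex.half.inj e)).symm
    · intro k' hk'
      rw [kids_of_plain hxC h, List.mem_singleton] at hk'
      rw [hk']
  · have hup1 : VUp T C (.node t) (.half x) :=
      hC.up_of_adj (hx.2 hxC) (hT.vadj_node hx.1 h).symm (by simp)
    obtain ⟨hl, hleg, hxe⟩ := hT.passage_node hx.1 h
    have hall : ∀ leg', l.gen.HasLeg leg' → leg' ≠ leg →
        VUp T C (.half (leg'.out t l.left).rev) (.node t) := by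
      intro leg' h1 h2
      refine hC.up_of_adj hup1 (hT.vadj_node
        (Loc.valid_rev.2 (hT.valid_out hl h1)) (passage_out hl h1)) ?_
      intro e
      rw [hxe] at e
      exact h2 (Leg.out_injective (Loc.rev_injective (Vertex.half.inj e)))
    have hup2 := hall leg' h1 h2
    rw [← h3] at hup2
    refine ⟨hout hup2 (by simp), .head hup2 (.single hup1), ?_, ?_⟩
    · rw [hup2.2, hup1.2]
      omega
    · intro k' hk'
      obtain ⟨-, h' | ⟨t', l', leg₁, leg₂, h', h1', h2', h3'⟩⟩ := hT.mem_kids hx.1 hk'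
      · rw [h] at h'; cases h'
      · rw [h] at h'
        cases h'
        rw [hup2.2, h3', (hall leg₂ h1' h2').2]

end

end BeadPush

/-! ### Final beads, the contour of the tree, and confluence -/

namespace BeadPush

variable {T : List Layer} {C : Finset (ℕ × ℕ)}

/-- The final beads into which a bead is pushed, with at most `n` successive pushes. -/
def pushOut (T : List Layer) (C : Finset (ℕ × ℕ)) : ℕ → Bead → List Bead
  | 0, b => [b]
  | n + 1, b => if kids T C b.loc = [] then [b] else
      (kids T C b.loc).flatMap fun k => pushOut T C n (b.step k)

/-- The contour of the subtree beyond a position, followed clockwise. -/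
def contour (T : List Layer) (C : Finset (ℕ × ℕ)) : ℕ → Loc → List Loc
  | 0, _ => []
  | n + 1, x => if kids T C x = [] then [] else
      x :: (kids T C x).flatMap fun k => contour T C n k.1 ++ [k.1.rev]

section

variable (hT : IsTangle 1 T 1) (hC : IsTreeCut T C) {N : ℕ} (hN : ∀ v, vdepth T C v < N)
include hT hC hN

-- A push crosses the point and then at least one further edge of the tree, so depth grows by two or
-- more. This is the measure behind all inductions over pushing.
omit hN in
theorem IsTreeCut.depth_kid {x : Loc} (hx : Outward T C x) {k : Loc × ℤ × List ℕ}
    (hk : k ∈ kids T C x) :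
    vdepth T C (.half x.rev) + 1 < vdepth T C (.half k.1.rev) := by
  have h1 := (hC.kid_outward hT hx hk).2.2.1
  have h2 := (hx.2 (hT.mem_kids hx.1 hk).1).2
  omega

theorem IsTreeCut.outward_induction {P : Loc → Prop}
    (h : ∀ x, Outward T C x → (∀ k ∈ kids T C x, P k.1) → P x) {x : Loc}
    (hx : Outward T C x) : P x := by
  induction hn : N - vdepth T C (.half x.rev) using Nat.strong_induction_on generalizing x with
  | _ n ih =>
    refine h x hx fun k hk => ih _ ?_ (hC.kid_outward hT hx hk).1 rfl
    have h1 := hC.depth_kid hT hx hk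
    have h2 := hN (.half k.1.rev)
    omega

@[elab_as_elim]
theorem IsTreeCut.bead_induction {P : Bead → Prop}
    (h : ∀ b : Bead, Outward T C b.loc → (∀ k ∈ kids T C b.loc, P (b.step k)) → P b) {b : Bead}
    (hb : Outward T C b.loc) : P b :=
  hC.outward_induction hT hN (P := fun x => ∀ b : Bead, b.loc = x → P b)
    (fun _ hx ih b hbx => h b (hbx ▸ hx) fun k hk => ih k (hbx ▸ hk) _ rfl) hb b rfl

/-- Once the fuel and the present depth together reach `N`, the recursion ends before the fuel does,
so its amount is irrelevant. Fuel zero would require a depth of at least `N`. -/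
theorem IsTreeCut.pushOut_stable {b : Bead} (hb : Outward T C b.loc) : ∀ {n m : ℕ},
    N ≤ n + vdepth T C (.half b.loc.rev) → N ≤ m + vdepth T C (.half b.loc.rev) →
    pushOut T C n b = pushOut T C m b := by
  intro n
  induction n generalizing b with
  | zero =>
    intro m h
    have := hN (.half b.loc.rev)
    omega
  | succ n ih =>
    intro m h1 h2
    cases m with
    | zero =>
      have := hN (.half b.loc.rev)
      omega
    | succ m =>
      simp only [pushOut]
      split_ifs with hk
      · rfl
      · refine List.flatMap_congr fun k hk => ?_
        have := hC.depth_kid hT hb hk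
        exact ih (hC.kid_outward hT hb hk).1 (by simp only [Bead.step]; omega)
          (by simp only [Bead.step]; omega)

theorem IsTreeCut.contour_stable {x : Loc} (hx : Outward T C x) : ∀ {n m : ℕ},
    N ≤ n + vdepth T C (.half x.rev) → N ≤ m + vdepth T C (.half x.rev) →
    contour T C n x = contour T C m x := by
  intro n
  induction n generalizing x with
  | zero =>
    intro m h
    have := hN (.half x.rev)
    omega
  | succ n ih =>
    intro m h1 h2
    cases m with
    | zero =>
      have := hN (.half x.rev)
      omega
    | succ m =>
      simp only [contour]
      split_ifs with hk
      · rfl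
      · congr 1
        refine List.flatMap_congr fun k hk => ?_
        have := hC.depth_kid hT hx hk
        rw [ih (hC.kid_outward hT hx hk).1 (m := m) (by omega) (by omega)]

theorem IsTreeCut.pushOut_eq {b : Bead} (hb : Outward T C b.loc) :
    pushOut T C N b = if kids T C b.loc = [] then [b] else
      (kids T C b.loc).flatMap fun k => pushOut T C N (b.step k) := by
  obtain ⟨M, rfl⟩ := Nat.exists_eq_succ_of_ne_zero
    (Nat.ne_of_gt ((Nat.zero_le _).trans_lt (hN (.half b.loc))))
  rw [pushOut]
  split_ifs
  · rfl
  · refine List.flatMap_congr fun k hk => ?_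
    have := hC.depth_kid hT hb hk
    exact hC.pushOut_stable hT hN (hC.kid_outward hT hb hk).1 (by simp only [Bead.step]; omega)
      (by simp only [Bead.step]; omega)

theorem IsTreeCut.contour_eq {x : Loc} (hx : Outward T C x) :
    contour T C N x = if kids T C x = [] then [] else
      x :: (kids T C x).flatMap fun k => contour T C N k.1 ++ [k.1.rev] := by
  obtain ⟨M, rfl⟩ := Nat.exists_eq_succ_of_ne_zero
    (Nat.ne_of_gt ((Nat.zero_le _).trans_lt (hN (.half x))))
  rw [contour]
  split_ifs
  · rfl
  · congr 1
    refine List.flatMap_congr fun k hk => ?_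
    have := hC.depth_kid hT hx hk
    rw [hC.contour_stable hT hN (hC.kid_outward hT hx hk).1 (m := M + 1) (by omega) (by omega)]

theorem IsTreeCut.mem_contour {x : Loc} (hx : Outward T C x) {z : Loc} :
    z ∈ contour T C N x ↔ kids T C x ≠ [] ∧ (z = x ∨
      ∃ k ∈ kids T C x, z ∈ contour T C N k.1 ++ [k.1.rev]) := by
  rw [hC.contour_eq hT hN hx]
  split_ifs with h
  · simp [h]
  · rw [List.mem_cons, List.mem_flatMap]
    simp [h]

/-! ### Confluence -/

omit hT hC hN in
theorem Push.append {l m : List Bead} (h : Relation.ReflTransGen (Push T C) l m)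
    (x y : List Bead) : Relation.ReflTransGen (Push T C) (x ++ l ++ y) (x ++ m ++ y) := by
  refine Relation.ReflTransGen.lift (p := Push T C) (fun l => x ++ l ++ y) ?_ _ _ h
  rintro _ _ ⟨x', b, bs, y', h⟩
  have := Push.mk (x ++ x') b bs (y' ++ y) h
  simpa [Function.onFun] using this

omit hT hC hN in
theorem Push.flatMap {F : Bead → List Bead} : ∀ {l : List Bead},
    (∀ b ∈ l, Relation.ReflTransGen (Push T C) [b] (F b)) →
    Relation.ReflTransGen (Push T C) l (l.flatMap F)
  | [], _ => .refl
  | b :: l, h => by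
    have h1 := Push.append (h b (by simp)) [] l
    have h2 := Push.append (Push.flatMap (l := l) fun c hc => h c (by simp [hc])) (F b) []
    simp only [List.nil_append, List.append_nil, List.singleton_append] at h1 h2
    rw [List.flatMap_cons]
    exact h1.trans h2

theorem IsTreeCut.push_pushOut {b : Bead} (hb : Outward T C b.loc) :
    Relation.ReflTransGen (Push T C) [b] (pushOut T C N b) := by
  refine IsTreeCut.bead_induction hT hC hN ?_ hb
  intro b hx ih
  rw [hC.pushOut_eq hT hN hx]
  split_ifs with hk
  · exact .refl
  · have h1 : Push T C [b] ((kids T C b.loc).map b.step) := by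
      have := Push.mk [] b _ [] (advance_eq_some.2 ⟨hk, rfl⟩)
      simpa using this
    refine .head h1 ?_
    have h2 := Push.flatMap (T := T) (C := C) (F := pushOut T C N)
      (l := (kids T C b.loc).map b.step) ?_
    · rwa [List.flatMap_map] at h2
    · intro c hc
      obtain ⟨k, hk, rfl⟩ := List.mem_map.1 hc
      exact ih k hk

/-- Confluence in the form of an invariant: a push merely performs the first step of `pushOut` on
one bead, so the predicted final position stays the same. -/
theorem IsTreeCut.push_invariant {l m : List Bead} (h : Push T C l m)
    (hl : ∀ b ∈ l, Outward T C b.loc) :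
    (∀ b ∈ m, Outward T C b.loc) ∧
      l.flatMap (pushOut T C N) = m.flatMap (pushOut T C N) := by
  obtain ⟨x, b, bs, y, h⟩ := h
  obtain ⟨hk, rfl⟩ := advance_eq_some.1 h
  have hb := hl b (by simp)
  constructor
  · intro c hc
    simp only [List.mem_append] at hc
    rcases hc with (hc | hc) | hc
    · exact hl c (by simp [hc])
    · obtain ⟨k, hk, rfl⟩ := List.mem_map.1 hc
      exact (hC.kid_outward hT hb hk).1
    · exact hl c (by simp [hc])
  · have h1 := hC.pushOut_eq hT hN hb
    rw [if_neg hk] at h1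
    simp only [List.flatMap_append, List.flatMap_cons, h1, List.flatMap_map, List.append_assoc]

theorem IsTreeCut.push_star_invariant {l m : List Bead}
    (h : Relation.ReflTransGen (Push T C) l m) (hl : ∀ b ∈ l, Outward T C b.loc) :
    (∀ b ∈ m, Outward T C b.loc) ∧
      l.flatMap (pushOut T C N) = m.flatMap (pushOut T C N) := by
  induction h with
  | refl => exact ⟨hl, rfl⟩
  | tail _ h ih =>
    have := hC.push_invariant hT hN h ih.1
    exact ⟨this.1, ih.2.trans this.2⟩

theorem IsTreeCut.pushOut_stopped {b : Bead} (hb : Outward T C b.loc) :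
    ∀ c ∈ pushOut T C N b, Outward T C c.loc ∧ kids T C c.loc = [] := by
  refine IsTreeCut.bead_induction hT hC hN ?_ hb
  intro b hx ih c hc
  rw [hC.pushOut_eq hT hN hx] at hc
  split_ifs at hc with hk
  · rw [List.mem_singleton] at hc
    subst hc
    exact ⟨hx, hk⟩
  · obtain ⟨k, hk, hc⟩ := List.mem_flatMap.1 hc
    exact ih k hk c hc

omit hT hC hN in
theorem kids_of_node {x : Loc} {t : ℕ} {l : Layer} {leg : Leg} (hxC : x.point ∉ C)
    (hp : passage T x = .node t l leg) : kids T C x = if l.gen.isCrossing then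
        [(leg.cw.out t l.left, turn leg leg.cw, [1]),
          (leg.cw.cw.out t l.left, turn leg leg.cw.cw, [2]),
          (leg.cw.cw.cw.out t l.left, turn leg leg.cw.cw.cw, [3])]
      else [((l.gen.strand leg).out t l.left, turn leg (l.gen.strand leg), [])] := by
  simp [kids, hxC, hp]

/-! ### Turning numbers and labels along the contour -/

-- The local pattern of the clockwise walk: the left-hand face passes from the arriving bead to its
-- first successor, from the back of each to the next, and from the back of the last to the back of
-- the arriving bead. The summand `1` is the half turn of reversing on a leg, the one that
-- `beadTurn` adds on the left of a bead.
omit hC hN in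
theorem IsTangle.kids_links {x : Loc} (hx : Loc.Valid T x) : kids T C x = [] ∨
    (∃ k, kids T C x = [k] ∧ faceLab T x = faceLab T k.1 ∧
      faceLab T k.1.rev = faceLab T x.rev ∧ leftTurn T x = k.2.1 ∧
      leftTurn T k.1.rev = -k.2.1 ∧ (Even k.2.1 ↔ k.1.up = x.up)) ∨
    ∃ k₁ k₂ k₃ : Loc × ℤ × List ℕ, kids T C x = [k₁, k₂, k₃] ∧
      k₁.2.2 = [1] ∧ k₂.2.2 = [2] ∧ k₃.2.2 = [3] ∧
      k₁.1 ≠ k₂.1 ∧ k₁.1 ≠ k₃.1 ∧ k₂.1 ≠ k₃.1 ∧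
      faceLab T x = faceLab T k₁.1 ∧ faceLab T k₁.1.rev = faceLab T k₂.1 ∧
      faceLab T k₂.1.rev = faceLab T k₃.1 ∧ faceLab T k₃.1.rev = faceLab T x.rev ∧
      leftTurn T x = k₁.2.1 ∧ leftTurn T k₁.1.rev = k₂.2.1 - k₁.2.1 + 1 ∧
      leftTurn T k₂.1.rev = k₃.2.1 - k₂.2.1 + 1 ∧ leftTurn T k₃.1.rev = -k₃.2.1 ∧
      (Even k₁.2.1 ↔ k₁.1.up = x.up) ∧ (Even k₂.2.1 ↔ k₂.1.up = x.up) ∧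
      (Even k₃.2.1 ↔ k₃.1.up = x.up) := by
  by_cases hxC : x.point ∈ C
  · exact Or.inl (by simp [kids, hxC])
  cases hp : passage T x with
  | exit => exact Or.inl (by simp [kids, hp])
  | plain y =>
    right; left
    refine ⟨_, kids_of_plain hxC hp, ?_⟩
    obtain ⟨t, l, hl, h | h⟩ := hT.passage_plain hx hp
    · obtain ⟨h1, h2⟩ := faceLab_vline hl h
      obtain ⟨h3, h4⟩ := leftTurn_vline hl h
      refine ⟨h1, h2.symm, h3, by simpa using h4, ?_⟩
      cases h <;> simp
    · obtain ⟨h1, h2⟩ := faceLab_vline hl h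
      obtain ⟨h3, h4⟩ := leftTurn_vline hl h
      rw [Loc.rev_rev] at h4 h2
      rw [Loc.rev_rev] at h2
      refine ⟨h2.symm, h1, h4, by simpa using h3, ?_⟩
      have : y.rev.up = x.rev.up := by
        generalize y.rev = u at h
        generalize x.rev = v at h
        cases h <;> rfl
      simpa using this
  | node t l leg =>
    right
    obtain ⟨hl, hleg, rfl⟩ := hT.passage_node hx hp
    have hlab := fun g h => faceLab_leftmost (leg := g) hl h
    have hturn := fun g h => leftTurn_out (leg := g) hl h
    by_cases hc : l.gen.isCrossing = true
    · right
      have hall : ∀ g, l.gen.HasLeg g := by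
        intro g
        revert hc
        cases l.gen <;> simp [Gen.HasLeg, Gen.isCrossing]
      have hcw : ∀ g, l.gen.leftmost g = g.cw := fun g => by simp [Gen.leftmost, hc]
      have h4 : leg.cw.cw.cw.cw = leg := by cases leg <;> rfl
      refine ⟨_, _, _, (kids_of_node hxC hp).trans (if_pos hc), rfl, rfl, rfl, ?_, ?_, ?_, ?_, ?_,
        ?_, ?_, ?_, ?_, ?_, ?_, ?_, ?_, ?_⟩
      · intro h; have := Leg.out_injective h; cases leg <;> simp [Leg.cw] at this
      · intro h; have := Leg.out_injective h; cases leg <;> simp [Leg.cw] at this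
      · intro h; have := Leg.out_injective h; cases leg <;> simp [Leg.cw] at this
      · rw [hlab _ (hall _), hcw]
      · rw [hlab _ (hall _), hcw]
      · rw [hlab _ (hall _), hcw]
      · rw [hlab _ (hall _), hcw, h4, Loc.rev_rev]
      · rw [hturn _ (hall _), hcw]
      · rw [hturn _ (hall _), hcw]; cases leg <;> rfl
      · rw [hturn _ (hall _), hcw]; cases leg <;> rfl
      · rw [hturn _ (hall _), hcw]; cases leg <;> rfl
      · cases leg <;> simp [Leg.cw, turn, Leg.out, Loc.rev]
      · cases leg <;> simp [Leg.cw, turn, Leg.out, Loc.rev]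
      · cases leg <;> simp [Leg.cw, turn, Leg.out, Loc.rev]
    · left
      have hlm : ∀ g, l.gen.leftmost g = l.gen.strand g := fun g => by simp [Gen.leftmost, hc]
      have hs : l.gen.HasLeg (l.gen.strand leg) ∧ l.gen.strand (l.gen.strand leg) = leg := by
        revert hc hleg
        cases l.gen <;> cases leg <;> simp [Gen.HasLeg, Gen.isCrossing, Gen.strand]
      refine ⟨_, (kids_of_node hxC hp).trans (if_neg hc), ?_, ?_, ?_, ?_, ?_⟩
      · rw [hlab _ hleg, hlm]
      · rw [hlab _ hs.1, hlm, hs.2, Loc.rev_rev]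
      · rw [hturn _ hleg, hlm]
      · rw [hturn _ hs.1, hlm, hs.2, turn_swap]
      · revert hc hleg
        cases l.gen <;> cases leg <;>
          simp [Gen.HasLeg, Gen.isCrossing, Gen.strand, turn, Leg.out, Loc.rev]

omit hT hC hN in
theorem beadTurn_step {Φ : Type*} {lab : Loc → Φ} (f : Φ) (b : Bead) (k : Loc × ℤ × List ℕ)
    [Decidable (lab k.1 = f)] [Decidable (lab k.1.rev = f)] :
    beadTurn lab f (b.step k) = (if lab k.1 = f then b.pow + k.2.1 + 1 else 0) -
      (if lab k.1.rev = f then b.pow + k.2.1 else 0) := by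
  unfold beadTurn
  congr

-- Induction over the tree. The half turns of the walk telescope to differences of exponents, so the
-- turning along each face is read off from the final beads and the initial one. Label order and
-- parity propagate in the same induction.
open Classical in
theorem IsTreeCut.pushOut_linked {b : Bead} (hb : Outward T C b.loc) :
    Linked (faceLab T) (faceLab T b.loc) (pushOut T C N b) (faceLab T b.loc.rev) ∧
    (∀ f, ((contour T C N b.loc).map (faceStep T f)).sum =
      faceTurn (faceLab T) f (pushOut T C N b) - beadTurn (faceLab T) f b) ∧
    (∀ c ∈ pushOut T C N b, b.label <+: c.label) ∧
    (pushOut T C N b).Pairwise (fun c d => c.label < d.label) ∧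
    ((b.loc.up = true ↔ Even b.pow) → ∀ c ∈ pushOut T C N b, (c.loc.up = true ↔ Even c.pow)) := by
  refine IsTreeCut.bead_induction hT hC hN ?_ hb
  intro b hx ih
  rw [hC.pushOut_eq hT hN hx, hC.contour_eq hT hN hx]
  rcases hT.kids_links hx.1 with h0 | ⟨k, h0, h1, h2, h3, h4, h5⟩ |
    ⟨k₁, k₂, k₃, h0, l1, l2, l3, -, -, -, e1, e2, e3, e4, t1, t2, t3, t4, p1, p2, p3⟩
  · rw [if_pos h0, if_pos h0]
    simp [Linked]
  · rw [h0] at ih ⊢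
    obtain ⟨i1, i2, i3, i4, i5⟩ := ih k (by simp)
    simp only [List.cons_ne_nil, if_false, List.flatMap_cons, List.flatMap_nil, List.append_nil]
    refine ⟨?_, ?_, ?_, i4, ?_⟩
    · rw [h1, ← h2]
      exact i1
    · intro f
      have i2' : (List.map (faceStep T f) (contour T C N k.1)).sum = _ := i2 f
      rw [List.map_cons, List.sum_cons, List.map_append, List.sum_append, i2', beadTurn_step]
      simp only [beadTurn, faceStep, List.map_cons, List.map_nil, List.sum_cons, List.sum_nil,
        h1, h2, h3, h4]
      split_ifs <;> ring
    · intro c hc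
      exact (List.prefix_append _ _).trans (i3 c hc)
    · intro hp
      refine i5 ?_
      simp only [Bead.step, Int.even_add, h5]
      cases hk : k.1.up <;> cases hx : b.loc.up <;> simp_all
  · rw [h0] at ih ⊢
    obtain ⟨i1, i2, i3, i4, i5⟩ := ih k₁ (by simp)
    obtain ⟨j1, j2, j3, j4, j5⟩ := ih k₂ (by simp)
    obtain ⟨m1, m2, m3, m4, m5⟩ := ih k₃ (by simp)
    simp only [List.cons_ne_nil, if_false, List.flatMap_cons, List.flatMap_nil, List.append_nil]
    -- Labels in different branches are compared at the entry where the branches part.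
    have hlt : ∀ {i j : ℕ} {u v : List ℕ}, i < j → b.label ++ [i] <+: u → b.label ++ [j] <+: v →
        u < v := by
      rintro i j _ _ hij ⟨u, rfl⟩ ⟨v, rfl⟩
      rw [List.append_assoc, List.append_assoc]
      exact List.append_left_lt (List.cons_lt_cons_iff.2 (Or.inl hij))
    replace i3 : ∀ c ∈ pushOut T C N (b.step k₁), b.label ++ [1] <+: c.label := by
      rw [← l1]
      exact i3
    replace j3 : ∀ c ∈ pushOut T C N (b.step k₂), b.label ++ [2] <+: c.label := by
      rw [← l2]
      exact j3
    replace m3 : ∀ c ∈ pushOut T C N (b.step k₃), b.label ++ [3] <+: c.label := by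
      rw [← l3]
      exact m3
    refine ⟨?_, ?_, ?_, ?_, ?_⟩
    · rw [linked_append]
      refine ⟨_, by rw [e1]; exact i1, ?_⟩
      rw [linked_append]
      refine ⟨_, by rw [show faceLab T (b.step k₁).loc.rev = _ from e2]; exact j1, ?_⟩
      rw [← e4, show faceLab T (b.step k₂).loc.rev = _ from e3]
      exact m1
    · intro f
      have i2' : (List.map (faceStep T f) (contour T C N k₁.1)).sum = _ := i2 f
      have j2' : (List.map (faceStep T f) (contour T C N k₂.1)).sum = _ := j2 f
      have m2' : (List.map (faceStep T f) (contour T C N k₃.1)).sum = _ := m2 f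
      simp only [List.map_cons, List.sum_cons, List.map_append, List.sum_append, i2', j2', m2',
        faceTurn_append, beadTurn_step]
      simp only [beadTurn, faceStep, List.map_nil, List.sum_nil, e1, e2, e3, e4, t1, t2, t3, t4]
      split_ifs <;> ring
    · intro c hc
      simp only [List.mem_append] at hc
      rcases hc with hc | hc | hc
      · exact (List.prefix_append _ _).trans (i3 c hc)
      · exact (List.prefix_append _ _).trans (j3 c hc)
      · exact (List.prefix_append _ _).trans (m3 c hc)
    · rw [List.pairwise_append, List.pairwise_append]
      refine ⟨i4, ⟨j4, m4, ?_⟩, ?_⟩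
      · intro c hc d hd
        exact hlt (by norm_num) (j3 c hc) (m3 d hd)
      · intro c hc d hd
        rcases List.mem_append.1 hd with hd | hd
        · exact hlt (by norm_num) (i3 c hc) (j3 d hd)
        · exact hlt (by norm_num) (i3 c hc) (m3 d hd)
    · intro hp c hc
      have key : ∀ k : Loc × ℤ × List ℕ, (Even k.2.1 ↔ k.1.up = b.loc.up) →
          ((b.step k).loc.up = true ↔ Even (b.step k).pow) := by
        intro k h
        simp only [Bead.step, Int.even_add, h]
        cases hk : k.1.up <;> cases hx : b.loc.up <;> simp_all
      simp only [List.mem_append] at hc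
      rcases hc with hc | hc | hc
      · exact i5 (key _ p1) c hc
      · exact j5 (key _ p2) c hc
      · exact m5 (key _ p3) c hc

end

end BeadPush

namespace BeadPush

variable {T : List Layer} {C : Finset (ℕ × ℕ)}

/-! ### The contour visits everything once -/

/-- The contour beyond a bead, including the step back over its point. -/
def Bead.trail (T : List Layer) (C : Finset (ℕ × ℕ)) (N : ℕ) (b : Bead) : List Loc :=
  contour T C N b.loc ++ [b.loc.rev]

section

variable (hT : IsTangle 1 T 1) (hC : IsTreeCut T C) {N : ℕ} (hN : ∀ v, vdepth T C v < N)
include hT hC hN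

/-- The walk stays inside the subtree beyond its starting point. -/
theorem IsTreeCut.above_of_mem_contour {x : Loc} (hx : Outward T C x) :
    ∀ z ∈ contour T C N x ++ [x.rev], VAbove T C (.half z) (.half x.rev) := by
  refine hC.outward_induction hT hN (P := fun x => ∀ z ∈ contour T C N x ++ [x.rev],
    VAbove T C (.half z) (.half x.rev)) ?_ hx
  intro x hx ih z hz
  rcases List.mem_append.1 hz with hz | hz
  · rw [hC.mem_contour hT hN hx] at hz
    obtain ⟨hk, rfl | ⟨k, hk, hz⟩⟩ := hz
    · exact .single (hx.2 fun h => hk (kids_eq_nil.2 (Or.inl h)))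
    · obtain ⟨-, h1, -⟩ := hC.kid_outward hT hx hk
      have h2 : VUp T C (.half x) (.half x.rev) := hx.2 (hT.mem_kids hx.1 hk).1
      exact (ih k hk z hz).trans (h1.tail h2)
  · rw [List.mem_singleton.1 hz]
    exact .refl

/-- Sibling branches are disjoint because a common vertex would have two ancestors of equal depth.
The two passages over the point of `x` lie nearer to the root than all others. -/
theorem IsTreeCut.nodup_contour {x : Loc} (hx : Outward T C x) :
    (contour T C N x ++ [x.rev]).Nodup := by
  refine hC.outward_induction hT hN (P := fun x => (contour T C N x ++ [x.rev]).Nodup) ?_ hx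
  intro x hx ih
  by_cases hk : kids T C x = []
  · rw [hC.contour_eq hT hN hx, if_pos hk]
    simp
  have hxC : x.point ∉ C := fun h => hk (kids_eq_nil.2 (Or.inl h))
  have hup := hx.2 hxC
  have hfar : ∀ k ∈ kids T C x, ∀ z ∈ contour T C N k.1 ++ [k.1.rev],
      vdepth T C (.half x) < vdepth T C (.half z) := by
    intro k hk z hz
    obtain ⟨h1, -, h2, -⟩ := hC.kid_outward hT hx hk
    exact h2.trans_le (hC.above_of_mem_contour hT hN h1 z hz).depth_le
  have hne : (kids T C x).Pairwise fun k k' => k.1 ≠ k'.1 := by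
    rcases hT.kids_links (C := C) hx.1 with h0 | ⟨k, h0, -⟩ |
      ⟨k₁, k₂, k₃, h0, -, -, -, n1, n2, n3, -⟩
    · exact absurd h0 hk
    · rw [h0]; simp
    · rw [h0]; simp [n1, n2, n3]
  rw [hC.contour_eq hT hN hx, if_neg hk, List.cons_append, List.nodup_cons, List.nodup_append]
  refine ⟨?_, ?_, by simp, ?_⟩
  · simp only [List.mem_append, List.mem_flatMap, List.mem_singleton, not_or, not_exists, not_and]
    refine ⟨fun k hk => ?_, fun h => Loc.rev_ne x h.symm⟩
    rw [← not_or]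
    intro h
    exact lt_irrefl _ (hfar k hk x (by simpa using h))
  · rw [List.nodup_flatMap]
    refine ⟨fun k hk => ih k hk, ?_⟩
    refine List.Pairwise.imp_of_mem ?_ hne
    intro k k' hk hk' h z hz hz'
    obtain ⟨h1, -, -, h2⟩ := hC.kid_outward hT hx hk
    have e := hC.above_unique (hC.above_of_mem_contour hT hN h1 z hz)
      (hC.above_of_mem_contour hT hN (hC.kid_outward hT hx hk').1 z hz') (h2 k' hk').symm
    exact h (Loc.rev_injective (Vertex.half.inj e))
  · intro z hz w hw
    rw [List.mem_singleton.1 hw]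
    rintro rfl
    obtain ⟨k, hk, hz⟩ := List.mem_flatMap.1 hz
    have := hfar k hk _ hz
    have := hup.2
    omega

theorem IsTreeCut.trail_step {b : Bead} (hb : Outward T C b.loc) (hk : kids T C b.loc ≠ []) :
    b.trail T C N =
      b.loc :: (((kids T C b.loc).map b.step).flatMap (Bead.trail T C N)) ++ [b.loc.rev] := by
  rw [Bead.trail, hC.contour_eq hT hN hb, if_neg hk, List.flatMap_map]
  rfl

/-- A push removes from the trails exactly the two passages over the point of the pushed bead.
Trails of all beads present at one time therefore remain disjoint, which prevents collisions. -/
theorem IsTreeCut.trail_push {l m : List Bead} (h : Push T C l m)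
    (hl : ∀ b ∈ l, Outward T C b.loc) :
    (m.flatMap (Bead.trail T C N)).Sublist (l.flatMap (Bead.trail T C N)) := by
  obtain ⟨x, b, bs, y, h⟩ := h
  obtain ⟨hk, rfl⟩ := advance_eq_some.1 h
  rw [List.flatMap_append, List.flatMap_append, List.flatMap_append, List.append_assoc]
  refine List.Sublist.append_left ?_ _
  rw [List.flatMap_cons, hC.trail_step hT hN (hl b (by simp)) hk]
  simp only [List.cons_append, List.append_assoc]
  refine List.Sublist.cons _ (List.Sublist.append_left ?_ _)
  exact List.Sublist.cons _ (List.Sublist.refl _)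

theorem IsTreeCut.trail_push_star {l m : List Bead} (h : Relation.ReflTransGen (Push T C) l m)
    (hl : ∀ b ∈ l, Outward T C b.loc) :
    (m.flatMap (Bead.trail T C N)).Sublist (l.flatMap (Bead.trail T C N)) := by
  induction h with
  | refl => exact .refl _
  | tail h1 h2 ih =>
    exact (hC.trail_push hT hN h2 (hC.push_star_invariant hT hN h1 hl).1).trans ih

/-! ### Coverage -/

/-- `y` is one of the positions of the beads that result from pushing a bead at `x`. -/
def Kid (T : List Layer) (C : Finset (ℕ × ℕ)) (x y : Loc) : Prop := ∃ k ∈ kids T C x, k.1 = y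

/-- The position is reached by pushing a bead from the lower leg. -/
def Visited (T : List Layer) (C : Finset (ℕ × ℕ)) : Loc → Prop :=
  Relation.ReflTransGen (Kid T C) ⟨0, 0, true⟩

omit hN in
theorem IsTreeCut.outward_of_star {x y : Loc} (hx : Outward T C x)
    (h : Relation.ReflTransGen (Kid T C) x y) : Outward T C y := by
  induction h with
  | refl => exact hx
  | tail _ h ih =>
    obtain ⟨k, hk, rfl⟩ := h
    exact (hC.kid_outward hT ih hk).1

omit hN in
theorem IsTreeCut.visited_cases {y : Loc} (h : Visited T C y) :
    y = ⟨0, 0, true⟩ ∨ ∃ x, Visited T C x ∧ Outward T C x ∧ Kid T C x y := by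
  rcases Relation.ReflTransGen.cases_tail h with h | ⟨x, h1, h2⟩
  · exact Or.inl h
  · exact Or.inr ⟨x, h1, hC.outward_of_star hT hC.outward_start h1, h2⟩

-- Induction on the depth of the half at `z`, through its parent: the other half of the point, the
-- end of a vertical line, or a generator. In the last case the generator was entered along its leg
-- nearest the root, and the beads left along all other legs.
omit hN in
theorem IsTreeCut.visited_or {z : Loc} (hz : z.Valid T) :
    (Visited T C z ∧ z.point ∉ C) ∨ Visited T C z.rev := by
  induction hn : vdepth T C (.half z) using Nat.strong_induction_on generalizing z with
  | _ n ih =>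
  by_cases hroot : z = bottomLoc
  · subst hroot
    exact Or.inr .refl
  obtain ⟨w, hw⟩ := hC.exists_up (v := .half z) hz fun e => hroot (Vertex.half.inj e)
  have hd := hw.2
  have hexit : ∀ {y : Loc}, y.rev = ⟨0, 0, true⟩ → passage T y = .exit := by
    intro y e
    obtain rfl : y = bottomLoc := by rw [← Loc.rev_rev y, e]; rfl
    rfl
  rcases hT.vadj_half_cases hw.1 with ⟨hzC, rfl⟩ | ⟨y, hp, rfl⟩ | ⟨t, l, leg, hp, rfl⟩
  · rcases ih _ (by omega) (z := z.rev) hz rfl with ⟨h, -⟩ | h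
    · exact Or.inr h
    · exact Or.inl ⟨by simpa using h, hzC⟩
  · obtain ⟨hy, hp'⟩ := hT.passage_plain_rev hz hp
    rcases ih _ (by omega) (z := y.rev) hy rfl with ⟨h, hyC⟩ | h
    · right
      exact h.tail ⟨(z.rev, 0, []), by rw [kids_of_plain hyC hp']; simp, rfl⟩
    · rw [Loc.rev_rev] at h
      rcases hC.visited_cases hT h with e | ⟨x, h1, h2, k, hk, rfl⟩
      · rw [hexit (y := y.rev) (by rw [Loc.rev_rev, e])] at hp'
        cases hp'
      · rcases hT.mem_kids h2.1 hk with ⟨hxC, h3 | ⟨t, l, leg, leg', h3, h4, h5, h6⟩⟩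
        · have h3' := (hT.passage_plain_rev h2.1 h3).2
          rw [hp'] at h3'
          obtain rfl := Loc.rev_injective (Passage.plain.inj h3')
          exact Or.inl ⟨h1, hxC⟩
        · rw [h6, passage_out (hT.passage_node h2.1 h3).1 h4] at hp'
          cases hp'
  · obtain ⟨hl, hleg, hze⟩ := hT.passage_node hz hp
    obtain ⟨v, hv⟩ := hC.exists_up (v := .node t) (List.getElem?_eq_some_iff.1 hl).1 (by simp)
    obtain ⟨u, l', leg', hu, hpu, rfl⟩ := vadj_node_cases hv.1
    have hdu := hv.2
    obtain ⟨hl', hleg', hue⟩ := hT.passage_node hu hpu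
    obtain rfl : l = l' := by
      rw [hl] at hl'
      exact Option.some.inj hl'
    have hne : leg ≠ leg' := by
      rintro rfl
      rw [← hze] at hue
      rw [hue] at hdu
      omega
    rcases ih _ (by omega) hu rfl with ⟨h, huC⟩ | h
    · right
      obtain ⟨k, hk, hke⟩ := hT.exists_kid hu huC hpu hleg hne
      exact h.tail ⟨k, hk, by rw [hke, hze, Loc.rev_rev]⟩
    · rcases hC.visited_cases hT h with e | ⟨x, h1, h2, k, hk, hku⟩
      · rw [hexit e] at hpu
        cases hpu
      · have hke : passage T k.1.rev = .node t l leg' := by rw [hku, Loc.rev_rev, hpu]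
        rcases hT.mem_kids h2.1 hk with ⟨hxC, h3 | ⟨t₁, l₁, leg₁, leg₂, h3, h4, h5, h6⟩⟩
        · rw [(hT.passage_plain_rev h2.1 h3).2] at hke
          cases hke
        · obtain ⟨g1, g2, g3⟩ := hT.passage_node h2.1 h3
          rw [h6, passage_out g1 h4] at hke
          cases hke
          -- The leg of `z` is either the one along which the generator was entered, or one along
          -- which it was left.
          by_cases he : leg = leg₁
          · subst he
            rw [← g3] at hze
            subst hze
            exact Or.inl ⟨h1, hxC⟩
          · right
            obtain ⟨k', hk', hke'⟩ := hT.exists_kid h2.1 hxC h3 hleg he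
            exact h1.tail ⟨k', hk', by rw [hke', hze, Loc.rev_rev]⟩

theorem IsTreeCut.mem_contour_of_star {a x : Loc} (ha : Outward T C a)
    (h : Relation.ReflTransGen (Kid T C) a x) :
    x.rev ∈ contour T C N a ++ [a.rev] ∧ (kids T C x ≠ [] → x ∈ contour T C N a) ∧
      ∀ b : Bead, b.loc = a → kids T C x = [] → ∃ c ∈ pushOut T C N b, c.loc = x := by
  revert ha
  induction h using Relation.ReflTransGen.head_induction_on with
  | refl =>
    intro hx
    refine ⟨by simp, fun h => (hC.mem_contour hT hN hx).2 ⟨h, Or.inl rfl⟩, ?_⟩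
    rintro b rfl hk
    refine ⟨b, ?_, rfl⟩
    rw [hC.pushOut_eq hT hN hx, if_pos hk]
    simp
  | @head a y hay _ ih =>
    obtain ⟨k, hk, rfl⟩ := hay
    intro ha
    have hne : kids T C a ≠ [] := List.ne_nil_of_mem hk
    obtain ⟨h1, h2, h3⟩ := ih (hC.kid_outward hT ha hk).1
    refine ⟨?_, fun h => ?_, ?_⟩
    · exact List.mem_append_left _ ((hC.mem_contour hT hN ha).2 ⟨hne, Or.inr ⟨k, hk, h1⟩⟩)
    · exact (hC.mem_contour hT hN ha).2 ⟨hne, Or.inr ⟨k, hk, List.mem_append_left _ (h2 h)⟩⟩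
    · rintro b rfl h
      obtain ⟨c, hc, hcx⟩ := h3 (b.step k) rfl h
      refine ⟨c, ?_, hcx⟩
      rw [hC.pushOut_eq hT hN ha, if_neg hne]
      exact List.mem_flatMap.2 ⟨k, hk, hc⟩

theorem IsTreeCut.valid_of_mem_contour {x : Loc} (hx : Outward T C x) :
    ∀ z ∈ contour T C N x, z.Valid T ∧ passage T z ≠ .exit := by
  refine hC.outward_induction hT hN (P := fun x => ∀ z ∈ contour T C N x,
    z.Valid T ∧ passage T z ≠ .exit) ?_ hx
  intro x hx ih z hz
  obtain ⟨hk, rfl | ⟨k, hk, hz⟩⟩ := (hC.mem_contour hT hN hx).1 hz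
  · exact ⟨hx.1, fun h => hk (kids_eq_nil.2 (Or.inr h))⟩
  · rcases List.mem_append.1 hz with hz | hz
    · exact ih k hk z hz
    · rw [List.mem_singleton.1 hz]
      exact ⟨hT.kid_valid hx.1 hk, hT.passage_kid_rev hx.1 hk⟩

/-- The contour is the full tour of the tree: it misses only the two motions that leave the diagram
at its ends. -/
theorem IsTreeCut.mem_contour_start {z : Loc} :
    z ∈ contour T C N ⟨0, 0, true⟩ ↔ z.Valid T ∧ passage T z ≠ .exit := by
  refine ⟨hC.valid_of_mem_contour hT hN hC.outward_start z, fun ⟨hz, hp⟩ => ?_⟩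
  rcases hC.visited_or hT hz with ⟨h, hzC⟩ | h
  · refine (hC.mem_contour_of_star hT hN hC.outward_start h).2.1 fun hk => ?_
    rcases kids_eq_nil.1 hk with h | h
    · exact hzC h
    · exact hp h
  · have := (hC.mem_contour_of_star hT hN hC.outward_start h).1
    rw [Loc.rev_rev, List.mem_append, List.mem_singleton] at this
    rcases this with h | rfl
    · exact h
    · exact absurd rfl hp

omit hN in
theorem IsTreeCut.visited_topLoc : Visited T C (topLoc T) := by
  rcases hC.visited_or hT hT.topLoc_valid with h | h
  · exact h.1
  · rcases hC.visited_cases hT h with e | ⟨x, h1, h2, k, hk, hku⟩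
    · simpa [topLoc, Loc.rev] using congrArg Loc.up e
    · have := hT.passage_kid_rev h2.1 hk
      rw [hku, Loc.rev_rev] at this
      exact absurd ((hT.passage_exit hT.topLoc_valid).2 (Or.inl rfl)) this

/-- Final positions appear reversed along the tour, so the distinctness of the tour passes to them.
-/
theorem IsTreeCut.rev_loc_sublist {b : Bead} (hb : Outward T C b.loc) :
    ((pushOut T C N b).map fun c => c.loc.rev).Sublist (b.trail T C N) := by
  refine IsTreeCut.bead_induction hT hC hN ?_ hb
  intro b hb ih
  rw [hC.pushOut_eq hT hN hb]
  split_ifs with hk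
  · rw [Bead.trail, hC.contour_eq hT hN hb, if_pos hk]
    simp
  · rw [hC.trail_step hT hN hb hk, List.map_flatMap, List.flatMap_map]
    refine List.Sublist.cons _ (List.Sublist.trans ?_ (List.sublist_append_left _ _))
    clear hk
    revert ih
    generalize kids T C b.loc = K
    intro ih
    induction K with
    | nil => simp
    | cons k K ih' =>
      rw [List.flatMap_cons, List.flatMap_cons]
      exact (ih k (by simp)).append (ih' fun k hk => ih k (by simp [hk]))

/-! ### The final position -/

theorem IsTreeCut.mem_final_iff (x : Loc) :
    x ∈ (pushOut T C N startBead).map Bead.loc ↔ x = topLoc T ∨ x.point ∈ C := by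
  have hs : Outward T C startBead.loc := hC.outward_start
  constructor
  · intro hx
    obtain ⟨c, hc, rfl⟩ := List.mem_map.1 hx
    obtain ⟨h1, h2⟩ := hC.pushOut_stopped hT hN hs c hc
    rcases kids_eq_nil.1 h2 with h | h
    · exact Or.inr h
    · rcases (hT.passage_exit h1.1).1 h with h' | h'
      · exact Or.inl h'
      -- A bead heading out of the lower end would lie beyond another vertex, but that end is the
      -- root.
      · have h3 := (h1.2 (hC.not_mem_of_exit hT h1.1 h)).2
        rw [h', vdepth_bottom] at h3
        omega
  · have key : ∀ y, Visited T C y → kids T C y = [] →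
        y ∈ (pushOut T C N startBead).map Bead.loc := by
      intro y hy hk
      obtain ⟨c, hc, hcy⟩ := (hC.mem_contour_of_star hT hN hs hy).2.2 startBead rfl hk
      exact List.mem_map.2 ⟨c, hc, hcy⟩
    rintro (rfl | hx)
    · exact key _ (hC.visited_topLoc hT)
        (kids_eq_nil.2 (Or.inr ((hT.passage_exit hT.topLoc_valid).2 (Or.inl rfl))))
    · refine key x ?_ (kids_eq_nil.2 (Or.inl hx))
      rcases hC.visited_or hT (z := x.rev) (hC.1 hx) with h | h
      · exact absurd hx h.2
      · simpa using h

theorem IsTreeCut.nodup_final : ((pushOut T C N startBead).map Bead.loc).Nodup := by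
  have h := (hC.nodup_contour hT hN hC.outward_start).sublist
    (hC.rev_loc_sublist hT hN (b := startBead) hC.outward_start)
  have e : (fun c : Bead => c.loc.rev) = Loc.rev ∘ Bead.loc := rfl
  rw [e, ← List.map_map] at h
  exact h.of_map

-- The tour visits each directed point other than the two exits once; `layerTurn` lists the same
-- ones according to the layer ahead of them.
open Classical in
theorem IsTreeCut.sum_contour (f : (gapGraph T).ConnectedComponent) :
    ((contour T C N ⟨0, 0, true⟩).map (faceStep T f)).sum =
      ∑ t ∈ Finset.range T.length, layerTurn T f t := by
  have hnd : (contour T C N ⟨0, 0, true⟩).Nodup :=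
    (List.nodup_append.1 (hC.nodup_contour hT hN hC.outward_start)).1
  rw [← List.sum_toFinset _ hnd]
  let A : Finset Loc := (Finset.range T.length).biUnion fun t =>
    (Finset.range (width T t)).image fun j => ⟨t, j, true⟩
  let B : Finset Loc := (Finset.range T.length).biUnion fun t =>
    (Finset.range (width T (t + 1))).image fun j => ⟨t + 1, j, false⟩
  have hAB : (contour T C N ⟨0, 0, true⟩).toFinset = A ∪ B := by
    ext ⟨t, j, u⟩
    rw [List.mem_toFinset, hC.mem_contour_start hT hN, Finset.mem_union]
    have hiff : ∀ hz : Loc.Valid T ⟨t, j, u⟩, (passage T ⟨t, j, u⟩ ≠ .exit ↔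
        ¬ ((⟨t, j, u⟩ : Loc) = topLoc T ∨ (⟨t, j, u⟩ : Loc) = bottomLoc)) := fun hz => by
      rw [Ne, hT.passage_exit hz]
    have hw0 : width T 0 = 1 := rfl
    have hwn := hT.width_length
    simp only [A, B, Finset.mem_biUnion, Finset.mem_image, Finset.mem_range, Loc.mk.injEq]
    constructor
    · rintro ⟨hz, hp⟩
      rw [hiff hz] at hp
      obtain ⟨h1, h2⟩ := Loc.valid_iff.1 hz
      simp only [topLoc, bottomLoc, Loc.mk.injEq, not_or, not_and] at hp h1 h2
      cases u with
      | true =>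
        left
        refine ⟨t, ?_, j, h2, rfl, rfl, rfl⟩
        rcases h1.eq_or_lt with rfl | h
        · rw [hwn] at h2
          exact absurd rfl (hp.1 rfl (by omega))
        · exact h
      | false =>
        right
        cases t with
        | zero =>
          rw [hw0] at h2
          exact absurd rfl (hp.2 rfl (by omega))
        | succ t => exact ⟨t, by omega, j, h2, rfl, rfl, rfl⟩
    · intro h
      have hz : Loc.Valid T ⟨t, j, u⟩ := by
        rw [Loc.valid_iff]
        rcases h with ⟨t', h1, j', h2, rfl, rfl, -⟩ | ⟨t', h1, j', h2, rfl, rfl, -⟩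
        · exact ⟨h1.le, h2⟩
        · exact ⟨h1, h2⟩
      refine ⟨hz, (hiff hz).2 ?_⟩
      simp only [topLoc, bottomLoc, Loc.mk.injEq]
      rcases h with ⟨t', h1, j', h2, rfl, rfl, rfl⟩ | ⟨t', h1, j', h2, rfl, rfl, rfl⟩
      · simp; omega
      · simp
  have hdisj : Disjoint A B := by
    rw [Finset.disjoint_left]
    intro x hx hx'
    simp only [A, B, Finset.mem_biUnion, Finset.mem_image] at hx hx'
    obtain ⟨_, _, _, _, rfl⟩ := hx
    obtain ⟨_, _, _, _, h⟩ := hx'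
    simp at h
  rw [hAB, Finset.sum_union hdisj]
  simp only [layerTurn]
  rw [Finset.sum_add_distrib]
  congr 1
  · rw [Finset.sum_biUnion]
    · refine Finset.sum_congr rfl fun t _ => ?_
      rw [Finset.sum_image]
      intro a _ b _ h
      simpa using h
    · intro a _ b _ hab
      rw [Function.onFun, Finset.disjoint_left]
      intro x hx hx'
      simp only [Finset.mem_image] at hx hx'
      obtain ⟨_, _, rfl⟩ := hx
      obtain ⟨_, _, h⟩ := hx'
      simp at h
      exact hab h.1.symm
  · rw [Finset.sum_biUnion]
    · refine Finset.sum_congr rfl fun t _ => ?_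
      rw [Finset.sum_image]
      intro a _ b _ h
      simpa using h
    · intro a _ b _ hab
      rw [Function.onFun, Finset.disjoint_left]
      intro x hx hx'
      simp only [Finset.mem_image] at hx hx'
      obtain ⟨_, _, rfl⟩ := hx
      obtain ⟨_, _, h⟩ := hx'
      simp at h
      exact hab h.1.symm

-- Combines the two halves of the planar argument: the turning numbers given by the beads obey the
-- bounds from the Euler characteristic. The initial bead has exponent zero and the left outer face
-- on its left, which explains the value `1` of `faceBound` there.
open Classical in
theorem IsTreeCut.final_collapse : ∃ z ∈ pushOut T C N startBead, z.loc = topLoc T ∧ z.pow = 0 ∧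
    Relation.ReflTransGen Collapse (pushOut T C N startBead) [z] := by
  have hs : Outward T C startBead.loc := hC.outward_start
  obtain ⟨h1, h2, -, -, -⟩ := hC.pushOut_linked hT hN hs
  obtain ⟨z, hz, hzl⟩ := List.mem_map.1 ((hC.mem_final_iff hT hN (topLoc T)).2 (Or.inl rfl))
  obtain ⟨g1, g2⟩ := hT.gapFace_zero le_rfl
  rw [hT.width_length] at g2
  have hexit : passage T (topLoc T) = .exit := (hT.passage_exit hT.topLoc_valid).2 (Or.inl rfl)
  have htop := hC.not_mem_of_exit hT hT.topLoc_valid hexit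
  have := exists_collapse (lab := faceLab T) (l := pushOut T C N startBead) (z := z)
    (L := gapFace T (0, 0)) (R := gapFace T (0, 1)) gapFace_left_ne_right hz h1
    (by rw [hzl]; exact g1) (by rw [hzl]; exact g2) (hC.nodup_final hT hN) ?_ ?_
  · exact ⟨z, hz, hzl, this.2.1, this.1⟩
  · intro d hd hdz
    have hdt : d.loc ≠ topLoc T := fun h => hdz
      (List.inj_on_of_nodup_map (hC.nodup_final hT hN) hd hz (h.trans hzl.symm))
    have hdC := ((hC.mem_final_iff hT hN d.loc).1 (List.mem_map_of_mem hd)).resolve_left hdt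
    obtain ⟨c, hc, hcd⟩ := List.mem_map.1
      ((hC.mem_final_iff hT hN d.loc.rev).2 (Or.inr (by simpa using hdC)))
    refine ⟨c, hc, ?_, hcd⟩
    rintro rfl
    rw [← Loc.point_rev, ← hcd, hzl] at hdC
    exact htop hdC
  · intro f
    have h3 := h2 f
    have h4 : ((contour T C N startBead.loc).map (faceStep T f)).sum = _ :=
      hC.sum_contour hT hN f
    have h5 := hT.sum_layerTurn_le f
    have h6 : beadTurn (faceLab T) f startBead = if gapFace T (0, 0) = f then 1 else 0 := by
      rw [beadTurn, show startBead.pow = 0 from rfl, ite_self, sub_zero, zero_add]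
      rfl
    rw [h4, h6] at h3
    omega

end

end BeadPush

namespace BeadPush

/-! ## The strands of a diagram -/

/-- The upward direction at a point. -/
def upLoc (p : ℕ × ℕ) : Loc := ⟨p.1, p.2, true⟩

@[simp] theorem upLoc_point (p : ℕ × ℕ) : (upLoc p).point = p := rfl

theorem Gen.hasLeg_strand {G : Gen} {a : Leg} (h : G.HasLeg a) :
    G.HasLeg (G.strand a) ∧ G.strand (G.strand a) = a ∧ G.strand a ≠ a := by
  cases G <;> cases a <;> simp [Gen.HasLeg, Gen.strand, Leg.cw] at h ⊢

theorem Gen.even_turn_strand {G : Gen} {a : Leg} (h : G.HasLeg a) (t n : ℕ) :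
    Even (turn a (G.strand a)) ↔ ((G.strand a).out t n).up = (a.out t n).rev.up := by
  cases G <;> cases a <;> simp [Gen.HasLeg, Gen.strand, Leg.cw, turn, Leg.out] at h ⊢

theorem IsTangle.next_eq_none {T : List Layer} (hT : IsTangle 1 T 1) {x : Loc} (hx : x.Valid T) :
    next T x = none ↔ x = topLoc T ∨ x = bottomLoc := by
  rw [← hT.passage_exit hx]
  unfold next
  cases passage T x <;> simp

theorem IsTangle.next_rev {T : List Layer} (hT : IsTangle 1 T 1) {x y : Loc} {δ : ℤ}
    (hx : x.Valid T) (h : next T x = some (y, δ)) :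
    y.Valid T ∧ next T y.rev = some (x.rev, -δ) ∧ (Even δ ↔ y.up = x.up) ∧
      y.point ≠ x.point := by
  unfold next at h
  split at h
  · cases h
  · rename_i z hz
    simp only [Option.some.injEq, Prod.mk.injEq] at h
    obtain ⟨rfl, rfl⟩ := h
    obtain ⟨hy, hr⟩ := hT.passage_plain_rev hx hz
    obtain ⟨t, l, hl, h1 | h1⟩ := hT.passage_plain hx hz
    · refine ⟨hy, by simp [next, hr], ?_, ?_⟩ <;> cases h1 <;> simp [Loc.point]
    · have h2 : z.rev.up = x.rev.up ∧ z.rev.point ≠ x.rev.point := by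
        generalize z.rev = a, x.rev = b at h1
        cases h1 <;> simp [Loc.point]
      refine ⟨hy, by simp [next, hr], ?_, h2.2⟩
      simpa using h2.1
  · rename_i t l leg hn
    simp only [Option.some.injEq, Prod.mk.injEq] at h
    obtain ⟨rfl, rfl⟩ := h
    obtain ⟨hl, hleg, rfl⟩ := hT.passage_node hx hn
    obtain ⟨h1, h2, h3⟩ := Gen.hasLeg_strand hleg
    refine ⟨hT.valid_out hl h1, ?_, Gen.even_turn_strand hleg _ _, fun h => h3 ?_⟩
    · simp only [next, passage_out hl h1, h2, Loc.rev_rev]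
      rw [turn_swap]
    · exact Leg.out_point_injective h

/-- The next point on the strand, where the two ends of the diagram are joined. -/
def follow (T : List Layer) (x : Loc) : Loc :=
  match next T x with
  | some (y, _) => y
  | none => if x.up then upLoc (0, 0) else (topLoc T).rev

/-- The half turns on the way to the next point. -/
def turnAt (T : List Layer) (x : Loc) : ℤ :=
  match next T x with
  | some (_, δ) => δ
  | none => 0

/-- The exponent of the antipode after `n` steps from `x`. -/
def exponent (T : List Layer) (x : Loc) (n : ℕ) : ℤ :=
  -∑ j ∈ Finset.range n, turnAt T ((follow T)^[j] x)

theorem follow_of_next {T : List Layer} {x y : Loc} {δ : ℤ} (h : next T x = some (y, δ)) :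
    follow T x = y := by
  simp [follow, h]

theorem turnAt_of_next {T : List Layer} {x y : Loc} {δ : ℤ} (h : next T x = some (y, δ)) :
    turnAt T x = δ := by
  simp [turnAt, h]

@[simp] theorem exponent_zero (T : List Layer) (x : Loc) : exponent T x 0 = 0 := by
  simp [exponent]

theorem exponent_succ (T : List Layer) (x : Loc) (n : ℕ) :
    exponent T x (n + 1) = exponent T x n - turnAt T ((follow T)^[n] x) := by
  simp [exponent, Finset.sum_range_succ]
  ring

theorem exponent_succ' (T : List Layer) (x : Loc) (n : ℕ) :
    exponent T x (n + 1) = -turnAt T x + exponent T (follow T x) n := by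
  simp only [exponent, Finset.sum_range_succ', Function.iterate_succ, Function.comp_apply,
    Function.iterate_zero, id]
  ring

section Strand

variable {T : List Layer} (hT : IsTangle 1 T 1)
include hT

/-- Reversal of direction conjugates `follow` into its inverse. This makes `follow` injective, and
its orbits the closed-up strands. -/
theorem IsTangle.follow_spec {x : Loc} (hx : x.Valid T) :
    (follow T x).Valid T ∧ follow T (follow T x).rev = x.rev ∧ follow T x ≠ x.rev ∧
      (Even (turnAt T x) ↔ (follow T x).up = x.up) := by
  rcases h : next T x with _ | ⟨y, δ⟩
  · rcases (hT.next_eq_none hx).1 h with rfl | rfl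
    · have h2 : next T (upLoc (0, 0)).rev = none :=
        (hT.next_eq_none (Loc.valid_rev.2 start_valid)).2 (Or.inr rfl)
      have h1 : follow T (topLoc T) = upLoc (0, 0) := by
        simp only [follow, h]
        rfl
      refine ⟨?_, ?_, ?_, ?_⟩
      · rw [h1]; exact start_valid
      · rw [h1]
        simp only [follow, h2]
        rfl
      · rw [h1]
        simp [upLoc, topLoc, Loc.rev]
      · rw [h1]
        rw [turnAt, h]
        simp [upLoc, topLoc]
    · have h2 : next T (topLoc T).rev.rev = none :=
        (hT.next_eq_none hT.topLoc_valid).2 (Or.inl rfl)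
      have h1 : follow T bottomLoc = (topLoc T).rev := by
        simp only [follow, h]
        rfl
      refine ⟨?_, ?_, ?_, ?_⟩
      · rw [h1]; exact Loc.valid_rev.2 hT.topLoc_valid
      · rw [h1]
        simp only [follow, h2]
        rfl
      · rw [h1]
        simp [bottomLoc, topLoc, Loc.rev]
      · rw [h1]
        rw [turnAt, h]
        simp [bottomLoc, topLoc]
  · obtain ⟨h1, h2, h3, h4⟩ := hT.next_rev hx h
    rw [follow_of_next h, follow_of_next h2, turnAt_of_next h]
    exact ⟨h1, rfl, fun h => h4 (by rw [h]; rfl), h3⟩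

theorem IsTangle.follow_iterate_valid {x : Loc} (hx : x.Valid T) (n : ℕ) :
    ((follow T)^[n] x).Valid T := by
  induction n with
  | zero => exact hx
  | succ n ih =>
    rw [Function.iterate_succ_apply']
    exact (hT.follow_spec ih).1

theorem IsTangle.follow_inj {x y : Loc} (hx : x.Valid T) (hy : y.Valid T)
    (h : follow T x = follow T y) : x = y := by
  have h1 := (hT.follow_spec hx).2.1
  rw [h, (hT.follow_spec hy).2.1] at h1
  exact (Loc.rev_injective h1).symm

theorem IsTangle.follow_iterate_rev {x : Loc} (hx : x.Valid T) (n : ℕ) :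
    (follow T)^[n] ((follow T)^[n] x).rev = x.rev := by
  induction n with
  | zero => rfl
  | succ n ih =>
    rw [Function.iterate_succ_apply, Function.iterate_succ_apply' _ n x,
      (hT.follow_spec (hT.follow_iterate_valid hx n)).2.1, ih]

/-- If a strand came back in the opposite direction, dropping its first and last step would give a
shorter instance; the lengths zero and one are impossible. -/
theorem IsTangle.follow_iterate_ne_rev {x : Loc} (hx : x.Valid T) (n : ℕ) :
    (follow T)^[n] x ≠ x.rev := by
  induction n using Nat.strong_induction_on generalizing x with
  | _ n ih =>
    rcases n with _ | _ | n
    · exact (Loc.rev_ne x).symm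
    · exact (hT.follow_spec hx).2.2.1
    · intro h
      obtain ⟨h1, h2, -⟩ := hT.follow_spec hx
      refine ih n (by omega) h1 (hT.follow_inj (hT.follow_iterate_valid h1 n) h1 ?_)
      rw [h2, ← h, ← Function.iterate_succ_apply' (follow T), Function.iterate_succ_apply,
        Function.iterate_succ_apply, Function.iterate_succ_apply]

/-- The vertical direction is reversed exactly at the half turns, each of which changes the exponent
by one. -/
theorem IsTangle.even_exponent {x : Loc} (hx : x.Valid T) (n : ℕ) :
    Even (exponent T x n) ↔ ((follow T)^[n] x).up = x.up := by
  induction n with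
  | zero => simp
  | succ n ih =>
    have h := (hT.follow_spec (hT.follow_iterate_valid hx n)).2.2.2
    rw [exponent_succ, Int.even_sub, ih, h, Function.iterate_succ_apply']
    generalize ((follow T)^[n] x).up = a, (follow T ((follow T)^[n] x)).up = b, x.up = c
    revert a b c
    decide

theorem IsTangle.minimalPeriod_pos {x : Loc} (hx : x.Valid T) :
    0 < Function.minimalPeriod (follow T) x := by
  have hfin : Set.Finite {y : Loc | y.Valid T} := by
    refine Set.Finite.of_surjOn (fun q : (ℕ × ℕ) × Bool => (⟨q.1.1, q.1.2, q.2⟩ : Loc))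
      (s := ((points T ×ˢ Finset.univ : Finset ((ℕ × ℕ) × Bool)) : Set _)) ?_
      (Finset.finite_toSet _)
    intro y hy
    exact ⟨(y.point, y.up), by simpa using (show y.point ∈ points T from hy), rfl⟩
  obtain ⟨i, j, hij, h⟩ : ∃ i j, i < j ∧ (follow T)^[i] x = (follow T)^[j] x := by
    by_contra! hne
    have hinj : Function.Injective fun i => (follow T)^[i] x := by
      intro i j h
      rcases lt_trichotomy i j with hij | hij | hij
      · exact absurd h (hne i j hij)
      · exact hij
      · exact absurd h.symm (hne j i hij)
    exact Set.infinite_range_of_injective hinj (hfin.subset (by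
      rintro _ ⟨i, rfl⟩
      exact hT.follow_iterate_valid hx i))
  have key : ∀ i n, (follow T)^[i] x = (follow T)^[i + n] x → (follow T)^[n] x = x := by
    intro i n
    induction i with
    | zero => simp only [zero_add]; exact fun h => h.symm
    | succ i ih =>
      intro h
      apply ih
      rw [Nat.add_right_comm, Function.iterate_succ_apply', Function.iterate_succ_apply'] at h
      exact hT.follow_inj (hT.follow_iterate_valid hx _) (hT.follow_iterate_valid hx _) h
  exact Function.IsPeriodicPt.minimalPeriod_pos (n := j - i) (by omega)
    (key i (j - i) (by rw [h]; congr; omega))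

/-- Within a period no directed point recurs, and the opposite direction is excluded by
`follow_iterate_ne_rev`. The number of points therefore bounds the period and is enough fuel for
`walk`. -/
theorem IsTangle.point_injOn {x : Loc} (hx : x.Valid T) {i j : ℕ}
    (hi : i < Function.minimalPeriod (follow T) x) (hj : j < Function.minimalPeriod (follow T) x)
    (h : ((follow T)^[i] x).point = ((follow T)^[j] x).point) : i = j := by
  rcases Loc.eq_or_eq_rev h with h | h
  · exact (Function.iterate_eq_iterate_iff_of_lt_minimalPeriod hi hj).1 h
  · exfalso
    have := hT.follow_iterate_rev hx j
    rw [← h, ← Function.iterate_add_apply] at this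
    exact hT.follow_iterate_ne_rev hx _ this

theorem IsTangle.minimalPeriod_le {x : Loc} (hx : x.Valid T) :
    Function.minimalPeriod (follow T) x ≤ (points T).card := by
  rw [← Finset.card_range (Function.minimalPeriod (follow T) x)]
  refine Finset.card_le_card_of_injOn (fun i => ((follow T)^[i] x).point)
    (fun i _ => hT.follow_iterate_valid hx i) ?_
  intro i hi j hj h
  exact hT.point_injOn hx (by simpa using hi) (by simpa using hj) h

end Strand

/-- The strand in the direction `x` passes through `y` in the direction `y`. -/
def Reach (T : List Layer) (x y : Loc) : Prop := ∃ n, (follow T)^[n] x = y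

theorem Reach.refl {T : List Layer} (x : Loc) : Reach T x x := ⟨0, rfl⟩

theorem Reach.trans {T : List Layer} {x y z : Loc} : Reach T x y → Reach T y z → Reach T x z := by
  rintro ⟨m, rfl⟩ ⟨n, rfl⟩
  exact ⟨n + m, Function.iterate_add_apply _ _ _ _⟩

section Reach

variable {T : List Layer} (hT : IsTangle 1 T 1)
include hT

theorem IsTangle.reach_lt {x y : Loc} (hx : x.Valid T) (h : Reach T x y) :
    ∃ n < Function.minimalPeriod (follow T) x, (follow T)^[n] x = y := by
  obtain ⟨n, rfl⟩ := h
  exact ⟨_, Nat.mod_lt n (hT.minimalPeriod_pos hx), Function.iterate_mod_minimalPeriod_eq⟩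

theorem IsTangle.reach_symm {x y : Loc} (hx : x.Valid T) (h : Reach T x y) : Reach T y x := by
  obtain ⟨n, hn, rfl⟩ := hT.reach_lt hx h
  refine ⟨Function.minimalPeriod (follow T) x - n, ?_⟩
  rw [← Function.iterate_add_apply, Nat.sub_add_cancel hn.le, Function.iterate_minimalPeriod]

theorem IsTangle.reach_rev {x y : Loc} (hx : x.Valid T) (h : Reach T x y) :
    Reach T x.rev y.rev := by
  obtain ⟨n, rfl⟩ := h
  exact hT.reach_symm (Loc.valid_rev.2 (hT.follow_iterate_valid hx n))
    ⟨n, hT.follow_iterate_rev hx n⟩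

theorem IsTangle.reach_valid {x y : Loc} (hx : x.Valid T) (h : Reach T x y) : y.Valid T := by
  obtain ⟨n, rfl⟩ := h
  exact hT.follow_iterate_valid hx n

theorem IsTangle.not_reach_rev {x y : Loc} (hx : x.Valid T) (h : Reach T x y) :
    ¬ Reach T x y.rev := by
  intro h'
  obtain ⟨n, hn⟩ := (hT.reach_symm hx h).trans h'
  exact hT.follow_iterate_ne_rev (hT.reach_valid hx h) n hn

end Reach

/-- The strand through `p` passes through `q`. -/
def SameStrand (T : List Layer) (p q : ℕ × ℕ) : Prop :=
  Reach T (upLoc p) (upLoc q) ∨ Reach T (upLoc p) (upLoc q).rev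

theorem sameStrand_iff {T : List Layer} {p q : ℕ × ℕ} :
    SameStrand T p q ↔ ∃ y, Reach T (upLoc p) y ∧ y.point = q := by
  constructor
  · rintro (h | h)
    · exact ⟨_, h, rfl⟩
    · exact ⟨_, h, rfl⟩
  · rintro ⟨y, h, rfl⟩
    rcases Loc.eq_or_eq_rev (x := y) (y := upLoc y.point) rfl with hy | hy
    · exact Or.inl (hy ▸ h)
    · exact Or.inr (hy ▸ h)

theorem SameStrand.refl {T : List Layer} (p : ℕ × ℕ) : SameStrand T p p := Or.inl (.refl _)

section SameStrand

variable {T : List Layer} (hT : IsTangle 1 T 1)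
include hT

theorem IsTangle.sameStrand_symm {p q : ℕ × ℕ} (hp : p ∈ points T) (h : SameStrand T p q) :
    SameStrand T q p := by
  rcases h with h | h
  · exact Or.inl (hT.reach_symm hp h)
  · right
    have := hT.reach_rev (x := upLoc p) hp h
    rw [Loc.rev_rev] at this
    exact hT.reach_symm (Loc.valid_rev.2 hp) this

theorem IsTangle.sameStrand_trans {p q r : ℕ × ℕ} (hq : q ∈ points T)
    (h : SameStrand T p q) (h' : SameStrand T q r) : SameStrand T p r := by
  rcases h with h | h
  · exact h'.imp h.trans h.trans
  · rcases h' with h' | h'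
    · exact Or.inr (h.trans (hT.reach_rev hq h'))
    · left
      have := h.trans (hT.reach_rev hq h')
      rwa [Loc.rev_rev] at this

theorem IsTangle.sameStrand_mem {p q : ℕ × ℕ} (hp : p ∈ points T) (h : SameStrand T p q) :
    q ∈ points T := by
  rcases h with h | h
  · exact hT.reach_valid (x := upLoc p) hp h
  · exact hT.reach_valid (x := upLoc p) hp h

end SameStrand

/-- The index `m` is that of the last point listed, after which the strand ends or returns to its
base. This turns the recursion into iterates of `follow`. -/
theorem walk_eq {T : List Layer} {base : Loc} {n m : ℕ} (hm : m < n) {x : Loc} {i : ℤ}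
    (h1 : ∀ j < m, next T ((follow T)^[j] x) ≠ none ∧ (follow T)^[j + 1] x ≠ base)
    (h2 : next T ((follow T)^[m] x) = none ∨ (follow T)^[m + 1] x = base) :
    walk T base n x i = ((List.range (m + 1)).map fun j =>
      ((follow T)^[j] x, i + exponent T x j), i + exponent T x (m + 1)) := by
  induction n generalizing m x i with
  | zero => omega
  | succ n ih =>
    rw [walk]
    cases m with
    | zero =>
      split
      · rename_i h
        simp [exponent_succ, turnAt, h]
      · rename_i y δ h
        have h3 := follow_of_next h
        rcases h2 with h2 | h2
        · simp [h] at h2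
        · rw [if_pos (h3.symm.trans h2)]
          simp [exponent_succ, turnAt_of_next h, sub_eq_add_neg]
    | succ m =>
      obtain ⟨h3, h4⟩ := h1 0 (by omega)
      split
      · rename_i h
        exact absurd h h3
      · rename_i y δ h
        have h5 := follow_of_next h
        have h6 := turnAt_of_next h
        rw [if_neg (by rw [← h5]; exact h4), ih (m := m) (by omega)]
        · rw [List.range_succ_eq_map (n := m + 1), List.map_cons, List.map_map,
            exponent_succ' T x (m + 1), h5, h6]
          simp only [Prod.mk.injEq, List.cons.injEq, Function.iterate_zero, id, exponent_zero,
            add_zero, true_and]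
          refine ⟨List.map_congr_left fun j _ => ?_, by ring⟩
          simp only [Function.comp_apply, Nat.succ_eq_add_one, Function.iterate_succ_apply,
            exponent_succ', h5, h6, Prod.mk.injEq, true_and]
          ring
        · intro j hj
          have := h1 (j + 1) (by omega)
          rw [Function.iterate_succ_apply, Function.iterate_succ_apply, h5] at this
          exact this
        · rw [Function.iterate_succ_apply, Function.iterate_succ_apply, h5] at h2
          exact h2

section Strand

variable {T : List Layer} (hT : IsTangle 1 T 1)
include hT

/-- A base point of a component: the lower end, or a point of a closed component. -/
theorem IsTangle.strand_eq {p : ℕ × ℕ} (hp : p ∈ points T)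
    (hb : p = (0, 0) ∨ ¬ SameStrand T (0, 0) p) :
    strand T p = ((List.range (Function.minimalPeriod (follow T) (upLoc p))).map fun j =>
      ((follow T)^[j] (upLoc p), exponent T (upLoc p) j),
      exponent T (upLoc p) (Function.minimalPeriod (follow T) (upLoc p))) := by
  have hpos := hT.minimalPeriod_pos (x := upLoc p) hp
  have hle := hT.minimalPeriod_le (x := upLoc p) hp
  obtain ⟨m, hm⟩ : ∃ m, Function.minimalPeriod (follow T) (upLoc p) = m + 1 :=
    ⟨_, (Nat.sub_add_cancel hpos).symm⟩
  rw [hm] at hle ⊢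
  have := walk_eq (T := T) (base := upLoc p) (n := (points T).card) (m := m) hle (x := upLoc p)
    (i := 0) ?_ ?_
  · rw [strand, ← upLoc, this]
    simp
  · intro j hj
    have hne : (follow T)^[j + 1] (upLoc p) ≠ upLoc p :=
      Function.not_isPeriodicPt_of_pos_of_lt_minimalPeriod (by omega) (by omega)
    refine ⟨fun h => ?_, hne⟩
    -- The upper end leads back to the lower one and completes the period of the open strand; the
    -- lower end cannot be met downward on it. A closed component meets neither.
    rcases (hT.next_eq_none (hT.follow_iterate_valid (x := upLoc p) hp j)).1 h with h1 | h1
    · have h2 : (follow T)^[j + 1] (upLoc p) = upLoc (0, 0) := by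
        rw [Function.iterate_succ_apply', follow, h, h1]
        rfl
      rcases hb with rfl | hb
      · exact hne h2
      · exact hb (Or.inl (hT.reach_symm hp ⟨_, h2⟩))
    · have h2 : SameStrand T p (0, 0) := Or.inr ⟨j, h1⟩
      rcases hb with rfl | hb
      · exact hT.follow_iterate_ne_rev (x := upLoc (0, 0)) hp j h1
      · exact hb (hT.sameStrand_symm hp h2)
  · right
    rw [← hm]
    exact Function.iterate_minimalPeriod

theorem IsTangle.exists_mem_strand {p : ℕ × ℕ} (hp : p ∈ points T)
    (hb : p = (0, 0) ∨ ¬ SameStrand T (0, 0) p) {q : ℕ × ℕ} :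
    (∃ y ∈ (strand T p).1, y.1.point = q) ↔ SameStrand T p q := by
  rw [hT.strand_eq hp hb, sameStrand_iff]
  simp only [List.mem_map, List.mem_range]
  constructor
  · rintro ⟨_, ⟨j, hj, rfl⟩, rfl⟩
    exact ⟨_, ⟨j, rfl⟩, rfl⟩
  · rintro ⟨y, h, rfl⟩
    obtain ⟨n, hn, rfl⟩ := hT.reach_lt (x := upLoc p) hp h
    exact ⟨_, ⟨n, hn, rfl⟩, rfl⟩

theorem IsTangle.mem_closedBases {p : ℕ × ℕ} :
    p ∈ closedBases T ↔ p ∈ points T ∧ ¬ SameStrand T (0, 0) p ∧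
      ∀ q, SameStrand T p q → toLex p ≤ toLex q := by
  have h0 : (0, 0) ∈ points T := start_valid (T := T)
  rw [closedBases, Finset.mem_filter]
  refine and_congr_right fun hp => ?_
  have h1 : (∀ y ∈ (strand T (0, 0)).1, y.1.point ≠ p) ↔ ¬ SameStrand T (0, 0) p := by
    rw [← hT.exists_mem_strand h0 (Or.inl rfl)]
    push Not
    rfl
  rw [h1]
  refine and_congr_right fun hb => ?_
  simp only [Prod.Lex.toLex_le_toLex]
  constructor
  · intro h q hq
    obtain ⟨y, hy, rfl⟩ := (hT.exists_mem_strand hp (Or.inr hb)).2 hq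
    exact h y hy
  · intro h y hy
    exact h y.1.point ((hT.exists_mem_strand hp (Or.inr hb)).1 ⟨y, hy, rfl⟩)

/-- Base points of all components. -/
theorem IsTangle.exists_base {q : ℕ × ℕ} (hq : q ∈ points T) :
    ∃ p ∈ insert (0, 0) (closedBases T), SameStrand T p q := by
  classical
  by_cases h0 : SameStrand T (0, 0) q
  · exact ⟨_, Finset.mem_insert_self _ _, h0⟩
  · obtain ⟨p, hp, hmin⟩ := ((points T).filter (SameStrand T q ·)).exists_min_image toLex
      ⟨q, by simp [hq, SameStrand.refl]⟩
    simp only [Finset.mem_filter] at hp hmin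
    refine ⟨p, Finset.mem_insert_of_mem (hT.mem_closedBases.2 ⟨hp.1, fun h => ?_, fun r hr => ?_⟩),
      hT.sameStrand_symm hq hp.2⟩
    · exact h0 (hT.sameStrand_trans hp.1 h (hT.sameStrand_symm hq hp.2))
    · exact hmin r ⟨hT.sameStrand_mem hp.1 hr, hT.sameStrand_trans hp.1 hp.2 hr⟩

theorem IsTangle.base_mem {p : ℕ × ℕ} (h : p ∈ insert (0, 0) (closedBases T)) :
    p ∈ points T ∧ (p = (0, 0) ∨ ¬ SameStrand T (0, 0) p) := by
  rcases Finset.mem_insert.1 h with rfl | h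
  · exact ⟨start_valid (T := T), Or.inl rfl⟩
  · obtain ⟨h1, h2, -⟩ := hT.mem_closedBases.1 h
    exact ⟨h1, Or.inr h2⟩

theorem IsTangle.base_unique {p p' q : ℕ × ℕ} (hp : p ∈ insert (0, 0) (closedBases T))
    (hp' : p' ∈ insert (0, 0) (closedBases T)) (h : SameStrand T p q) (h' : SameStrand T p' q) :
    p = p' := by
  have hpm := (hT.base_mem hp).1
  have hpm' := (hT.base_mem hp').1
  have hq := hT.sameStrand_mem hpm h
  have h1 := hT.sameStrand_trans hq h (hT.sameStrand_symm hpm' h')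
  have h2 := hT.sameStrand_symm hpm h1
  rcases Finset.mem_insert.1 hp with rfl | hp <;> rcases Finset.mem_insert.1 hp' with rfl | hp'
  · rfl
  · exact absurd h1 (hT.mem_closedBases.1 hp').2.1
  · exact absurd h2 (hT.mem_closedBases.1 hp).2.1
  · exact toLex.injective (le_antisymm ((hT.mem_closedBases.1 hp).2.2 _ h1)
      ((hT.mem_closedBases.1 hp').2.2 _ h2))

theorem IsTangle.start_notMem_closedBases : (0, 0) ∉ closedBases T := fun h =>
  (hT.mem_closedBases.1 h).2.1 (.refl _)

end Strand

end BeadPush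

/-! ### Powers of the antipode and contents of strands -/

namespace BeadPush

section Antipode

variable {k A : Type*} [CommRing k] [Ring A] [HopfAlgebra k A] (g : Augmentation k A)

theorem Augmentation.s_apply (x : A) : g.s x = HopfAlgebra.antipode k x := rfl

theorem Augmentation.s_mul (x y : A) : g.s (x * y) = g.s y * g.s x :=
  HopfAlgebra.antipode_mul_antidistrib x y

theorem Augmentation.s_one : g.s (1 : A) = 1 := HopfAlgebra.antipode_one

theorem Augmentation.zpow_add_apply (i j : ℤ) (x : A) :
    (g.s ^ (i + j)) x = (g.s ^ i) ((g.s ^ j) x) := by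
  rw [zpow_add]
  rfl

theorem Augmentation.zpow_two_mul (n : ℤ) (x : A) :
    (g.s ^ (2 * n)) x = ((g.G ^ n : Aˣ) : A) * x * ((g.G ^ (-n) : Aˣ) : A) := by
  have hsq : ∀ x, (g.s ^ (2 : ℤ)) x = g.G * x * (g.G⁻¹ : Aˣ) := fun x => g.antipode_sq x
  have hsq' : ∀ x, (g.s ^ (-2 : ℤ)) x = (g.G⁻¹ : Aˣ) * x * g.G := fun x => by
    apply (g.s ^ (2 : ℤ)).injective
    rw [← g.zpow_add_apply, hsq]
    simp [mul_assoc]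
  induction n using Int.induction_on generalizing x with
  | zero => simp
  | succ n ih =>
    rw [show 2 * ((n : ℤ) + 1) = 2 * n + 2 by ring, g.zpow_add_apply, hsq, ih, zpow_add,
      neg_add_rev, zpow_add]
    simp [mul_assoc]
  | pred n ih =>
    rw [show 2 * (-(n : ℤ) - 1) = 2 * (-n) + (-2) by ring, g.zpow_add_apply, hsq', ih, sub_eq_add_neg,
      zpow_add, neg_add_rev, zpow_add]
    simp [mul_assoc]

/-- Even powers of `s` are conjugations by powers of `G`. -/
theorem Augmentation.zpow_mul_of_even {i : ℤ} (hi : Even i) (x y : A) :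
    (g.s ^ i) (x * y) = (g.s ^ i) x * (g.s ^ i) y := by
  obtain ⟨n, rfl⟩ := hi
  rw [← two_mul, g.zpow_two_mul, g.zpow_two_mul, g.zpow_two_mul, zpow_neg]
  simp [mul_assoc]

theorem Augmentation.zpow_mul_of_odd {i : ℤ} (hi : ¬ Even i) (x y : A) :
    (g.s ^ i) (x * y) = (g.s ^ i) y * (g.s ^ i) x := by
  obtain ⟨n, rfl⟩ := Int.not_even_iff_odd.1 hi
  simp only [g.zpow_add_apply, zpow_one, g.s_mul, g.zpow_mul_of_even (even_two_mul n)]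

theorem Augmentation.zpow_one_apply (i : ℤ) : (g.s ^ i) (1 : A) = 1 := by
  rcases Int.even_or_odd' i with ⟨n, rfl | rfl⟩
  · rw [g.zpow_two_mul]
    simp
  · rw [g.zpow_add_apply, zpow_one, g.s_one, g.zpow_two_mul]
    simp

/-- Moves an element past the Whitney factor. It accounts for the change of base point on a closed
component and for the bead at the upper end. -/
theorem Augmentation.G_mul {i : ℤ} (hi : Even i) (x : A) :
    ((g.G ^ (i / 2) : Aˣ) : A) * x = (g.s ^ i) x * ((g.G ^ (i / 2) : Aˣ) : A) := by
  obtain ⟨n, rfl⟩ := hi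
  rw [← two_mul, g.zpow_two_mul, Int.mul_ediv_cancel_left _ (by norm_num), zpow_neg]
  simp [mul_assoc]

end Antipode

section RangeProd

variable {M : Type*} [Monoid M]

theorem prod_range_split (F : ℕ → M) (n r : ℕ) :
    ((List.range (n + r)).map F).prod =
      ((List.range n).map F).prod * ((List.range r).map fun j => F (n + j)).prod := by
  rw [List.range_add, List.map_append, List.prod_append, List.map_map]
  rfl

theorem prod_range_congr {F F' : ℕ → M} {n : ℕ} (h : ∀ j < n, F j = F' j) :
    ((List.range n).map F).prod = ((List.range n).map F').prod := by
  rw [List.map_congr_left fun j hj => h j (List.mem_range.1 hj)]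

theorem prod_range_at (F : ℕ → M) {n m : ℕ} (h : n < m) :
    ((List.range m).map F).prod = ((List.range n).map F).prod * F n *
      ((List.range (m - (n + 1))).map fun j => F (n + 1 + j)).prod := by
  conv_lhs => rw [← Nat.add_sub_cancel' (Nat.succ_le_of_lt h), prod_range_split]
  rw [Nat.succ_eq_add_one, prod_range_split F n 1]
  simp

theorem prod_range_congr_pair {F F' : ℕ → M} {n m : ℕ} (hn : n + 1 < m)
    (h : F n * F (n + 1) = F' n * F' (n + 1))
    (h' : ∀ j < m, j ≠ n → j ≠ n + 1 → F j = F' j) :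
    ((List.range m).map F).prod = ((List.range m).map F').prod := by
  obtain ⟨r, rfl⟩ := Nat.exists_eq_add_of_lt hn
  rw [show n + 1 + r + 1 = n + (2 + r) by omega] at h' ⊢
  rw [prod_range_split, prod_range_split, prod_range_split F', prod_range_split _ 2 r]
  congr 1
  · exact prod_range_congr fun j hj => h' j (by omega) (by omega) (by omega)
  congr 1
  · simpa [List.range_succ] using h
  · exact prod_range_congr fun j hj => h' _ (by omega) (by omega) (by omega)

end RangeProd

/-! ## Contents of strands -/

section Content

variable {k A ι : Type*} [CommRing k] [Ring A] [HopfAlgebra k A] (g : Augmentation k A)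

/-- The contribution of a point, with a bead `P` at the point, followed by a bead `S`. -/
noncomputable def strandFactor (P : ℕ × ℕ → A) (S : Loc → A) (x : Loc) (i : ℤ) : A :=
  (g.s ^ i) (P x.point) * (g.s ^ i) (S x)

/-- The content of the strand through `p`, with beads `P` at the points and beads `S` between
them. -/
noncomputable def strandContent (T : List Layer) (P : ℕ × ℕ → A) (S : Loc → A) (p : ℕ × ℕ) : A :=
  ((List.range (Function.minimalPeriod (follow T) (upLoc p))).map fun j =>
      strandFactor g P S ((follow T)^[j] (upLoc p)) (exponent T (upLoc p) j)).prod *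
    ((g.G ^ (exponent T (upLoc p) (Function.minimalPeriod (follow T) (upLoc p)) / 2) : Aˣ) : A)

/-- The product of the contents of the open strand and the traces of the contents of the
closed components. -/
noncomputable def diagramTerm (tr : ℕ × ℕ → A →ₗ[k] k) (T : List Layer) (P : ℕ × ℕ → A)
    (S : Loc → A) : A :=
  (∏ p ∈ closedBases T, tr p (strandContent g T P S p)) • strandContent g T P S (0, 0)

/-- The beads on the way from the point of `x` to the point of `y`, concentrated at `x`. -/
noncomputable def joint (P : ℕ × ℕ → A) (S : Loc → A) (x y : Loc) (δ : ℤ) : A :=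
  if x.up then P x.point * S x * (g.s ^ (-δ)) (P y.point)
  else (g.s ^ (-δ)) (P y.point) * S x * P x.point

/-- `joint` multiplies in upward order. Even exponents belong to upward motion and odd ones, which
reverse products, to downward motion; either way the beads unfold in the order of travel. -/
theorem zpow_joint {P : ℕ × ℕ → A} {S : Loc → A} {x y : Loc} {δ i : ℤ}
    (hi : Even i ↔ x.up = true) :
    (g.s ^ i) (joint g P S x y δ) =
      strandFactor g P S x i * (g.s ^ (i - δ)) (P y.point) := by
  rw [joint, strandFactor, sub_eq_add_neg, g.zpow_add_apply]
  split_ifs with h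
  · rw [g.zpow_mul_of_even (hi.2 h), g.zpow_mul_of_even (hi.2 h)]
  · rw [g.zpow_mul_of_odd (fun h' => h (hi.1 h')), g.zpow_mul_of_odd (fun h' => h (hi.1 h')),
      mul_assoc]

section Strand

variable {T : List Layer} (hT : IsTangle 1 T 1)
include hT

theorem IsTangle.even_exponent_minimalPeriod {p : ℕ × ℕ} (hp : p ∈ points T) :
    Even (exponent T (upLoc p) (Function.minimalPeriod (follow T) (upLoc p))) := by
  rw [hT.even_exponent (x := upLoc p) hp, Function.iterate_minimalPeriod]

omit hT in
theorem strandContent_congr {P P' : ℕ × ℕ → A} {S S' : Loc → A} {p : ℕ × ℕ}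
    (hP : ∀ q, SameStrand T p q → P q = P' q)
    (hS : ∀ z, Reach T (upLoc p) z → S z = S' z) :
    strandContent g T P S p = strandContent g T P' S' p := by
  unfold strandContent
  congr 1
  refine prod_range_congr fun j _ => ?_
  rw [strandFactor, strandFactor, hP _ (sameStrand_iff.2 ⟨_, ⟨j, rfl⟩, rfl⟩), hS _ ⟨j, rfl⟩]

/-- A change of beads along one edge enters the content only through the product concentrated at
`x`. If the edge closes the period, its two ends stand at opposite ends of the word and only the
trace is preserved. -/
theorem IsTangle.strandContent_joint {x y : Loc} {δ : ℤ} {p : ℕ × ℕ} (hp : p ∈ points T)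
    (hx : Reach T (upLoc p) x) (h : next T x = some (y, δ)) {P P' : ℕ × ℕ → A}
    {S S' : Loc → A} (hP : ∀ q, q ≠ x.point → q ≠ y.point → P q = P' q)
    (hS : ∀ z, z ≠ x → z ≠ y.rev → S z = S' z)
    (hJ : joint g P S x y δ = joint g P' S' x y δ) :
    (p = (0, 0) → strandContent g T P S p = strandContent g T P' S' p) ∧
      ∀ tr : A →ₗ[k] k, IsTrace k tr →
        tr (strandContent g T P S p) = tr (strandContent g T P' S' p) := by
  have hpv : (upLoc p).Valid T := hp
  have hxv := hT.reach_valid hpv hx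
  obtain ⟨n, hn, rfl⟩ := hT.reach_lt hpv hx
  obtain ⟨-, hr, -, hne⟩ := hT.next_rev hxv h
  have hy := follow_of_next h
  have hδ := turnAt_of_next h
  have hrev : ∀ j, (follow T)^[j] (upLoc p) ≠ y.rev := fun j hj => by
    have h1 : Reach T (upLoc p) y := ⟨n + 1, by rw [Function.iterate_succ_apply', hy]⟩
    exact hT.not_reach_rev hpv h1 ⟨j, hj⟩
  have key : ∀ {P P' : ℕ × ℕ → A} {S S' : Loc → A},
      (hJ : joint g P S ((follow T)^[n] (upLoc p)) y δ =
        joint g P' S' ((follow T)^[n] (upLoc p)) y δ) →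
      strandFactor g P S ((follow T)^[n] (upLoc p)) (exponent T (upLoc p) n) *
          (g.s ^ (exponent T (upLoc p) (n + 1))) (P y.point) =
        strandFactor g P' S' ((follow T)^[n] (upLoc p)) (exponent T (upLoc p) n) *
          (g.s ^ (exponent T (upLoc p) (n + 1))) (P' y.point) := fun hJ => by
    have he : Even (exponent T (upLoc p) n) ↔ ((follow T)^[n] (upLoc p)).up = true :=
      hT.even_exponent hpv n
    rw [exponent_succ, hδ, ← zpow_joint g he, ← zpow_joint g he, hJ]
  have hSy : S y = S' y := hS y (fun h => hne (by rw [h])) (Loc.rev_ne y).symm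
  have hother : ∀ j < Function.minimalPeriod (follow T) (upLoc p), j ≠ n →
      (follow T)^[j] (upLoc p) ≠ y →
      strandFactor g P S ((follow T)^[j] (upLoc p)) (exponent T (upLoc p) j) =
        strandFactor g P' S' ((follow T)^[j] (upLoc p)) (exponent T (upLoc p) j) := by
    intro j hj hjn hjy
    have h1 : ((follow T)^[j] (upLoc p)).point ≠ ((follow T)^[n] (upLoc p)).point :=
      fun h => hjn (hT.point_injOn hpv hj hn h)
    have h2 : ((follow T)^[j] (upLoc p)).point ≠ y.point := fun h => by
      rcases Loc.eq_or_eq_rev h with h | h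
      · exact hjy h
      · exact hrev j h
    rw [strandFactor, strandFactor, hP _ h1 h2,
      hS _ (fun h => h1 (by rw [h])) (hrev j)]
  by_cases hlast : n + 1 < Function.minimalPeriod (follow T) (upLoc p)
  · have : strandContent g T P S p = strandContent g T P' S' p := by
      unfold strandContent
      congr 1
      refine prod_range_congr_pair hlast ?_ fun j hj h1 h2 => hother j hj h1 fun h => h2 ?_
      · have hF : ∀ (P : ℕ × ℕ → A) (S : Loc → A) (i : ℤ), strandFactor g P S y i =
            (g.s ^ i) (P y.point) * (g.s ^ i) (S y) := fun _ _ _ => rfl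
        rw [Function.iterate_succ_apply', hy, hF, hF, ← mul_assoc, ← mul_assoc, hSy, key hJ]
      · refine hT.point_injOn hpv hj hlast ?_
        rw [h, Function.iterate_succ_apply', hy]
    exact ⟨fun _ => this, fun tr _ => by rw [this]⟩
  · have hm : Function.minimalPeriod (follow T) (upLoc p) = n + 1 := by omega
    have hyb : y = upLoc p := by
      rw [← hy, ← Function.iterate_succ_apply' (follow T), Nat.succ_eq_add_one, ← hm,
        Function.iterate_minimalPeriod]
    subst hyb
    -- Consecutive points differ, so the period is not one.
    have hn0 : n ≠ 0 := fun h0 => hne (by rw [h0]; rfl)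
    obtain ⟨r, rfl⟩ := Nat.exists_eq_succ_of_ne_zero hn0
    constructor
    -- The open strand has no such edge: the reverse motion at its base leaves the diagram.
    · rintro rfl
      have := (hT.next_eq_none (Loc.valid_rev.2 hpv)).2 (Or.inr rfl)
      rw [this] at hr
      cases hr
    · intro tr htr
      -- Cyclicity of the trace moves the base factor to the end of the word. Passing it over the
      -- power of `G` applies the full exponent of the period, exactly as if the strand had been
      -- followed once more into the base point.
      have hrot : ∀ {P : ℕ × ℕ → A} {S : Loc → A}, tr (strandContent g T P S p) =
          tr ((strandFactor g P S ((follow T)^[r + 1] (upLoc p)) (exponent T (upLoc p) (r + 1)) *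
            (g.s ^ (exponent T (upLoc p) (r + 1 + 1))) (P (upLoc p).point)) *
            (g.s ^ (exponent T (upLoc p) (r + 1 + 1))) (S (upLoc p)) *
            (((g.G ^ (exponent T (upLoc p) (r + 1 + 1) / 2) : Aˣ) : A) *
            ((List.range r).map fun j => strandFactor g P S ((follow T)^[1 + j] (upLoc p))
              (exponent T (upLoc p) (1 + j))).prod)) := by
        intro P S
        have hev := hT.even_exponent_minimalPeriod hp
        rw [hm] at hev
        unfold strandContent
        rw [hm, Nat.succ_eq_add_one, show r + 1 + 1 = 1 + (r + 1) by omega, prod_range_split,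
          prod_range_split _ r 1, mul_assoc, mul_assoc, ← mul_assoc, htr.mul_comm]
        simp only [List.range_one, List.map_cons, List.map_nil, List.prod_cons, List.prod_nil,
          mul_one, Function.iterate_zero, id, exponent_zero, add_zero]
        rw [show 1 + (r + 1) = r + 1 + 1 by omega, add_comm 1 r]
        congr 1
        have h0 : strandFactor g P S (upLoc p) 0 = P (upLoc p).point * S (upLoc p) := by
          simp [strandFactor]
        rw [h0, mul_assoc, ← mul_assoc _ (P _ * S _), g.G_mul hev, g.zpow_mul_of_even hev]
        simp only [mul_assoc]
      rw [hrot, hrot, key hJ, hSy]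
      congr 3
      refine prod_range_congr fun j hj => hother _ (by omega) (by omega) fun h => ?_
      have := hT.point_injOn hpv (i := 1 + j) (j := 0) (by omega) (by omega) (by rw [h]; rfl)
      omega

/-- A component runs along the edge in one direction, in the other, or not at all; hence the two
hypotheses on `joint`. -/
theorem IsTangle.diagramTerm_joint {tr : ℕ × ℕ → A →ₗ[k] k} (htr : ∀ p, IsTrace k (tr p))
    {x y : Loc} {δ : ℤ} (hx : x.Valid T) (h : next T x = some (y, δ)) {P P' : ℕ × ℕ → A}
    {S S' : Loc → A} (hP : ∀ q, q ≠ x.point → q ≠ y.point → P q = P' q)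
    (hS : ∀ z, z ≠ x → z ≠ y.rev → S z = S' z)
    (hJ : joint g P S x y δ = joint g P' S' x y δ)
    (hJ' : joint g P S y.rev x.rev (-δ) = joint g P' S' y.rev x.rev (-δ)) :
    diagramTerm g tr T P S = diagramTerm g tr T P' S' := by
  have key : ∀ p ∈ insert (0, 0) (closedBases T),
      (p = (0, 0) → strandContent g T P S p = strandContent g T P' S' p) ∧
      ∀ tr : A →ₗ[k] k, IsTrace k tr →
        tr (strandContent g T P S p) = tr (strandContent g T P' S' p) := by
    intro p hp
    have hpm := (hT.base_mem hp).1
    have hpv : (upLoc p).Valid T := hpm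
    obtain ⟨hyv, hr, -, -⟩ := hT.next_rev hx h
    have hxy : Reach T x y := ⟨1, follow_of_next h⟩
    by_cases h1 : Reach T (upLoc p) x
    · exact hT.strandContent_joint g hpm h1 h hP hS hJ
    by_cases h2 : Reach T (upLoc p) y.rev
    · refine hT.strandContent_joint g hpm h2 hr (fun q hq hq' => hP q hq' hq) ?_ hJ'
      intro z hz hz'
      rw [Loc.rev_rev] at hz'
      exact hS z hz' hz
    have h3 : ¬ Reach T (upLoc p) x.rev := fun h => h2 (h.trans (hT.reach_symm
      (Loc.valid_rev.2 hyv) ⟨1, follow_of_next hr⟩))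
    have h4 : ¬ Reach T (upLoc p) y := fun h => h1 (h.trans (hT.reach_symm hx hxy))
    have : strandContent g T P S p = strandContent g T P' S' p := by
      refine strandContent_congr g (fun q hq => hP q ?_ ?_) fun z hz => hS z ?_ ?_
      · rintro rfl
        obtain ⟨z, hz, hzx⟩ := sameStrand_iff.1 hq
        rcases Loc.eq_or_eq_rev hzx with rfl | rfl
        exacts [h1 hz, h3 hz]
      · rintro rfl
        obtain ⟨z, hz, hzx⟩ := sameStrand_iff.1 hq
        rcases Loc.eq_or_eq_rev hzx with rfl | rfl
        exacts [h4 hz, h2 hz]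
      · rintro rfl
        exact h1 hz
      · rintro rfl
        exact h2 hz
    exact ⟨fun _ => this, fun tr _ => by rw [this]⟩
  unfold diagramTerm
  rw [(key _ (Finset.mem_insert_self _ _)).1 rfl]
  congr 1
  exact Finset.prod_congr rfl fun p hp => (key p (Finset.mem_insert_of_mem hp)).2 _ (htr p)

/-- The strand passes the point only once, so the bead there enters one factor of the word. -/
theorem IsTangle.strandContent_update {p q : ℕ × ℕ} (hp : p ∈ points T) (h : SameStrand T p q)
    (P : ℕ × ℕ → A) (S : Loc → A) :
    ∃ L : A →ₗ[k] A, ∀ c, strandContent g T (Function.update P q c) S p = L c := by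
  have hpv : (upLoc p).Valid T := hp
  obtain ⟨y, hy, rfl⟩ := sameStrand_iff.1 h
  obtain ⟨n, hn, rfl⟩ := hT.reach_lt hpv hy
  set Q := (((List.range (Function.minimalPeriod (follow T) (upLoc p) - (n + 1))).map fun j =>
      strandFactor g P S ((follow T)^[n + 1 + j] (upLoc p))
        (exponent T (upLoc p) (n + 1 + j))).prod *
    ((g.G ^ (exponent T (upLoc p) (Function.minimalPeriod (follow T) (upLoc p)) / 2) : Aˣ) : A))
    with hQ
  refine ⟨LinearMap.mulLeft k ((List.range n).map fun j =>
      strandFactor g P S ((follow T)^[j] (upLoc p)) (exponent T (upLoc p) j)).prod ∘ₗ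
    LinearMap.mulRight k ((g.s ^ exponent T (upLoc p) n) (S ((follow T)^[n] (upLoc p))) * Q) ∘ₗ
    (g.s ^ exponent T (upLoc p) n).toLinearMap, fun c => ?_⟩
  have key : ∀ j < Function.minimalPeriod (follow T) (upLoc p), j ≠ n →
      strandFactor g (Function.update P ((follow T)^[n] (upLoc p)).point c) S
        ((follow T)^[j] (upLoc p)) (exponent T (upLoc p) j) =
      strandFactor g P S ((follow T)^[j] (upLoc p)) (exponent T (upLoc p) j) := by
    intro j hj hjn
    rw [strandFactor, Function.update_of_ne, strandFactor]
    exact fun h => hjn (hT.point_injOn hpv hj hn h)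
  unfold strandContent
  rw [prod_range_at _ hn, prod_range_congr fun j hj => key j (by omega) (by omega),
    prod_range_congr fun j hj => key (n + 1 + j) (by omega) (by omega)]
  simp only [LinearMap.comp_apply, LinearMap.mulLeft_apply, LinearMap.mulRight_apply, hQ,
    LinearEquiv.coe_coe, strandFactor, Function.update_self, mul_assoc]

omit hT in
theorem strandContent_update_of_not {p q : ℕ × ℕ} (h : ¬ SameStrand T p q)
    (P : ℕ × ℕ → A) (S : Loc → A) (c : A) :
    strandContent g T (Function.update P q c) S p = strandContent g T P S p :=
  strandContent_congr g (fun r hr => Function.update_of_ne (by rintro rfl; exact h hr) _ _)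
    fun _ _ => rfl

/-- The value of a diagram is linear in the bead at each point. -/
theorem IsTangle.diagramTerm_update {q : ℕ × ℕ} (hq : q ∈ points T) (tr : ℕ × ℕ → A →ₗ[k] k)
    (P : ℕ × ℕ → A) (S : Loc → A) :
    ∃ L : A →ₗ[k] A, ∀ c, diagramTerm g tr T (Function.update P q c) S = L c := by
  obtain ⟨p, hp, hpq⟩ := hT.exists_base hq
  obtain ⟨L, hL⟩ := hT.strandContent_update g (hT.base_mem hp).1 hpq P S
  have hother : ∀ p' ∈ insert (0, 0) (closedBases T), p' ≠ p → ∀ c,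
      strandContent g T (Function.update P q c) S p' = strandContent g T P S p' :=
    fun p' hp' hne c => strandContent_update_of_not g
      (fun h => hne (hT.base_unique hp' hp h hpq)) P S c
  have h0 := hT.start_notMem_closedBases
  rcases Finset.mem_insert.1 hp with rfl | hpc
  · refine ⟨(∏ p ∈ closedBases T, tr p (strandContent g T P S p)) • L, fun c => ?_⟩
    rw [diagramTerm, hL, LinearMap.smul_apply]
    congr 1
    refine Finset.prod_congr rfl fun p' hp' => ?_
    rw [hother p' (Finset.mem_insert_of_mem hp') (by rintro rfl; exact h0 hp')]
  · refine ⟨((∏ p' ∈ (closedBases T).erase p, tr p' (strandContent g T P S p')) •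
      (tr p ∘ₗ L)).smulRight (strandContent g T P S (0, 0)), fun c => ?_⟩
    rw [diagramTerm, hother _ (Finset.mem_insert_self _ _) (by rintro rfl; exact h0 hpc),
      ← Finset.prod_erase_mul _ _ hpc, hL, LinearMap.smulRight_apply, LinearMap.smul_apply,
      LinearMap.comp_apply, smul_eq_mul]
    congr 2
    refine Finset.prod_congr rfl fun p' hp' => ?_
    obtain ⟨h1, h2⟩ := Finset.mem_erase.1 hp'
    rw [hother p' (Finset.mem_insert_of_mem h2) h1]

end Strand

end Content

end BeadPush

namespace BeadPush

/-! ## Evaluation of decorated diagrams -/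

/-- Validity of `x` is not needed: a crossing has two ends on each side, and these determine the leg
even for positions off the diagram. -/
theorem passage_node_crossing {T : List Layer} {x : Loc} {t : ℕ} {l : Layer} {leg : Leg}
    (h : passage T x = .node t l leg) (hc : l.gen.isCrossing = true) :
    T[t]? = some l ∧ x = (leg.out t l.left).rev := by
  obtain ⟨t', j, u⟩ := x
  have key : ∀ {t' : ℕ} {l' : Layer}, T[t']? = some l' →
      (passUp t' l' j = .node t l leg → T[t]? = some l ∧
        (⟨t', j, true⟩ : Loc) = (leg.out t l.left).rev) ∧
      (passDown t' l' j = .node t l leg → T[t]? = some l ∧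
        (⟨t' + 1, j, false⟩ : Loc) = (leg.out t l.left).rev) := by
    intro t' l' hl
    constructor
    · intro h
      unfold passUp at h
      split_ifs at h with h1 h2 h3 <;> cases h <;> refine ⟨hl, ?_⟩
      · simp [Leg.out, Loc.rev, h3]
      · rcases l with ⟨_, _ | _ | _ | _, _⟩ <;>
          simp [Gen.src, Gen.isCrossing, Leg.out, Loc.rev] at h1 h2 h3 hc ⊢ <;> omega
    · intro h
      unfold passDown at h
      split_ifs at h with h1 h2 h3 <;> cases h <;> refine ⟨hl, ?_⟩
      · simp [Leg.out, Loc.rev, h3]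
      · rcases l with ⟨_, _ | _ | _ | _, _⟩ <;>
          simp [Gen.tgt, Gen.isCrossing, Leg.out, Loc.rev] at h1 h2 h3 hc ⊢ <;> omega
  cases u with
  | true =>
    simp only [passage] at h
    split at h
    · rename_i l' hl
      exact (key hl).1 h
    · cases h
  | false =>
    cases t' with
    | zero => simp [passage] at h
    | succ t' =>
      simp only [passage] at h
      split at h
      · rename_i l' hl
        exact (key hl).2 h
      · cases h

theorem mem_crossings {T : List Layer} {t : ℕ} {l : Layer} (hl : T[t]? = some l) :
    t ∈ crossings T ↔ l.gen.isCrossing = true := by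
  rw [crossings, Finset.mem_filter, Finset.mem_range, hl]
  simp [(List.getElem?_eq_some_iff.1 hl).1]

theorem map_prod_of_length_le_one {M N : Type*} [Monoid M] [Monoid N] {φ : M → N} (h1 : φ 1 = 1)
    {l : List M} (hl : l.length ≤ 1) : (l.map φ).prod = φ l.prod := by
  match l, hl with
  | [], _ => simp [h1]
  | [a], _ => simp

theorem exists_tensor_lift {k A M : Type*} [CommRing k] [AddCommGroup A] [Module k A]
    [AddCommGroup M] [Module k M] {B : A → A → M}
    (h1 : ∀ y, ∃ L : A →ₗ[k] M, ∀ x, B x y = L x) (h2 : ∀ x, ∃ L : A →ₗ[k] M, ∀ y, B x y = L y) :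
    ∃ L : A ⊗[k] A →ₗ[k] M, ∀ x y, B x y = L (x ⊗ₜ y) := by
  choose L1 hL1 using h1
  choose L2 hL2 using h2
  refine ⟨TensorProduct.lift (LinearMap.mk₂ k B ?_ ?_ ?_ ?_), fun x y => by
    rw [TensorProduct.lift.tmul]; rfl⟩
  · intro x x' y
    simp only [hL1, map_add]
  · intro c x y
    simp only [hL1, map_smul]
  · intro x y y'
    simp only [hL2, map_add]
  · intro c x y
    simp only [hL2, map_smul]

section Evaluate

variable {k A ι : Type*} [CommRing k] [Ring A] [HopfAlgebra k A] (g : Augmentation k A)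
  (e f : ι → A)

/-- The products of the beads at the points. -/
def pointBeads (D : Loc → List A) (q : ℕ × ℕ) : A := (D (upLoc q) ++ D (upLoc q).rev).prod

theorem pointBeads_point (D : Loc → List A) (x : Loc) :
    pointBeads D x.point = if x.up then (D x).prod * (D x.rev).prod
      else (D x.rev).prod * (D x).prod := by
  obtain ⟨t, j, _ | _⟩ := x <;> simp [pointBeads, upLoc, Loc.rev, Loc.point]

theorem strandBead_eq_one {T : List Layer} {σ : crossings T → ι} {x : Loc}
    (h : ∀ t l leg, passage T x = .node t l leg → l.gen.isCrossing = false) :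
    strandBead g e f T σ x = 1 := by
  unfold strandBead
  split
  · rename_i t l leg hn
    have := h t l leg hn
    split
    · generalize l.gen = G at this
      cases G <;> simp [crossingBead, Gen.isCrossing] at this ⊢
    · rfl
  · rfl

theorem strandBead_out {T : List Layer} {σ : crossings T → ι} {t : ℕ} {l : Layer}
    (hl : T[t]? = some l) (hc : l.gen.isCrossing = true) (leg : Leg) :
    strandBead g e f T σ (leg.out t l.left).rev =
      crossingBead g e f (σ ⟨t, (mem_crossings hl).2 hc⟩) l.gen leg := by
  have hleg : l.gen.HasLeg leg := by
    generalize l.gen = G at hc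
    cases G <;> simp [Gen.isCrossing, Gen.HasLeg] at hc ⊢
  rw [strandBead, passage_out hl hleg]
  simp [(mem_crossings hl).2 hc]

/-- The value of a diagram with beads at the points. -/
noncomputable def evalPoints [Fintype ι] (tr : ℕ × ℕ → A →ₗ[k] k) (T : List Layer)
    (P : ℕ × ℕ → A) : A :=
  ∑ σ : crossings T → ι, diagramTerm g tr T P (strandBead g e f T σ)

variable {T : List Layer} (hT : IsTangle 1 T 1)
include hT

/-- With at most one bead on each half, the beads at a point may be multiplied in upward order
first; parity of the exponent restores the order of motion. -/
theorem IsTangle.content_eq {σ : crossings T → ι} {D : Loc → List A}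
    (hD : ∀ x, (D x).length ≤ 1) {p : ℕ × ℕ} (hp : p ∈ insert (0, 0) (closedBases T)) :
    content g e f T σ D p = strandContent g T (pointBeads D) (strandBead g e f T σ) p := by
  obtain ⟨hpm, hb⟩ := hT.base_mem hp
  have hpv : (upLoc p).Valid T := hpm
  rw [content, strandContent, hT.strand_eq hpm hb, List.map_map]
  congr 2
  refine List.map_congr_left fun j _ => ?_
  have hev := hT.even_exponent hpv j
  simp only [Function.comp_apply, strandFactor]
  generalize (follow T)^[j] (upLoc p) = x at hev
  generalize exponent T (upLoc p) j = i at hev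
  rw [List.map_append, List.prod_append, List.map_append, List.prod_append,
    map_prod_of_length_le_one (g.zpow_one_apply i) (hD _),
    map_prod_of_length_le_one (g.zpow_one_apply i) (hD _), pointBeads_point]
  simp only [List.map_cons, List.map_nil, List.prod_cons, List.prod_nil, mul_one]
  congr 1
  split_ifs with h
  · rw [g.zpow_mul_of_even (hev.2 h)]
  · rw [g.zpow_mul_of_odd (fun h' => h (hev.1 h'))]

theorem IsTangle.evalTangle_eq [Fintype ι] (tr : ℕ × ℕ → A →ₗ[k] k) {D : Loc → List A}
    (hD : ∀ x, (D x).length ≤ 1) :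
    evalTangle g e f tr T D = evalPoints g e f tr T (pointBeads D) := by
  unfold evalTangle evalPoints diagramTerm
  refine Finset.sum_congr rfl fun σ _ => ?_
  rw [hT.content_eq g e f hD (Finset.mem_insert_self _ _)]
  congr 1
  exact Finset.prod_congr rfl fun p hp => by
    rw [hT.content_eq g e f hD (Finset.mem_insert_of_mem hp)]

theorem IsTangle.evalPoints_update [Fintype ι] {q : ℕ × ℕ} (hq : q ∈ points T)
    (tr : ℕ × ℕ → A →ₗ[k] k) (P : ℕ × ℕ → A) :
    ∃ L : A →ₗ[k] A, ∀ c, evalPoints g e f tr T (Function.update P q c) = L c := by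
  choose L hL using fun σ => hT.diagramTerm_update g hq tr P (strandBead g e f T σ)
  refine ⟨∑ σ, L σ, fun c => ?_⟩
  rw [evalPoints, LinearMap.sum_apply]
  exact Finset.sum_congr rfl fun σ _ => hL σ c

/-- Sliding a bead along a vertical line or around a maximum or minimum. -/
theorem IsTangle.evalPoints_slide [Fintype ι] {tr : ℕ × ℕ → A →ₗ[k] k}
    (htr : ∀ p, IsTrace k (tr p)) {x y : Loc} {δ : ℤ} (hx : x.Valid T)
    (h : next T x = some (y, δ))
    (hS : ∀ σ : crossings T → ι, strandBead g e f T σ x = 1 ∧ strandBead g e f T σ y.rev = 1)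
    {P P' : ℕ × ℕ → A} (hP : ∀ q, q ≠ x.point → q ≠ y.point → P q = P' q)
    (hPx : P' x.point = 1)
    (hPy : P' y.point = if y.up then (g.s ^ δ) (P x.point) * P y.point
      else P y.point * (g.s ^ δ) (P x.point)) :
    evalPoints g e f tr T P = evalPoints g e f tr T P' := by
  have hpar := (hT.next_rev hx h).2.2.1
  have hinv : ∀ c, (g.s ^ (-δ)) ((g.s ^ δ) c) = c := fun c => by
    rw [← g.zpow_add_apply]
    simp
  refine Finset.sum_congr rfl fun σ _ => hT.diagramTerm_joint g htr hx h hP (fun _ _ _ => rfl) ?_ ?_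
  · rw [joint, joint, (hS σ).1, hPx, hPy]
    simp only [mul_one, one_mul]
    by_cases hδ : Even δ
    · have hδ' : Even (-δ) := even_neg.2 hδ
      rw [hpar.1 hδ]
      split_ifs
      · rw [g.zpow_mul_of_even hδ', hinv]
      · rw [g.zpow_mul_of_even hδ', hinv]
    · have hδ' : ¬ Even (-δ) := fun h => hδ (even_neg.1 h)
      have hne : y.up = !x.up := by
        rw [hpar] at hδ
        generalize y.up = a, x.up = b at hδ
        revert a b
        decide
      rw [hne]
      rcases x.up
      · simp only [Bool.not_false, if_true, if_false, Bool.false_eq_true,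
          g.zpow_mul_of_odd hδ', hinv]
      · simp only [Bool.not_true, if_true, if_false, Bool.false_eq_true,
          g.zpow_mul_of_odd hδ', hinv]
  · rw [joint, joint, (hS σ).2, Loc.point_rev, Loc.point_rev, hPx, hPy, neg_neg, g.zpow_one_apply,
      Loc.up_rev]
    rcases y.up <;> simp

omit hT in
/-- The tensor of the beads of the two upward strands at a crossing. -/
noncomputable def crossingTensor [Fintype ι] (G : Gen) : A ⊗[k] A :=
  ∑ i, crossingBead g e f i G .lr ⊗ₜ[k] crossingBead g e f i G .ll

/-- Gathers the bead between two points and the beads at both of them at the lower point. Strands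
through a crossing make no half turn, so no antipode appears. -/
theorem IsTangle.diagramTerm_concentrate {tr : ℕ × ℕ → A →ₗ[k] k} (htr : ∀ p, IsTrace k (tr p))
    {x y : Loc} (hx : x.Valid T) (h : next T x = some (y, 0)) (hup : x.up = true)
    (P : ℕ × ℕ → A) {S : Loc → A} (hS : S y.rev = S x) :
    diagramTerm g tr T P S =
      diagramTerm g tr T
        (Function.update (Function.update P y.point 1) x.point (P x.point * S x * P y.point))
        (Function.update (Function.update S x 1) y.rev 1) := by
  obtain ⟨-, -, h3, hne⟩ := hT.next_rev hx h
  have hyup : y.up = true := by simpa [hup] using h3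
  refine hT.diagramTerm_joint g htr hx h (fun q h1 h2 => ?_) (fun z h1 h2 => ?_) ?_ ?_
  · rw [Function.update_of_ne h1, Function.update_of_ne h2]
  · rw [Function.update_of_ne h2, Function.update_of_ne h1]
  · have hxy : x ≠ y.rev := fun h => by simp [h, hyup] at hup
    simp [joint, hup, hne, hxy]
  · simp [joint, hyup, hS, hne]

/-- After all beads at the crossing are concentrated on its two lower points, the value is bilinear
in them. Summing over the terms of the Yang-Baxter element at this crossing assembles the product in
`A ⊗ A`. -/
theorem IsTangle.evalPoints_crossing [Fintype ι] {tr : ℕ × ℕ → A →ₗ[k] k}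
    (htr : ∀ p, IsTrace k (tr p)) {t : ℕ} {l : Layer} (hl : T[t]? = some l)
    (hc : l.gen.isCrossing = true) (P : ℕ × ℕ → A) :
    ∃ L : A ⊗[k] A →ₗ[k] A, ∀ P' : ℕ × ℕ → A,
      (∀ q, (∀ leg : Leg, q ≠ (leg.out t l.left).point) → P' q = P q) →
      evalPoints g e f tr T P' =
        L ((P' (Leg.out t l.left .lr).point ⊗ₜ P' (Leg.out t l.left .ll).point) *
          crossingTensor g e f l.gen *
          (P' (Leg.out t l.left .ul).point ⊗ₜ P' (Leg.out t l.left .ur).point)) := by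
  classical
  have hleg : ∀ leg, l.gen.HasLeg leg := by
    intro leg
    generalize l.gen = G at hc
    cases G <;> simp [Gen.isCrossing, Gen.HasLeg] at hc ⊢
  have hv : ∀ leg : Leg, (leg.out t l.left).Valid T := fun leg => hT.valid_out hl (hleg leg)
  have hstr : ∀ leg, l.gen.strand leg = leg.cw.cw := by
    intro leg
    generalize l.gen = G at hc
    cases G <;> simp [Gen.isCrossing, Gen.strand] at hc ⊢
  have hne : ∀ {a b : Leg}, a ≠ b → (a.out t l.left).point ≠ (b.out t l.left).point :=
    fun h h' => h (Leg.out_point_injective h')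
  have hne' : ∀ {a b : Leg}, a ≠ b → (a.out t l.left).rev ≠ (b.out t l.left).rev :=
    fun h h' => h (Leg.out_injective (Loc.rev_injective h'))
  have hn1 : next T (Leg.out t l.left .lr).rev = some (Leg.out t l.left .ul, 0) := by
    simp [next, passage_out hl (hleg _), hstr, Leg.cw, turn]
  have hn2 : next T (Leg.out t l.left .ll).rev = some (Leg.out t l.left .ur, 0) := by
    simp [next, passage_out hl (hleg _), hstr, Leg.cw, turn]
  have hcb : ∀ i, crossingBead g e f i l.gen .ul = crossingBead g e f i l.gen .lr ∧
      crossingBead g e f i l.gen .ur = crossingBead g e f i l.gen .ll := by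
    intro i
    generalize l.gen = G at hc
    cases G <;> simp [Gen.isCrossing, crossingBead] at hc ⊢
  have htc := (mem_crossings hl).2 hc
  set plr := (Leg.out t l.left .lr).point with hplr
  set pll := (Leg.out t l.left .ll).point with hpll
  set pul := (Leg.out t l.left .ul).point with hpul
  set pur := (Leg.out t l.left .ur).point with hpur
  -- What remains of the Yang-Baxter beads no longer depends on the term chosen at this crossing.
  let S' : (crossings T → ι) → Loc → A := fun σ x =>
    if ∃ leg : Leg, x = (leg.out t l.left).rev then 1 else strandBead g e f T σ x
  have hS' : ∀ σ σ' : crossings T → ι, (∀ j, j ≠ ⟨t, htc⟩ → σ j = σ' j) → S' σ = S' σ' := by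
    intro σ σ' h
    funext x
    simp only [S']
    split_ifs with hx
    · rfl
    · unfold strandBead
      split
      · rename_i t' l' leg' hn
        split
        · rename_i ht'
          by_cases htt : t' = t
          · subst htt
            have hcc : l'.gen.isCrossing = true ∨ l'.gen.isCrossing = false := by
              rcases l'.gen.isCrossing <;> simp
            rcases hcc with hcc | hcc
            · obtain ⟨h1, h2⟩ := passage_node_crossing hn hcc
              rw [hl] at h1
              cases h1
              exact absurd ⟨_, h2⟩ hx
            · generalize l'.gen = G at hcc
              cases G <;> simp [Gen.isCrossing, crossingBead] at hcc ⊢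
          · rw [h]
            simpa using htt
        · rfl
      · rfl
  let P'' : A → A → ℕ × ℕ → A := fun u w =>
    Function.update (Function.update (Function.update (Function.update P pul 1) pur 1) plr u) pll w
  have hmain : ∀ P' : ℕ × ℕ → A, (∀ q, (∀ leg : Leg, q ≠ (leg.out t l.left).point) → P' q = P q) →
      ∀ σ, diagramTerm g tr T P' (strandBead g e f T σ) =
        diagramTerm g tr T (P'' (P' plr * crossingBead g e f (σ ⟨t, htc⟩) l.gen .lr * P' pul)
          (P' pll * crossingBead g e f (σ ⟨t, htc⟩) l.gen .ll * P' pur)) (S' σ) := by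
    intro P' hP' σ
    have hb := strandBead_out g e f (σ := σ) hl hc
    rw [hT.diagramTerm_concentrate g htr (Loc.valid_rev.2 (hv _)) hn1 rfl P' (by rw [hb, hb, (hcb _).1]),
      hT.diagramTerm_concentrate g htr (Loc.valid_rev.2 (hv _)) hn2 rfl]
    · rw [hb]
      simp only [Loc.point_rev, ← hplr, ← hpul, ← hpll, ← hpur]
      congr 1
      · funext q
        simp only [P'', Function.update_apply]
        rw [if_neg (show pll ≠ plr from hne (by decide)),
          if_neg (show pll ≠ pul from hne (by decide)), if_neg (hne' (by decide)),
          if_neg (hne' (by decide)), hb, if_neg (show pur ≠ plr from hne (by decide)),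
          if_neg (show pur ≠ pul from hne (by decide))]
        by_cases h1 : q = pll
        · simp [h1]
        by_cases h2 : q = plr
        · have : plr ≠ pur := hne (by decide)
          have h3 : plr ≠ pll := hne (by decide)
          simp [h2, this, h3]
        by_cases h3 : q = pur
        · have : pur ≠ plr := hne (by decide)
          simp [h3, this]
        by_cases h4 : q = pul
        · have : pul ≠ plr := hne (by decide)
          simp [h4, this]
        simp only [h1, h2, h3, h4, if_false]
        refine hP' q fun leg => ?_
        cases leg <;> assumption
      · funext x
        simp only [S', Function.update_apply]
        by_cases hx : ∃ leg : Leg, x = (leg.out t l.left).rev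
        · rw [if_pos hx]
          obtain ⟨leg, rfl⟩ := hx
          cases leg <;> simp
        · rw [if_neg hx]
          push Not at hx
          simp [hx]
    · rw [Function.update_of_ne (hne' (by decide)), Function.update_of_ne (hne' (by decide)),
        Function.update_of_ne (hne' (by decide)), Function.update_of_ne (hne' (by decide)), hb, hb,
        (hcb _).2]
  have hpt : plr ≠ pll := hne (by decide)
  have hbil : ∀ σ, ∃ L : A ⊗[k] A →ₗ[k] A, ∀ u w,
      diagramTerm g tr T (P'' u w) (S' σ) = L (u ⊗ₜ w) := by
    intro σ
    refine exists_tensor_lift (fun w => ?_) fun u => ?_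
    · obtain ⟨L, hL⟩ := hT.diagramTerm_update g (hv .lr) tr (Function.update (Function.update
        (Function.update P pul 1) pur 1) pll w) (S' σ)
      refine ⟨L, fun u => ?_⟩
      rw [← hL]
      simp only [P'']
      rw [Function.update_comm hpt]
    · exact hT.diagramTerm_update g (hv .ll) tr _ (S' σ)
  choose L hL using hbil
  have hsplit := fun φ : (crossings T → ι) → A =>
    (Equiv.sum_comp (Equiv.piSplitAt (⟨t, htc⟩ : crossings T) (fun _ => ι)).symm φ).symm
  rcases isEmpty_or_nonempty ι with hι | ⟨⟨i₀⟩⟩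
  · refine ⟨0, fun P' _ => ?_⟩
    have : IsEmpty (crossings T → ι) := ⟨fun σ => hι.elim (σ ⟨t, htc⟩)⟩
    simp [evalPoints]
  · refine ⟨∑ τ, L ((Equiv.piSplitAt (⟨t, htc⟩ : crossings T) (fun _ => ι)).symm (i₀, τ)),
      fun P' hP' => ?_⟩
    rw [evalPoints, hsplit, Fintype.sum_prod_type_right, LinearMap.sum_apply]
    refine Finset.sum_congr rfl fun τ _ => ?_
    rw [crossingTensor, Finset.mul_sum, Finset.sum_mul, map_sum]
    refine Finset.sum_congr rfl fun i _ => ?_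
    rw [hmain P' hP', hS' _ ((Equiv.piSplitAt (⟨t, htc⟩ : crossings T) (fun _ => ι)).symm (i₀, τ)),
      hL, Equiv.piSplitAt_symm_apply]
    · simp [hplr, hpul, hpll, hpur]
    · intro j hj
      simp [Equiv.piSplitAt_symm_apply, hj]

theorem IsTangle.diagramTerm_start (tr : ℕ × ℕ → A →ₗ[k] k) (S : Loc → A) (a : A) :
    diagramTerm g tr T (Function.update 1 (0, 0) a) S = a * diagramTerm g tr T 1 S := by
  have h0 := hT.start_notMem_closedBases
  have hv : (upLoc (0, 0)).Valid T := start_valid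
  have hpos := hT.minimalPeriod_pos hv
  have hfac : strandFactor g (Function.update 1 (0, 0) a) S ((follow T)^[0] (upLoc (0, 0)))
      (exponent T (upLoc (0, 0)) 0) =
      a * strandFactor g 1 S ((follow T)^[0] (upLoc (0, 0))) (exponent T (upLoc (0, 0)) 0) := by
    simp [strandFactor]
  have h1 : strandContent g T (Function.update 1 (0, 0) a) S (0, 0) =
      a * strandContent g T 1 S (0, 0) := by
    unfold strandContent
    rw [prod_range_at _ hpos, prod_range_at _ hpos, ← mul_assoc, ← mul_assoc,
      prod_range_congr (F := fun j => strandFactor g (Function.update 1 (0, 0) a) S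
        ((follow T)^[0 + 1 + j] (upLoc (0, 0))) (exponent T (upLoc (0, 0)) (0 + 1 + j)))
        (F' := fun j => strandFactor g 1 S ((follow T)^[0 + 1 + j] (upLoc (0, 0)))
        (exponent T (upLoc (0, 0)) (0 + 1 + j)))]
    · rw [hfac]
      simp [mul_assoc]
    · intro j hj
      rw [strandFactor, strandFactor, Function.update_of_ne]
      intro h
      have := hT.point_injOn hv (i := 0 + 1 + j) (j := 0) (by omega) hpos h
      omega
  unfold diagramTerm
  rw [h1, mul_smul_comm]
  congr 1
  refine Finset.prod_congr rfl fun p hp => ?_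
  rw [strandContent_update_of_not]
  intro h
  exact h0 (hT.base_unique (Finset.mem_insert_of_mem hp) (Finset.mem_insert_self _ _) h
    (.refl _) ▸ hp)

/-- The bead is the last factor before the power of `G` and carries the same even exponent; moved
past it, it appears on the right without antipode. -/
theorem IsTangle.diagramTerm_top (tr : ℕ × ℕ → A →ₗ[k] k) {S : Loc → A} (hS : S (topLoc T) = 1)
    (a : A) :
    diagramTerm g tr T (Function.update 1 (topLoc T).point a) S = diagramTerm g tr T 1 S * a := by
  have h0 := hT.start_notMem_closedBases
  have hv : (upLoc (0, 0)).Valid T := start_valid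
  have hpos := hT.minimalPeriod_pos hv
  have hfol : follow T (topLoc T) = upLoc (0, 0) := by
    rw [follow, (hT.next_eq_none hT.topLoc_valid).2 (Or.inl rfl)]
    rfl
  have hturn : turnAt T (topLoc T) = 0 := by
    rw [turnAt, (hT.next_eq_none hT.topLoc_valid).2 (Or.inl rfl)]
  have hreach : Reach T (upLoc (0, 0)) (topLoc T) :=
    hT.reach_symm hT.topLoc_valid ⟨1, hfol⟩
  obtain ⟨n, hn, hnt⟩ := hT.reach_lt hv hreach
  have hm : Function.minimalPeriod (follow T) (upLoc (0, 0)) = n + 1 := by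
    by_contra hne
    refine Function.not_isPeriodicPt_of_pos_of_lt_minimalPeriod (n := n + 1) (by omega)
      (f := follow T) (x := upLoc (0, 0)) (by omega) ?_
    rw [Function.IsPeriodicPt, Function.IsFixedPt, Function.iterate_succ_apply', hnt, hfol]
  have hev := hT.even_exponent_minimalPeriod (p := (0, 0)) hv
  have h1 : strandContent g T (Function.update 1 (topLoc T).point a) S (0, 0) =
      strandContent g T 1 S (0, 0) * a := by
    unfold strandContent
    have hex : exponent T (upLoc (0, 0)) (n + 1) = exponent T (upLoc (0, 0)) n := by
      rw [exponent_succ, hnt, hturn, sub_zero]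
    rw [hm, hex] at hev ⊢
    rw [List.range_succ, List.map_append, List.map_append, List.prod_append, List.prod_append,
      prod_range_congr (F' := fun j => strandFactor g 1 S ((follow T)^[j] (upLoc (0, 0)))
        (exponent T (upLoc (0, 0)) j)), mul_assoc, mul_assoc, mul_assoc]
    · simp [strandFactor, hnt, hS, g.zpow_one_apply, g.G_mul hev]
    · intro j hj
      rw [strandFactor, strandFactor, Function.update_of_ne]
      intro h
      rw [← hnt] at h
      have := hT.point_injOn hv (by omega) hn h
      omega
  unfold diagramTerm
  rw [h1, smul_mul_assoc]
  congr 1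
  refine Finset.prod_congr rfl fun p hp => ?_
  rw [strandContent_update_of_not]
  intro h
  exact h0 (hT.base_unique (Finset.mem_insert_of_mem hp) (Finset.mem_insert_self _ _) h
    (sameStrand_iff.2 ⟨_, hreach, rfl⟩) ▸ hp)

theorem IsTangle.tangleElement_eq [Fintype ι] (tr : ℕ × ℕ → A →ₗ[k] k) :
    tangleElement g e f tr T = evalPoints g e f tr T 1 := by
  rw [tangleElement, hT.evalTangle_eq g e f tr (by simp)]
  rfl

theorem IsTangle.evalPoints_start [Fintype ι] (tr : ℕ × ℕ → A →ₗ[k] k) (a : A) :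
    evalPoints g e f tr T (Function.update 1 (0, 0) a) = a * tangleElement g e f tr T := by
  rw [hT.tangleElement_eq, evalPoints, evalPoints, Finset.mul_sum]
  exact Finset.sum_congr rfl fun σ _ => hT.diagramTerm_start g tr _ a

theorem IsTangle.evalPoints_top [Fintype ι] (tr : ℕ × ℕ → A →ₗ[k] k) (a : A) :
    evalPoints g e f tr T (Function.update 1 (topLoc T).point a) =
      tangleElement g e f tr T * a := by
  rw [hT.tangleElement_eq, evalPoints, evalPoints, Finset.sum_mul]
  refine Finset.sum_congr rfl fun σ _ => hT.diagramTerm_top g tr ?_ a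
  refine strandBead_eq_one g e f fun t l leg h => ?_
  rw [(hT.passage_exit hT.topLoc_valid).2 (Or.inl rfl)] at h
  cases h

end Evaluate

end BeadPush

namespace BeadPush

/-! ## Sweedler sums -/

section Sweedler

variable {k A : Type*} [CommRing k] [Ring A] [HopfAlgebra k A]
variable {M : Type*} [AddCommGroup M] [Module k M]

theorem isLinearMap_of_exists {F : A → M} (h : ∃ L : A →ₗ[k] M, ∀ c, F c = L c) :
    IsLinearMap k F := by
  obtain ⟨L, hL⟩ := h
  rw [funext hL]
  exact L.isLinear

/-- `K` is linear in each of its three entries. -/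
structure IsTrilinear (k : Type*) {A M : Type*} [CommRing k] [AddCommGroup A] [Module k A]
    [AddCommGroup M] [Module k M] (K : A → A → A → M) : Prop where
  fst : ∀ y z, IsLinearMap k fun x => K x y z
  snd : ∀ x z, IsLinearMap k fun y => K x y z
  thd : ∀ x y, IsLinearMap k fun z => K x y z

theorem IsTrilinear.exists_lift {K : A → A → A → M} (h : IsTrilinear k K) :
    ∃ L : A ⊗[k] (A ⊗[k] A) →ₗ[k] M, ∀ x y z, K x y z = L (x ⊗ₜ (y ⊗ₜ z)) := by
  have h2 : ∀ x, ∃ L : A ⊗[k] A →ₗ[k] M, ∀ y z, K x y z = L (y ⊗ₜ z) := fun x =>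
    exists_tensor_lift (fun z => ⟨(h.snd x z).mk' _, fun _ => rfl⟩)
      fun y => ⟨(h.thd x y).mk' _, fun _ => rfl⟩
  choose L hL using h2
  have hadd : ∀ x x', L (x + x') = L x + L x' := fun x x' =>
    TensorProduct.ext' fun y z => by
      rw [LinearMap.add_apply, ← hL, ← hL, ← hL, (h.fst y z).map_add]
  have hsmul : ∀ (c : k) x, L (c • x) = c • L x := fun c x =>
    TensorProduct.ext' fun y z => by
      rw [LinearMap.smul_apply, ← hL, ← hL, (h.fst y z).map_smul]
  refine ⟨TensorProduct.lift ⟨⟨L, hadd⟩, hsmul⟩, fun x y z => ?_⟩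
  rw [TensorProduct.lift.tmul]
  exact hL x y z

theorem sum_repr (L : A ⊗[k] A →ₗ[k] M) (a : A) :
    ∑ i ∈ (Coalgebra.Repr.arbitrary k a).index,
      L ((Coalgebra.Repr.arbitrary k a).left i ⊗ₜ (Coalgebra.Repr.arbitrary k a).right i) =
    L (Coalgebra.comul a) := by
  rw [← map_sum, (Coalgebra.Repr.arbitrary k a).eq]

theorem IsTrilinear.sum_coassoc {K : A → A → A → M} (h : IsTrilinear k K) (a : A) :
    ∑ i ∈ (Coalgebra.Repr.arbitrary k a).index,
      ∑ j ∈ (Coalgebra.Repr.arbitrary k ((Coalgebra.Repr.arbitrary k a).right i)).index,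
      K ((Coalgebra.Repr.arbitrary k a).left i)
        ((Coalgebra.Repr.arbitrary k ((Coalgebra.Repr.arbitrary k a).right i)).left j)
        ((Coalgebra.Repr.arbitrary k ((Coalgebra.Repr.arbitrary k a).right i)).right j) =
    ∑ i ∈ (Coalgebra.Repr.arbitrary k a).index,
      ∑ j ∈ (Coalgebra.Repr.arbitrary k ((Coalgebra.Repr.arbitrary k a).left i)).index,
      K ((Coalgebra.Repr.arbitrary k ((Coalgebra.Repr.arbitrary k a).left i)).left j)
        ((Coalgebra.Repr.arbitrary k ((Coalgebra.Repr.arbitrary k a).left i)).right j)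
        ((Coalgebra.Repr.arbitrary k a).right i) := by
  obtain ⟨L, hL⟩ := h.exists_lift
  have := congrArg L (Coalgebra.sum_tmul_tmul_eq (Coalgebra.Repr.arbitrary k a)
    (fun i => Coalgebra.Repr.arbitrary k ((Coalgebra.Repr.arbitrary k a).left i))
    (fun i => Coalgebra.Repr.arbitrary k ((Coalgebra.Repr.arbitrary k a).right i)))
  simp only [map_sum] at this
  simp only [hL]
  exact this.symm

/-- `f` is linear in each entry of a list of length `n`. -/
def IsMultilinear (k : Type*) {A : Type*} [CommRing k] [Ring A] [HopfAlgebra k A] (n : ℕ)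
    (f : List A → A) : Prop :=
  ∀ v w, v.length + w.length + 1 = n → ∃ L : A →ₗ[k] A, ∀ c, f (v ++ c :: w) = L c

theorem IsMultilinear.cons {n : ℕ} {f : List A → A} (hf : IsMultilinear k (n + 1) f) (u : A) :
    IsMultilinear k n fun v => f (u :: v) := fun v w h =>
  hf (u :: v) w (by simp; omega)

theorem IsMultilinear.append_left {n m : ℕ} {f : List A → A} (hf : IsMultilinear k (m + n) f)
    {u : List A} (hu : u.length = m) : IsMultilinear k n fun v => f (u ++ v) := fun v w h => by
  obtain ⟨L, hL⟩ := hf (u ++ v) w (by simp; omega)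
  exact ⟨L, fun c => by rw [← hL, List.append_assoc]⟩

theorem IsMultilinear.append_right {n m : ℕ} {f : List A → A} (hf : IsMultilinear k (n + m) f)
    {u : List A} (hu : u.length = m) : IsMultilinear k n fun v => f (v ++ u) := fun v w h => by
  obtain ⟨L, hL⟩ := hf v (w ++ u) (by simp; omega)
  exact ⟨L, fun c => by simp [← hL]⟩

theorem sweedler_congr {n : ℕ} {f f' : List A → A} (h : ∀ v, v.length = n → f v = f' v) (a : A) :
    sweedler k n a f = sweedler k n a f' := by
  induction n generalizing f f' a with
  | zero => rw [sweedler, sweedler, h _ rfl]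
  | succ n ih =>
    rw [sweedler, sweedler]
    exact Finset.sum_congr rfl fun i _ => ih (fun v hv => h _ (by simp [hv])) _

/-- Linear dependence on a parameter survives Sweedler summation, which allows nested sums to be
lifted to tensor products. -/
theorem sweedler_param {n : ℕ} {F : A → List A → A}
    (h : ∀ v, v.length = n → ∃ L : A →ₗ[k] A, ∀ u, F u v = L u) (a : A) :
    ∃ L : A →ₗ[k] A, ∀ u, sweedler k n a (F u) = L u := by
  induction n generalizing F a with
  | zero =>
    obtain ⟨L, hL⟩ := h [] rfl
    exact ⟨Coalgebra.counit (R := k) a • L, fun u => by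
      rw [sweedler, hL, LinearMap.smul_apply]⟩
  | succ n ih =>
    choose L hL using fun i => ih (F := fun u v =>
      F u ((Coalgebra.Repr.arbitrary k a).left i :: v)) (fun v hv => h _ (by simp [hv]))
      ((Coalgebra.Repr.arbitrary k a).right i)
    refine ⟨∑ i ∈ (Coalgebra.Repr.arbitrary k a).index, L i, fun u => ?_⟩
    rw [sweedler, LinearMap.sum_apply]
    exact Finset.sum_congr rfl fun i _ => hL i u

theorem sweedler_sum {κ : Type*} (s : Finset κ) {n : ℕ} (F : κ → List A → A) (a : A) :
    sweedler k n a (fun v => ∑ i ∈ s, F i v) = ∑ i ∈ s, sweedler k n a (F i) := by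
  induction n generalizing F a with
  | zero => rw [sweedler, Finset.smul_sum]; rfl
  | succ n ih =>
    simp only [sweedler, ih]
    rw [Finset.sum_comm]

theorem sweedler_smul {n : ℕ} (c : k) (f : List A → A) (a : A) :
    sweedler k n a (fun v => c • f v) = c • sweedler k n a f := by
  induction n generalizing f a with
  | zero => rw [sweedler, sweedler, smul_comm]
  | succ n ih => simp only [sweedler, ih, Finset.smul_sum]

theorem IsMultilinear.sweedler_linear {n : ℕ} {f : List A → A} (hf : IsMultilinear k n f) :
    ∃ L : A →ₗ[k] A, ∀ a, sweedler k n a f = L a := by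
  induction n generalizing f with
  | zero =>
    exact ⟨(Coalgebra.counit (R := k) (A := A)).smulRight (f []), fun a => rfl⟩
  | succ n ih =>
    have h2 : ∃ L : A ⊗[k] A →ₗ[k] A, ∀ u w, sweedler k n w (fun v => f (u :: v)) =
        L (u ⊗ₜ w) := by
      refine exists_tensor_lift (fun w => sweedler_param (fun v hv => ?_) w)
        fun u => ih (hf.cons u)
      exact hf [] v (by simp [hv])
    obtain ⟨L, hL⟩ := h2
    refine ⟨L ∘ₗ Coalgebra.comul, fun a => ?_⟩
    rw [sweedler, LinearMap.comp_apply, ← sum_repr]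
    exact Finset.sum_congr rfl fun i _ => hL _ _

/-- The recursion ends in a counit, so a single factor appears as `∑ ε(a_2) a_1`. -/
theorem sweedler_one {f : List A → A} (hf : IsMultilinear k 1 f) (a : A) :
    sweedler k 1 a f = f [a] := by
  obtain ⟨L, hL⟩ := hf [] [] rfl
  simp only [List.nil_append] at hL
  simp only [sweedler, hL]
  have := congrArg (TensorProduct.lift ((LinearMap.lsmul k A).flip))
    (Coalgebra.sum_tmul_counit_eq (Coalgebra.Repr.arbitrary k a))
  simp only [map_sum, TensorProduct.lift.tmul, LinearMap.flip_apply, LinearMap.lsmul_apply,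
    one_smul] at this
  rw [← congrArg L this, map_sum]
  simp

theorem sweedler_two {f : List A → A} (hf : IsMultilinear k 2 f) (a : A) :
    sweedler k 2 a f = ∑ i ∈ (Coalgebra.Repr.arbitrary k a).index,
      f [(Coalgebra.Repr.arbitrary k a).left i, (Coalgebra.Repr.arbitrary k a).right i] := by
  rw [sweedler]
  exact Finset.sum_congr rfl fun i _ => sweedler_one (hf.cons _) _

theorem sweedler_three {f : List A → A} (hf : IsMultilinear k 3 f) (a : A) :
    sweedler k 3 a f = ∑ i ∈ (Coalgebra.Repr.arbitrary k a).index,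
      ∑ j ∈ (Coalgebra.Repr.arbitrary k ((Coalgebra.Repr.arbitrary k a).right i)).index,
      f [(Coalgebra.Repr.arbitrary k a).left i,
        (Coalgebra.Repr.arbitrary k ((Coalgebra.Repr.arbitrary k a).right i)).left j,
        (Coalgebra.Repr.arbitrary k ((Coalgebra.Repr.arbitrary k a).right i)).right j] := by
  rw [sweedler]
  exact Finset.sum_congr rfl fun i _ => sweedler_two (hf.cons _) _

/-- Generalized coassociativity; the case `r = 0` is the counit law. Together with linearity it
makes a block of consecutive factors replaceable. -/
theorem sweedler_add {r n : ℕ} {f : List A → A} (hf : IsMultilinear k (r + n) f) (a : A) :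
    sweedler k (r + n) a f = ∑ i ∈ (Coalgebra.Repr.arbitrary k a).index,
      sweedler k n ((Coalgebra.Repr.arbitrary k a).right i) fun w =>
        sweedler k r ((Coalgebra.Repr.arbitrary k a).left i) fun v => f (v ++ w) := by
  induction r generalizing f a with
  | zero =>
    rw [zero_add] at hf ⊢
    obtain ⟨L, hL⟩ := hf.sweedler_linear
    simp only [sweedler, List.nil_append, sweedler_smul, hL]
    rw [← congrArg L (Coalgebra.sum_counit_smul (Coalgebra.Repr.arbitrary k a))]
    simp
  | succ r ih =>
    rw [show r + 1 + n = r + n + 1 by omega] at hf ⊢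
    simp only [sweedler]
    rw [Finset.sum_congr rfl fun i _ => ih (hf.cons _) _]
    simp only [sweedler_sum, List.cons_append]
    have h : IsTrilinear k fun x y z : A =>
        sweedler k n z fun w => sweedler k r y fun v => f (x :: (v ++ w)) := by
      constructor
      · intro y z
        refine isLinearMap_of_exists (sweedler_param (fun w hw => sweedler_param
          (fun v hv => ?_) y) z)
        exact hf [] (v ++ w) (by simp; omega)
      · intro x z
        refine isLinearMap_of_exists (sweedler_param (fun w hw => ?_) z)
        exact ((hf.cons x).append_right hw).sweedler_linear
      · intro x y
        refine isLinearMap_of_exists (IsMultilinear.sweedler_linear fun v w hvw => ?_)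
        refine sweedler_param (fun u hu => ?_) y
        obtain ⟨L, hL⟩ := hf (x :: (u ++ v)) w (by simp; omega)
        exact ⟨L, fun c => by rw [← hL]; simp⟩
    exact h.sum_coassoc a

/-- Replacing consecutive factors of an iterated coproduct. -/
theorem sweedler_replace {m r r' n : ℕ} {f f' : List A → A}
    (hf : IsMultilinear k (m + (r + n)) f) (hf' : IsMultilinear k (m + (r' + n)) f')
    (h : ∀ u w, u.length = m → w.length = n → ∀ c,
      sweedler k r c (fun v => f (u ++ (v ++ w))) = sweedler k r' c fun v => f' (u ++ (v ++ w)))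
    (a : A) : sweedler k (m + (r + n)) a f = sweedler k (m + (r' + n)) a f' := by
  induction m generalizing f f' a with
  | zero =>
    rw [zero_add] at hf hf' ⊢
    rw [zero_add, sweedler_add hf, sweedler_add hf']
    refine Finset.sum_congr rfl fun i _ => sweedler_congr (fun w hw => ?_) _
    exact h [] w rfl hw _
  | succ m ih =>
    rw [Nat.add_right_comm] at hf hf' ⊢
    rw [Nat.add_right_comm m 1, sweedler, sweedler]
    refine Finset.sum_congr rfl fun i _ => ih (hf.cons _) (hf'.cons _) (fun u w hu hw c => ?_) _
    exact h (_ :: u) w (by simp [hu]) hw c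

end Sweedler

/-! ## The antipode and the coproduct -/

section Hopf

variable {k A ι : Type*} [CommRing k] [Ring A] [HopfAlgebra k A]

/-- Uniqueness of convolution inverses: the right side is a left inverse of the coproduct, and the
coproduct composed with the antipode is a right inverse. -/
theorem comul_antipode (a : A) : Coalgebra.comul (R := k) (HopfAlgebra.antipode k a) =
    TensorProduct.map (HopfAlgebra.antipode k) (HopfAlgebra.antipode k)
      (TensorProduct.comm k A A (Coalgebra.comul a)) := by
  let F : A →ₗ[k] A ⊗[k] A := TensorProduct.map (HopfAlgebra.antipode k) (HopfAlgebra.antipode k) ∘ₗ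
    (TensorProduct.comm k A A).toLinearMap ∘ₗ Coalgebra.comul
  have hF : ∀ b, F b = ∑ i ∈ (Coalgebra.Repr.arbitrary k b).index,
      HopfAlgebra.antipode k ((Coalgebra.Repr.arbitrary k b).right i) ⊗ₜ[k]
        HopfAlgebra.antipode k ((Coalgebra.Repr.arbitrary k b).left i) := fun b => by
    simp only [F, LinearMap.comp_apply]
    conv_lhs => rw [← (Coalgebra.Repr.arbitrary k b).eq]
    simp
  have hK : IsTrilinear k fun x y z : A =>
      (HopfAlgebra.antipode k y ⊗ₜ[k] HopfAlgebra.antipode k x) * Coalgebra.comul (R := k) z := by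
    constructor <;> intros <;> constructor <;> intros <;>
      simp [TensorProduct.add_tmul, TensorProduct.tmul_add, add_mul, mul_add,
        ← TensorProduct.smul_tmul']
  have hK' : ∀ l : A, IsTrilinear k fun x y z : A =>
      (HopfAlgebra.antipode k x * y) ⊗ₜ[k] (HopfAlgebra.antipode k l * z) := fun l => by
    constructor <;> intros <;> constructor <;> intros <;>
      simp [TensorProduct.add_tmul, TensorProduct.tmul_add, add_mul, mul_add,
        ← TensorProduct.smul_tmul']
  have hinv : WithConv.toConv F * WithConv.toConv (Coalgebra.comul (R := k) (A := A)) = 1 := by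
    ext b
    rw [(Coalgebra.Repr.arbitrary k b).convMul_apply]
    simp only [hF, Finset.sum_mul]
    rw [← hK.sum_coassoc]
    -- The inner antipode cancels first; the outer one is then left next to its own partner.
    have hin : ∀ l c : A, ∑ j ∈ (Coalgebra.Repr.arbitrary k c).index,
        (HopfAlgebra.antipode k ((Coalgebra.Repr.arbitrary k c).left j) ⊗ₜ[k]
          HopfAlgebra.antipode k l) *
          Coalgebra.comul (R := k) ((Coalgebra.Repr.arbitrary k c).right j) =
        1 ⊗ₜ[k] (HopfAlgebra.antipode k l * c) := by
      intro l c
      have h1 : ∀ x z : A, (HopfAlgebra.antipode k x ⊗ₜ[k] HopfAlgebra.antipode k l) *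
          Coalgebra.comul (R := k) z = ∑ j ∈ (Coalgebra.Repr.arbitrary k z).index,
          (HopfAlgebra.antipode k x * (Coalgebra.Repr.arbitrary k z).left j) ⊗ₜ[k]
            (HopfAlgebra.antipode k l * (Coalgebra.Repr.arbitrary k z).right j) := by
        intro x z
        conv_lhs => rw [← (Coalgebra.Repr.arbitrary k z).eq]
        simp [Finset.mul_sum]
      simp only [h1]
      rw [(hK' l).sum_coassoc]
      simp only [← TensorProduct.sum_tmul, HopfAlgebra.sum_antipode_mul_eq_smul]
      simp only [TensorProduct.smul_tmul, ← mul_smul_comm, ← TensorProduct.tmul_sum,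
        ← Finset.mul_sum, Coalgebra.sum_counit_smul]
    simp only [hin, ← TensorProduct.tmul_sum, HopfAlgebra.sum_antipode_mul_eq_smul]
    simp [Algebra.TensorProduct.one_def, Algebra.algebraMap_eq_smul_one]
  have := left_inv_eq_right_inv hinv LinearMap.comul_right_inv
  exact (LinearMap.congr_fun (congrArg WithConv.ofConv this) a).symm

end Hopf

end BeadPush

/-! ### Bead-push identities at a crossing -/

namespace BeadPush

section Push

variable {k A ι : Type*} [CommRing k] [Ring A] [HopfAlgebra k A]

/-- The sum `∑ F a_1 a_2` over the coproduct of `a`. -/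
noncomputable def comulSum (k : Type*) {A M : Type*} [CommRing k] [Ring A] [HopfAlgebra k A]
    [AddCommGroup M] (F : A → A → M) (a : A) : M :=
  ∑ i ∈ (Coalgebra.Repr.arbitrary k a).index,
    F ((Coalgebra.Repr.arbitrary k a).left i) ((Coalgebra.Repr.arbitrary k a).right i)

variable {M : Type*} [AddCommGroup M] [Module k M]

theorem comulSum_tmul (L : A ⊗[k] A →ₗ[k] M) (a : A) :
    comulSum k (fun x y => L (x ⊗ₜ y)) a = L (Coalgebra.comul a) := sum_repr L a

omit [Module k M] in
theorem comulSum_congr {F F' : A → A → M} (h : ∀ x y, F x y = F' x y) (a : A) :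
    comulSum k F a = comulSum k F' a := by
  simp only [comulSum, h]

theorem IsTrilinear.comulSum_coassoc {K : A → A → A → M} (h : IsTrilinear k K) (a : A) :
    comulSum k (fun x w => comulSum k (fun y z => K x y z) w) a =
      comulSum k (fun w z => comulSum k (fun x y => K x y z) w) a := h.sum_coassoc a

theorem comulSum_counit_left (L : A →ₗ[k] M) (a : A) :
    comulSum k (fun x y => Coalgebra.counit (R := k) x • L y) a = L a := by
  conv_rhs => rw [← Coalgebra.sum_counit_smul (Coalgebra.Repr.arbitrary k a)]
  simp [comulSum]

theorem comulSum_counit_right (L : A →ₗ[k] M) (a : A) :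
    comulSum k (fun x y => Coalgebra.counit (R := k) y • L x) a = L a := by
  have := congrArg (fun t => L (TensorProduct.lift ((LinearMap.lsmul k A).flip) t))
    (Coalgebra.sum_tmul_counit_eq (Coalgebra.Repr.arbitrary k a))
  simp only [map_sum, TensorProduct.lift.tmul, LinearMap.flip_apply, LinearMap.lsmul_apply,
    map_smul, one_smul] at this
  exact this

variable (g : Augmentation k A)

theorem comul_s (a : A) : Coalgebra.comul (R := k) (g.s a) =
    TensorProduct.comm k A A (TensorProduct.map g.s.toLinearMap g.s.toLinearMap
      (Coalgebra.comul a)) := by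
  rw [g.s_apply, comul_antipode, TensorProduct.map_comm]
  rfl

theorem map_zpow_add (i j : ℤ) (t : A ⊗[k] A) :
    TensorProduct.map (g.s ^ (i + j)).toLinearMap (g.s ^ (i + j)).toLinearMap t =
      TensorProduct.map (g.s ^ i).toLinearMap (g.s ^ i).toLinearMap
        (TensorProduct.map (g.s ^ j).toLinearMap (g.s ^ j).toLinearMap t) := by
  rw [zpow_add]
  exact LinearMap.congr_fun (TensorProduct.map_comp _ _ _ _) t

theorem comul_zpow_two_mul (n : ℤ) (a : A) : Coalgebra.comul (R := k) ((g.s ^ (2 * n)) a) =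
    TensorProduct.map (g.s ^ (2 * n)).toLinearMap (g.s ^ (2 * n)).toLinearMap
      (Coalgebra.comul a) := by
  have h2 : ∀ a, Coalgebra.comul (R := k) ((g.s ^ (2 : ℤ)) a) =
      TensorProduct.map (g.s ^ (2 : ℤ)).toLinearMap (g.s ^ (2 : ℤ)).toLinearMap
        (Coalgebra.comul a) := fun a => by
    rw [show (2 : ℤ) = 1 + 1 from rfl, g.zpow_add_apply, map_zpow_add, zpow_one, comul_s, comul_s,
      TensorProduct.map_comm]
    simp
  have hneg : ∀ a, Coalgebra.comul (R := k) ((g.s ^ (-2 : ℤ)) a) =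
      TensorProduct.map (g.s ^ (-2 : ℤ)).toLinearMap (g.s ^ (-2 : ℤ)).toLinearMap
        (Coalgebra.comul a) := fun a => by
    have h := h2 ((g.s ^ (-2 : ℤ)) a)
    rw [← g.zpow_add_apply, add_neg_cancel, zpow_zero, LinearEquiv.coe_one, id] at h
    conv_rhs => rw [h, ← map_zpow_add, neg_add_cancel, zpow_zero]
    exact (LinearMap.congr_fun TensorProduct.map_id _).symm
  induction n using Int.induction_on with
  | zero =>
    simp
  | succ n ih =>
    rw [show 2 * ((n : ℤ) + 1) = 2 + 2 * n by ring, g.zpow_add_apply, h2, ih, ← map_zpow_add]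
  | pred n ih =>
    rw [show 2 * (-(n : ℤ) - 1) = -2 + 2 * (-n) by ring, g.zpow_add_apply, hneg, ih,
      ← map_zpow_add]

theorem comul_zpow_of_even {p : ℤ} (hp : Even p) (a : A) :
    Coalgebra.comul (R := k) ((g.s ^ p) a) =
      TensorProduct.map (g.s ^ p).toLinearMap (g.s ^ p).toLinearMap (Coalgebra.comul a) := by
  obtain ⟨n, rfl⟩ := hp
  rw [← two_mul, comul_zpow_two_mul]

theorem comul_zpow_of_odd {p : ℤ} (hp : ¬ Even p) (a : A) :
    Coalgebra.comul (R := k) ((g.s ^ p) a) = TensorProduct.comm k A A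
      (TensorProduct.map (g.s ^ p).toLinearMap (g.s ^ p).toLinearMap (Coalgebra.comul a)) := by
  obtain ⟨n, rfl⟩ := Int.not_even_iff_odd.1 hp
  rw [add_comm, g.zpow_add_apply, map_zpow_add, zpow_one, comul_s, comul_zpow_two_mul]

theorem comulSum_zpow_even {p : ℤ} (hp : Even p) (a : A) :
    comulSum k (fun x y => (g.s ^ p) x ⊗ₜ[k] (g.s ^ p) y) a =
      Coalgebra.comul (R := k) ((g.s ^ p) a) ∧
    comulSum k (fun x y => (g.s ^ p) y ⊗ₜ[k] (g.s ^ p) x) a =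
      TensorProduct.comm k A A (Coalgebra.comul (R := k) ((g.s ^ p) a)) := by
  rw [comul_zpow_of_even g hp]
  exact ⟨comulSum_tmul (TensorProduct.map (g.s ^ p).toLinearMap (g.s ^ p).toLinearMap) a,
    comulSum_tmul ((TensorProduct.comm k A A).toLinearMap ∘ₗ
      TensorProduct.map (g.s ^ p).toLinearMap (g.s ^ p).toLinearMap) a⟩

theorem comulSum_zpow_odd {p : ℤ} (hp : ¬ Even p) (a : A) :
    comulSum k (fun x y => (g.s ^ p) x ⊗ₜ[k] (g.s ^ p) y) a =
      TensorProduct.comm k A A (Coalgebra.comul (R := k) ((g.s ^ p) a)) ∧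
    comulSum k (fun x y => (g.s ^ p) y ⊗ₜ[k] (g.s ^ p) x) a =
      Coalgebra.comul (R := k) ((g.s ^ p) a) := by
  rw [comul_zpow_of_odd g hp]
  refine ⟨?_, comulSum_tmul ((TensorProduct.comm k A A).toLinearMap ∘ₗ
      TensorProduct.map (g.s ^ p).toLinearMap (g.s ^ p).toLinearMap) a⟩
  have := comulSum_tmul (TensorProduct.map (g.s ^ p).toLinearMap (g.s ^ p).toLinearMap) a
  simpa using this

theorem comulSum_antipode_left (n : ℤ) (a : A) :
    comulSum k (fun x y => (g.s ^ n) (g.s x * y)) a = Coalgebra.counit (R := k) a • (1 : A) := by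
  have := congrArg (g.s ^ n)
    (HopfAlgebra.sum_antipode_mul_eq_smul (Coalgebra.Repr.arbitrary k a))
  rw [map_sum, map_smul, g.zpow_one_apply] at this
  exact this

theorem comulSum_antipode_right (n : ℤ) (a : A) :
    comulSum k (fun x y => (g.s ^ n) (x * g.s y)) a = Coalgebra.counit (R := k) a • (1 : A) := by
  have := congrArg (g.s ^ n)
    (HopfAlgebra.sum_mul_antipode_eq_smul (Coalgebra.Repr.arbitrary k a))
  rw [map_sum, map_smul, g.zpow_one_apply] at this
  exact this

theorem zpow_succ_apply (n : ℤ) (x : A) : (g.s ^ n) (g.s x) = (g.s ^ (n + 1)) x := by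
  rw [g.zpow_add_apply, zpow_one]

theorem zpow_mul_s_even {n : ℤ} (hn : Even n) (x y : A) :
    (g.s ^ (n + 1)) x * (g.s ^ n) y = (g.s ^ n) (g.s x * y) := by
  rw [g.zpow_mul_of_even hn, zpow_succ_apply]

theorem zpow_mul_s_odd {n : ℤ} (hn : ¬ Even n) (x y : A) :
    (g.s ^ n) y * (g.s ^ (n + 1)) x = (g.s ^ n) (g.s x * y) := by
  rw [g.zpow_mul_of_odd hn, zpow_succ_apply]

section Identities

variable {Q : A ⊗[k] A} (hQ : ∀ x : A, Q * Coalgebra.comul x =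
    TensorProduct.comm k A A (Coalgebra.comul x) * Q)
include hQ

/-- Even powers of `s` commute with the coproduct, so the intertwining property applies to the
transformed element. For odd powers the coproduct is reversed, and the beads start on the other side
of `Q`. -/
theorem exchange_even {p : ℤ} (hp : Even p) (X : A ⊗[k] A) (a : A) :
    comulSum k (fun y z => X * Q * ((g.s ^ p) y ⊗ₜ[k] (g.s ^ p) z)) a =
      comulSum k (fun y z => X * ((g.s ^ p) z ⊗ₜ[k] (g.s ^ p) y) * Q) a := by
  obtain ⟨h1, h2⟩ := comulSum_zpow_even (k := k) g hp a
  simp only [comulSum, ← Finset.mul_sum, ← Finset.sum_mul] at h1 h2 ⊢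
  rw [h1, h2, mul_assoc, hQ, mul_assoc]

theorem exchange_odd {p : ℤ} (hp : ¬ Even p) (X : A ⊗[k] A) (a : A) :
    comulSum k (fun y z => ((g.s ^ p) y ⊗ₜ[k] (g.s ^ p) z) * Q * X) a =
      comulSum k (fun y z => Q * ((g.s ^ p) z ⊗ₜ[k] (g.s ^ p) y) * X) a := by
  obtain ⟨h1, h2⟩ := comulSum_zpow_odd (k := k) g hp a
  simp only [comulSum, ← Finset.mul_sum, ← Finset.sum_mul] at h1 h2 ⊢
  rw [h1, h2, hQ]

/-- A bead arriving at a crossing from below on the right. -/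
theorem push_lr {p : ℤ} (hp : Even p) (a : A) :
    comulSum k (fun x w => comulSum k (fun y z => ((1 : A) ⊗ₜ[k] (g.s ^ (p + 1)) x) * Q *
      ((g.s ^ p) y ⊗ₜ[k] (g.s ^ p) z)) w) a = ((g.s ^ p) a ⊗ₜ[k] 1) * Q := by
  have hK : IsTrilinear k fun x y z : A =>
      ((g.s ^ p) z ⊗ₜ[k] ((g.s ^ (p + 1)) x * (g.s ^ p) y)) * Q := by
    constructor <;> intros <;> constructor <;> intros <;>
      simp [TensorProduct.add_tmul, TensorProduct.tmul_add, add_mul, mul_add,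
        ← TensorProduct.smul_tmul']
  calc _ = comulSum k (fun x w => comulSum k (fun y z =>
        ((g.s ^ p) z ⊗ₜ[k] ((g.s ^ (p + 1)) x * (g.s ^ p) y)) * Q) w) a := by
        refine comulSum_congr (fun x w => ?_) a
        rw [exchange_even g hQ hp]
        simp
    _ = comulSum k (fun w z => comulSum k (fun x y =>
        ((g.s ^ p) z ⊗ₜ[k] ((g.s ^ (p + 1)) x * (g.s ^ p) y)) * Q) w) a := hK.comulSum_coassoc a
    _ = comulSum k (fun w z => Coalgebra.counit (R := k) w • (((g.s ^ p) z ⊗ₜ[k] 1) * Q)) a := by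
        refine comulSum_congr (fun w z => ?_) a
        have := comulSum_antipode_left (k := k) g p w
        simp only [← zpow_mul_s_even g hp, comulSum] at this
        simp only [comulSum, ← Finset.sum_mul, ← TensorProduct.tmul_sum, this,
          TensorProduct.tmul_smul, smul_mul_assoc]
    _ = _ := comulSum_counit_left (LinearMap.mulRight k Q ∘ₗ
        (TensorProduct.mk k A A).flip 1 ∘ₗ (g.s ^ p).toLinearMap) a

/-- A bead arriving at a crossing from below on the left. -/
theorem push_ll {p : ℤ} (hp : Even p) (a : A) :
    comulSum k (fun x w => comulSum k (fun y z => ((g.s ^ (p - 1)) z ⊗ₜ[k] (1 : A)) * Q *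
      ((g.s ^ p) x ⊗ₜ[k] (g.s ^ p) y)) w) a = ((1 : A) ⊗ₜ[k] (g.s ^ p) a) * Q := by
  have hp' : ¬ Even (p - 1) := by
    rw [Int.even_sub_one]
    exact not_not.2 hp
  have hK : IsTrilinear k fun x y z : A =>
      ((g.s ^ (p - 1)) z ⊗ₜ[k] (1 : A)) * Q * ((g.s ^ p) x ⊗ₜ[k] (g.s ^ p) y) := by
    constructor <;> intros <;> constructor <;> intros <;>
      simp [TensorProduct.add_tmul, TensorProduct.tmul_add, add_mul, mul_add,
        ← TensorProduct.smul_tmul']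
  have hK' : IsTrilinear k fun x y z : A =>
      (((g.s ^ (p - 1)) z * (g.s ^ p) y) ⊗ₜ[k] (g.s ^ p) x) * Q := by
    constructor <;> intros <;> constructor <;> intros <;>
      simp [TensorProduct.add_tmul, TensorProduct.tmul_add, add_mul, mul_add,
        ← TensorProduct.smul_tmul']
  -- The factors `x`, `y` must be the two parts of one coproduct before they can pass `Q`;
  -- afterwards `y`, `z` are regrouped for the antipode.
  calc _ = comulSum k (fun w z => comulSum k (fun x y => ((g.s ^ (p - 1)) z ⊗ₜ[k] (1 : A)) * Q *
        ((g.s ^ p) x ⊗ₜ[k] (g.s ^ p) y)) w) a := hK.comulSum_coassoc a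
    _ = comulSum k (fun w z => comulSum k (fun x y =>
        (((g.s ^ (p - 1)) z * (g.s ^ p) y) ⊗ₜ[k] (g.s ^ p) x) * Q) w) a := by
        refine comulSum_congr (fun w z => ?_) a
        rw [exchange_even g hQ hp]
        simp
    _ = comulSum k (fun x w => comulSum k (fun y z =>
        (((g.s ^ (p - 1)) z * (g.s ^ p) y) ⊗ₜ[k] (g.s ^ p) x) * Q) w) a :=
        (hK'.comulSum_coassoc a).symm
    _ = comulSum k (fun x w => Coalgebra.counit (R := k) w • (((1 : A) ⊗ₜ[k] (g.s ^ p) x) * Q))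
        a := by
        refine comulSum_congr (fun x w => ?_) a
        have := comulSum_antipode_left (k := k) g (p - 1) w
        simp only [← zpow_mul_s_odd g hp', comulSum, sub_add_cancel] at this
        simp only [comulSum, ← Finset.sum_mul, ← TensorProduct.sum_tmul, this,
          ← TensorProduct.smul_tmul', smul_mul_assoc]
    _ = _ := comulSum_counit_right (LinearMap.mulRight k Q ∘ₗ
        TensorProduct.mk k A A 1 ∘ₗ (g.s ^ p).toLinearMap) a

/-- A bead arriving at a crossing from above on the left. -/
theorem push_ul {p : ℤ} (hp : ¬ Even p) (a : A) :
    comulSum k (fun x w => comulSum k (fun y z => ((g.s ^ p) y ⊗ₜ[k] (g.s ^ p) z) * Q *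
      ((1 : A) ⊗ₜ[k] (g.s ^ (p + 1)) x)) w) a = Q * ((g.s ^ p) a ⊗ₜ[k] 1) := by
  have hK : IsTrilinear k fun x y z : A =>
      Q * ((g.s ^ p) z ⊗ₜ[k] ((g.s ^ p) y * (g.s ^ (p + 1)) x)) := by
    constructor <;> intros <;> constructor <;> intros <;>
      simp [TensorProduct.add_tmul, TensorProduct.tmul_add, add_mul, mul_add,
        ← TensorProduct.smul_tmul']
  calc _ = comulSum k (fun x w => comulSum k (fun y z =>
        Q * ((g.s ^ p) z ⊗ₜ[k] ((g.s ^ p) y * (g.s ^ (p + 1)) x))) w) a := by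
        refine comulSum_congr (fun x w => ?_) a
        rw [exchange_odd g hQ hp]
        simp [mul_assoc]
    _ = comulSum k (fun w z => comulSum k (fun x y =>
        Q * ((g.s ^ p) z ⊗ₜ[k] ((g.s ^ p) y * (g.s ^ (p + 1)) x))) w) a := hK.comulSum_coassoc a
    _ = comulSum k (fun w z => Coalgebra.counit (R := k) w • (Q * ((g.s ^ p) z ⊗ₜ[k] 1))) a := by
        refine comulSum_congr (fun w z => ?_) a
        have := comulSum_antipode_left (k := k) g p w
        simp only [← zpow_mul_s_odd g hp, comulSum] at this
        simp only [comulSum, ← Finset.mul_sum, ← TensorProduct.tmul_sum, this,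
          TensorProduct.tmul_smul, mul_smul_comm]
    _ = _ := comulSum_counit_left (LinearMap.mulLeft k Q ∘ₗ
        (TensorProduct.mk k A A).flip 1 ∘ₗ (g.s ^ p).toLinearMap) a

/-- A bead arriving at a crossing from above on the right. -/
theorem push_ur {p : ℤ} (hp : ¬ Even p) (a : A) :
    comulSum k (fun x w => comulSum k (fun y z => ((g.s ^ p) x ⊗ₜ[k] (g.s ^ p) y) * Q *
      ((g.s ^ (p - 1)) z ⊗ₜ[k] (1 : A))) w) a = Q * ((1 : A) ⊗ₜ[k] (g.s ^ p) a) := by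
  have hp' : Even (p - 1) := by
    rw [Int.even_sub_one]
    exact hp
  have hK : IsTrilinear k fun x y z : A =>
      ((g.s ^ p) x ⊗ₜ[k] (g.s ^ p) y) * Q * ((g.s ^ (p - 1)) z ⊗ₜ[k] (1 : A)) := by
    constructor <;> intros <;> constructor <;> intros <;>
      simp [TensorProduct.add_tmul, TensorProduct.tmul_add, add_mul, mul_add,
        ← TensorProduct.smul_tmul']
  have hK' : IsTrilinear k fun x y z : A =>
      Q * (((g.s ^ p) y * (g.s ^ (p - 1)) z) ⊗ₜ[k] (g.s ^ p) x) := by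
    constructor <;> intros <;> constructor <;> intros <;>
      simp [TensorProduct.add_tmul, TensorProduct.tmul_add, add_mul, mul_add,
        ← TensorProduct.smul_tmul']
  calc _ = comulSum k (fun w z => comulSum k (fun x y => ((g.s ^ p) x ⊗ₜ[k] (g.s ^ p) y) * Q *
        ((g.s ^ (p - 1)) z ⊗ₜ[k] (1 : A))) w) a := hK.comulSum_coassoc a
    _ = comulSum k (fun w z => comulSum k (fun x y =>
        Q * (((g.s ^ p) y * (g.s ^ (p - 1)) z) ⊗ₜ[k] (g.s ^ p) x)) w) a := by
        refine comulSum_congr (fun w z => ?_) a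
        rw [exchange_odd g hQ hp]
        simp [mul_assoc]
    _ = comulSum k (fun x w => comulSum k (fun y z =>
        Q * (((g.s ^ p) y * (g.s ^ (p - 1)) z) ⊗ₜ[k] (g.s ^ p) x)) w) a :=
        (hK'.comulSum_coassoc a).symm
    _ = comulSum k (fun x w => Coalgebra.counit (R := k) w • (Q * ((1 : A) ⊗ₜ[k] (g.s ^ p) x)))
        a := by
        refine comulSum_congr (fun x w => ?_) a
        have := comulSum_antipode_left (k := k) g (p - 1) w
        simp only [← zpow_mul_s_even g hp', comulSum, sub_add_cancel] at this
        simp only [comulSum, ← Finset.mul_sum, ← TensorProduct.sum_tmul, this,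
          ← TensorProduct.smul_tmul', mul_smul_comm]
    _ = _ := comulSum_counit_right (LinearMap.mulLeft k Q ∘ₗ
        TensorProduct.mk k A A 1 ∘ₗ (g.s ^ p).toLinearMap) a

end Identities

/-- Two contractions of `ρ₁₃ ρ₂₃ = (Δ ⊗ 1) ρ`. With the counit it gives `(ε ⊗ 1) ρ * ρ = ρ`, hence
`(ε ⊗ 1) ρ = 1` by invertibility; with the antipode it gives `(s ⊗ 1) ρ * ρ = (ε ⊗ 1) ρ`. -/
theorem IsQuasitriangular.antipode_mul {ρ : A ⊗[k] A} (hρ : IsQuasitriangular k ρ) :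
    (HopfAlgebra.antipode k).rTensor A ρ * ρ = 1 := by
  let Φ : A ⊗[k] (A ⊗[k] A) →ₗ[k] A ⊗[k] A :=
    (LinearMap.mul' k A ∘ₗ (HopfAlgebra.antipode k).rTensor A).rTensor A ∘ₗ
      (TensorProduct.assoc k A A A).symm.toLinearMap
  let Ψ : A ⊗[k] (A ⊗[k] A) →ₗ[k] A ⊗[k] A :=
    (LinearMap.mul' k A ∘ₗ (Algebra.linearMap k A ∘ₗ Coalgebra.counit).rTensor A).rTensor A ∘ₗ
      (TensorProduct.assoc k A A A).symm.toLinearMap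
  let u : A ⊗[k] A := (Algebra.linearMap k A ∘ₗ Coalgebra.counit).rTensor A ρ
  have hΦ : ∀ τ : A ⊗[k] A, Φ (TensorProduct.assoc k A A A
      ((Coalgebra.comul (R := k) (A := A)).rTensor A τ)) =
      (Algebra.linearMap k A ∘ₗ Coalgebra.counit).rTensor A τ := by
    intro τ
    simp only [Φ, LinearMap.comp_apply, LinearEquiv.coe_coe, LinearEquiv.symm_apply_apply]
    rw [← LinearMap.comp_apply, ← LinearMap.rTensor_comp, LinearMap.comp_assoc,
      HopfAlgebra.mul_antipode_rTensor_comul]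
  have hΨ : ∀ τ : A ⊗[k] A, Ψ (TensorProduct.assoc k A A A
      ((Coalgebra.comul (R := k) (A := A)).rTensor A τ)) = τ := by
    intro τ
    simp only [Ψ, LinearMap.comp_apply, LinearEquiv.coe_coe, LinearEquiv.symm_apply_apply]
    rw [← LinearMap.comp_apply, ← LinearMap.rTensor_comp]
    have : (LinearMap.mul' k A ∘ₗ (Algebra.linearMap k A ∘ₗ Coalgebra.counit).rTensor A) ∘ₗ
        Coalgebra.comul = LinearMap.id := by
      ext a
      rw [LinearMap.rTensor_comp]
      simp only [LinearMap.comp_apply, Coalgebra.rTensor_counit_comul]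
      simp
    rw [this, LinearMap.rTensor_id, LinearMap.id_apply]
  have hmul : ∀ (S : A →ₗ[k] A) (τ τ' : A ⊗[k] A),
      ((LinearMap.mul' k A ∘ₗ S.rTensor A).rTensor A ∘ₗ
        (TensorProduct.assoc k A A A).symm.toLinearMap)
        (Algebra.TensorProduct.map (AlgHom.id k A)
          (Algebra.TensorProduct.includeRight : A →ₐ[k] A ⊗[k] A) τ * ((1 : A) ⊗ₜ[k] τ')) =
      S.rTensor A τ * τ' := by
    intro S τ τ'
    induction τ using TensorProduct.induction_on with
    | zero => simp
    | add x y hx hy => simp only [map_add, add_mul, hx, hy]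
    | tmul a b =>
      induction τ' using TensorProduct.induction_on with
      | zero => simp
      | add x y hx hy => simp only [TensorProduct.tmul_add, map_add, mul_add, hx, hy]
      | tmul c d => simp
  have h1 := congrArg Ψ hρ.rTensor_comul
  rw [hΨ, hmul] at h1
  have hu : u = 1 := hρ.isUnit.mul_right_cancel (h1.trans (one_mul ρ).symm)
  have h2 := congrArg Φ hρ.rTensor_comul
  rw [hΦ, hmul] at h2
  exact h2.trans hu

/-- For `L` the tensor is the flip of the inverse of `ρ`. Inversion and flip each interchange the
coproduct with its opposite, so both crossings obey the same law. -/
theorem IsQuasitriangular.crossing [Fintype ι] {e f : ι → A}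
    (hρ : IsQuasitriangular k (∑ i, e i ⊗ₜ[k] f i)) {G : Gen} (hG : G.isCrossing = true) (x : A) :
    crossingTensor g e f G * Coalgebra.comul x =
      TensorProduct.comm k A A (Coalgebra.comul x) * crossingTensor g e f G := by
  have hR : G = .R ∨ G = .L := by
    cases G <;> simp [Gen.isCrossing] at hG ⊢
  rcases hR with rfl | rfl
  · exact hρ.comul_comm x
  · set ρ := ∑ i, e i ⊗ₜ[k] f i with hρe
    set τ := (HopfAlgebra.antipode k).rTensor A ρ with hτ
    have h1 : τ * ρ = 1 := hρ.antipode_mul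
    have h2 : ρ * τ = 1 := hρ.isUnit.mul_right_cancel (by rw [mul_assoc, h1, mul_one, one_mul])
    have h3 : crossingTensor g e f .L = Algebra.TensorProduct.comm k A A τ := by
      simp [crossingTensor, crossingBead, hτ, hρe, g.s_apply]
    have h4 : ∀ t : A ⊗[k] A, TensorProduct.comm k A A t = Algebra.TensorProduct.comm k A A t :=
      fun t => rfl
    have h5 : Coalgebra.comul x = Algebra.TensorProduct.comm k A A
        (TensorProduct.comm k A A (Coalgebra.comul (R := k) x)) := by
      rw [← h4]
      simp
    rw [h3]
    conv_lhs => rw [h5]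
    rw [h4 (Coalgebra.comul x), ← map_mul, ← map_mul]
    congr 1
    have h6 := hρ.comul_comm x
    rw [← h4]
    calc τ * TensorProduct.comm k A A (Coalgebra.comul x)
        = τ * (TensorProduct.comm k A A (Coalgebra.comul x) * ρ) * τ := by
          rw [mul_assoc, mul_assoc, h2, mul_one]
      _ = Coalgebra.comul x * τ := by rw [← h6, ← mul_assoc, h1, one_mul]

end Push

end BeadPush

namespace BeadPush

/-! ## Decorations -/

section Decoration

variable {k A : Type*} [CommRing k] [Ring A] [HopfAlgebra k A] (g : Augmentation k A)

theorem decoration_append {x y : List Bead} {u v : List A} (h : u.length = x.length) (z : Loc) :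
    decoration g (x ++ y) (u ++ v) z = decoration g x u z ++ decoration g y v z := by
  rw [decoration, List.zip_append h.symm, List.filter_append, List.map_append]
  rfl

theorem decoration_cons (b : Bead) (y : List Bead) (c : A) (v : List A) (z : Loc) :
    decoration g (b :: y) (c :: v) z =
      (if b.loc = z then [(g.s ^ b.pow) c] else []) ++ decoration g y v z := by
  rw [decoration, List.zip_cons_cons, List.filter_cons]
  by_cases h : b.loc = z <;> simp [h, decoration]

theorem decoration_eq_nil {bs : List Bead} {z : Loc} (h : z ∉ bs.map Bead.loc) (v : List A) :
    decoration g bs v z = [] := by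
  induction bs generalizing v with
  | nil => simp [decoration]
  | cons b bs ih =>
    simp only [List.map_cons, List.mem_cons, not_or] at h
    cases v with
    | nil => simp [decoration]
    | cons c v => rw [decoration_cons, if_neg (Ne.symm h.1), ih h.2, List.nil_append]

theorem decoration_length {bs : List Bead} (h : (bs.map Bead.loc).Nodup) (v : List A) (z : Loc) :
    (decoration g bs v z).length ≤ 1 := by
  induction bs generalizing v with
  | nil => simp [decoration]
  | cons b bs ih =>
    simp only [List.map_cons, List.nodup_cons] at h
    cases v with
    | nil => simp [decoration]
    | cons c v =>
      rw [decoration_cons]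
      split_ifs with hz
      · subst hz
        simp [decoration_eq_nil g h.1]
      · simpa using ih h.2 v

/-- Adding a bead with the element `c` to the beads at the points. -/
noncomputable def addBead (b : Bead) (c : A) (P : ℕ × ℕ → A) : ℕ × ℕ → A :=
  Function.update P b.loc.point
    (if b.loc.up then (g.s ^ b.pow) c * P b.loc.point else P b.loc.point * (g.s ^ b.pow) c)

/-- Distinct positions leave the new bead alone on its half, so it is multiplied from below or from
above onto whatever lies on the other half. -/
theorem pointBeads_insert {x y : List Bead} {b : Bead} {u w : List A}
    (hnd : ((x ++ b :: y).map Bead.loc).Nodup) (hu : u.length = x.length) (c : A) :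
    pointBeads (decoration g (x ++ b :: y) (u ++ c :: w)) =
      addBead g b c (pointBeads (decoration g (x ++ y) (u ++ w))) := by
  rw [List.map_append, List.map_cons, List.nodup_middle, List.nodup_cons, ← List.map_append] at hnd
  have hD : ∀ z, (decoration g (x ++ b :: y) (u ++ c :: w) z) =
      if b.loc = z then [(g.s ^ b.pow) c] else decoration g (x ++ y) (u ++ w) z := by
    intro z
    rw [decoration_append g hu, decoration_cons]
    split_ifs with h
    · subst h
      have h1 := hnd.1
      rw [List.map_append, List.mem_append, not_or] at h1
      rw [decoration_eq_nil g h1.1, decoration_eq_nil g h1.2]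
      rfl
    · rw [decoration_append g hu, List.nil_append]
  funext q
  by_cases hq : q = b.loc.point
  · subst hq
    have h0 := decoration_eq_nil g hnd.1 (u ++ w)
    rw [addBead, Function.update_self, pointBeads_point, pointBeads_point, hD, hD, if_pos rfl,
      if_neg (Loc.rev_ne b.loc).symm, h0]
    split_ifs <;> simp
  · rw [addBead, Function.update_of_ne hq, pointBeads, pointBeads, hD, hD, if_neg, if_neg]
    · rintro h
      exact hq (by rw [h]; rfl)
    · rintro h
      exact hq (by rw [h]; rfl)

theorem pointBeads_eq_one {bs : List Bead} {z : Loc} (h : z ∉ bs.map Bead.loc)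
    (h' : z.rev ∉ bs.map Bead.loc) (v : List A) : pointBeads (decoration g bs v) z.point = 1 := by
  rw [pointBeads_point, decoration_eq_nil g h, decoration_eq_nil g h']
  simp

theorem addBead_of_ne {b : Bead} {c : A} {P : ℕ × ℕ → A} {q : ℕ × ℕ} (h : q ≠ b.loc.point) :
    addBead g b c P q = P q := Function.update_of_ne h _ _

theorem addBead_self {b : Bead} {c : A} {P : ℕ × ℕ → A} : addBead g b c P b.loc.point =
    if b.loc.up then (g.s ^ b.pow) c * P b.loc.point else P b.loc.point * (g.s ^ b.pow) c :=
  Function.update_self _ _ _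

end Decoration

section Value

variable {k A ι : Type*} [CommRing k] [Ring A] [HopfAlgebra k A] [Fintype ι]
  (g : Augmentation k A) (e f : ι → A) (tr : ℕ × ℕ → A →ₗ[k] k)
variable {T : List Layer} (hT : IsTangle 1 T 1)
include hT

theorem IsTangle.evalTangle_decoration {bs : List Bead} (hnd : (bs.map Bead.loc).Nodup)
    (v : List A) : evalTangle g e f tr T (decoration g bs v) =
      evalPoints g e f tr T (pointBeads (decoration g bs v)) :=
  hT.evalTangle_eq g e f tr (decoration_length g hnd v)

theorem IsTangle.evalTangle_multilinear {bs : List Bead} (hnd : (bs.map Bead.loc).Nodup)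
    (hv : ∀ b ∈ bs, b.loc.Valid T) :
    IsMultilinear k bs.length fun v => evalTangle g e f tr T (decoration g bs v) := by
  intro v w h
  obtain ⟨x, y, rfl, hx⟩ : ∃ x y, bs = x ++ y ∧ x.length = v.length :=
    ⟨bs.take v.length, bs.drop v.length, (List.take_append_drop _ _).symm, by simp; omega⟩
  obtain ⟨b, y, rfl⟩ : ∃ b y', y = b :: y' := List.exists_cons_of_ne_nil (by
    rintro rfl
    simp at h
    omega)
  set P := pointBeads (decoration g (x ++ y) (v ++ w)) with hP
  obtain ⟨L, hL⟩ := hT.evalPoints_update g e f (hv b (by simp)) tr P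
  refine ⟨L ∘ₗ (if b.loc.up then LinearMap.mulRight k (P b.loc.point) else
    LinearMap.mulLeft k (P b.loc.point)) ∘ₗ (g.s ^ b.pow).toLinearMap, fun c => ?_⟩
  change evalTangle g e f tr T _ = _
  rw [hT.evalTangle_decoration g e f tr hnd, pointBeads_insert g hnd hx.symm, addBead, hL, ← hP]
  simp only [LinearMap.comp_apply]
  split_ifs <;> simp

theorem IsTangle.value_single {b : Bead} (hv : b.loc.Valid T) (hpow : b.pow = 0)
    (hup : b.loc.up = true) (a : A) : value g e f tr T a [b] =
      evalPoints g e f tr T (Function.update 1 b.loc.point a) := by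
  have hnd : ([b].map Bead.loc).Nodup := by simp
  rw [value, List.length_singleton,
    sweedler_one (hT.evalTangle_multilinear g e f tr hnd (by simpa using hv)),
    hT.evalTangle_decoration g e f tr hnd]
  have h := pointBeads_insert g (x := []) (y := []) (b := b) (u := []) (w := []) (by simp) rfl a
  have h1 : pointBeads (decoration g ([] ++ []) ([] ++ [])) = (1 : ℕ × ℕ → A) := by
    funext q
    simp [pointBeads, decoration]
  rw [h1, addBead] at h
  rw [List.nil_append] at h
  simp only [List.nil_append] at h
  rw [h, hpow, if_pos hup]
  simp

variable {tr} (htr : ∀ p, IsTrace k (tr p))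

include htr in
theorem IsTangle.evalPoints_addBead_slide {b b' : Bead} {δ : ℤ} (hb : b.loc.Valid T)
    (h : next T b.loc = some (b'.loc, δ)) (hpow : b'.pow = b.pow + δ)
    (hcr : ∀ t l leg, passage T b.loc = .node t l leg → l.gen.isCrossing = false)
    {P : ℕ × ℕ → A} (hP : P b.loc.point = 1) (c : A) :
    evalPoints g e f tr T (addBead g b c P) = evalPoints g e f tr T (addBead g b' c P) := by
  obtain ⟨hv, hr, -, hne⟩ := hT.next_rev hb h
  have hcr' : ∀ t l leg, passage T b'.loc.rev = .node t l leg → l.gen.isCrossing = false := by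
    intro t l leg hn
    have hr' := hr
    unfold next at hr'
    rw [hn] at hr'
    simp only [Option.some.injEq, Prod.mk.injEq] at hr'
    obtain ⟨hl, hleg, -⟩ := hT.passage_node (Loc.valid_rev.2 hv) hn
    have h2 := passage_out hl (Gen.hasLeg_strand hleg).1
    rw [hr'.1, Loc.rev_rev] at h2
    exact hcr _ _ _ h2
  have hx : addBead g b c P b.loc.point = (g.s ^ b.pow) c := by
    rw [addBead_self, hP]
    simp
  refine hT.evalPoints_slide g e f htr hb h (fun σ => ⟨strandBead_eq_one g e f hcr,
    strandBead_eq_one g e f hcr'⟩) (fun q h1 h2 => ?_) ?_ ?_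
  · rw [addBead_of_ne g h1, addBead_of_ne g h2]
  · rw [addBead_of_ne g hne.symm, hP]
  · rw [addBead_self, hx, addBead_of_ne g hne, hpow, add_comm, g.zpow_add_apply]

include htr in
theorem IsTangle.evalPoints_addBead_crossing (hρ : IsQuasitriangular k (∑ i, e i ⊗ₜ[k] f i))
    {b : Bead} {t : ℕ} {l : Layer} {leg : Leg} (hb : b.loc.Valid T)
    (hn : passage T b.loc = .node t l leg) (hc : l.gen.isCrossing = true)
    (hpar : b.loc.up = true ↔ Even b.pow) {P : ℕ × ℕ → A} (hP : P b.loc.point = 1) (c : A) :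
    comulSum k (fun x w => comulSum k (fun y z => evalPoints g e f tr T
      (addBead g (sendBead b t l leg leg.cw (b.label ++ [1])) x
        (addBead g (sendBead b t l leg leg.cw.cw (b.label ++ [2])) y
          (addBead g (sendBead b t l leg leg.cw.cw.cw (b.label ++ [3])) z P)))) w) c =
      evalPoints g e f tr T (addBead g b c P) := by
  obtain ⟨hl, -, hloc⟩ := hT.passage_node hb hn
  have hpt : b.loc.point = (leg.out t l.left).point := by rw [hloc]; rfl
  have hup : b.loc.up = !(leg.out t l.left).up := by rw [hloc]; rfl
  obtain ⟨L, hL⟩ := hT.evalPoints_crossing g e f htr hl hc P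
  have hQ := hρ.crossing g hc
  have hne : ∀ {a b : Leg}, a ≠ b → (a.out t l.left).point ≠ (b.out t l.left).point :=
    fun h h' => h (Leg.out_point_injective h')
  have hrest : ∀ x y z q, (∀ leg : Leg, q ≠ (leg.out t l.left).point) →
      addBead g (sendBead b t l leg leg.cw (b.label ++ [1])) x
        (addBead g (sendBead b t l leg leg.cw.cw (b.label ++ [2])) y
          (addBead g (sendBead b t l leg leg.cw.cw.cw (b.label ++ [3])) z P)) q = P q := by
    intro x y z q hq
    rw [addBead_of_ne g (hq _), addBead_of_ne g (hq _), addBead_of_ne g (hq _)]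
  have hrest' : ∀ q, (∀ leg : Leg, q ≠ (leg.out t l.left).point) → addBead g b c P q = P q := by
    intro q hq
    rw [addBead_of_ne]
    rw [hpt]
    exact hq _
  have hself : addBead g b c P (leg.out t l.left).point = (g.s ^ b.pow) c := by
    rw [← hpt, addBead_self, hP]
    simp
  have hother : ∀ leg', leg' ≠ leg →
      addBead g b c P (leg'.out t l.left).point = P (leg'.out t l.left).point := fun leg' h =>
    addBead_of_ne g (by rw [hpt]; exact fun h' => h (Leg.out_point_injective h'))
  have hsend : ∀ (leg' : Leg) (lab : List ℕ) (x : A) (P : ℕ × ℕ → A) (leg'' : Leg),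
      addBead g (sendBead b t l leg leg' lab) x P (leg''.out t l.left).point =
        if leg'' = leg' then
          (if (leg'.out t l.left).up then
            (g.s ^ (b.pow + turn leg leg')) x * P (leg'.out t l.left).point
          else P (leg'.out t l.left).point * (g.s ^ (b.pow + turn leg leg')) x)
        else P (leg''.out t l.left).point := by
    intro leg' lab x P leg''
    split_ifs with h1 h2
    · subst h1
      exact (addBead_self g).trans (if_pos h2)
    · subst h1
      exact (addBead_self g).trans (if_neg h2)
    · exact addBead_of_ne g fun h => h1 (Leg.out_point_injective h)
  -- Linearity lets a push identity be applied inside `L`, between the older beads `X` and `Y`.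
  have hout : ∀ (F : A → A → A → A ⊗[k] A) (X Y R : A ⊗[k] A),
      comulSum k (fun x w => comulSum k (fun y z => F x y z) w) c = R →
      comulSum k (fun x w => comulSum k (fun y z => L (X * F x y z * Y)) w) c = L (X * R * Y) := by
    rintro F X Y R rfl
    simp only [comulSum, Finset.mul_sum, Finset.sum_mul, map_sum]
  -- The new beads lie next to the crossing, and older beads at the same points lie outside them.
  have hgroup : ∀ a a' b b' c c' d d' : A,
      ((a * a') ⊗ₜ[k] (b * b')) * crossingTensor g e f l.gen * ((c' * c) ⊗ₜ[k] (d' * d)) =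
        (a ⊗ₜ b) * ((a' ⊗ₜ b') * crossingTensor g e f l.gen * (c' ⊗ₜ d')) * (c ⊗ₜ d) := by
    intro a a' b b' c c' d d'
    simp only [← Algebra.TensorProduct.tmul_mul_tmul, mul_assoc]
  have hgl : ∀ a a' b b' c d : A,
      ((a * a') ⊗ₜ[k] (b * b')) * crossingTensor g e f l.gen * (c ⊗ₜ[k] d) =
        (a ⊗ₜ b) * ((a' ⊗ₜ b') * crossingTensor g e f l.gen) * (c ⊗ₜ d) := by
    intro a a' b b' c d
    simp only [← Algebra.TensorProduct.tmul_mul_tmul, mul_assoc]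
  have hgr : ∀ a b c c' d d' : A,
      (a ⊗ₜ[k] b) * crossingTensor g e f l.gen * ((c' * c) ⊗ₜ[k] (d' * d)) =
        (a ⊗ₜ b) * (crossingTensor g e f l.gen * (c' ⊗ₜ d')) * (c ⊗ₜ d) := by
    intro a b c c' d d'
    simp only [← Algebra.TensorProduct.tmul_mul_tmul, mul_assoc]
  have hll : (Leg.out t l.left .ll).up = false := rfl
  have hlr : (Leg.out t l.left .lr).up = false := rfl
  have hul : (Leg.out t l.left .ul).up = true := rfl
  have hur : (Leg.out t l.left .ur).up = true := rfl
  simp only [hL _ (hrest _ _ _), hL _ hrest']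
  rw [hpt] at hP
  cases leg with
  | lr =>
    have hp : Even b.pow := hpar.1 (by rw [hup]; rfl)
    rw [hself, hother .ll (by decide), hother .ul (by decide), hother .ur (by decide)]
    refine (comulSum_congr (fun x w => comulSum_congr (fun y z => congrArg L ?_) w) c).trans
      ((hout _ (1 ⊗ₜ P (Leg.out t l.left .ll).point)
        (P (Leg.out t l.left .ul).point ⊗ₜ P (Leg.out t l.left .ur).point) _
        (push_lr g hQ hp c)).trans (congrArg L ?_))
    · rw [← hgroup]
      simp [hsend, Leg.cw, hll, hul, hur, turn, hP]
    · rw [← hgl]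
      simp
  | ll =>
    have hp : Even b.pow := hpar.1 (by rw [hup]; rfl)
    rw [hself, hother .lr (by decide), hother .ul (by decide), hother .ur (by decide)]
    refine (comulSum_congr (fun x w => comulSum_congr (fun y z => congrArg L ?_) w) c).trans
      ((hout _ (P (Leg.out t l.left .lr).point ⊗ₜ 1)
        (P (Leg.out t l.left .ul).point ⊗ₜ P (Leg.out t l.left .ur).point) _
        (push_ll g hQ hp c)).trans (congrArg L ?_))
    · rw [← hgroup]
      simp [hsend, Leg.cw, hlr, hul, hur, turn, hP, sub_eq_add_neg]
    · rw [← hgl]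
      simp
  | ul =>
    have hp : ¬ Even b.pow := fun h => by
      have := hpar.2 h
      rw [hup] at this
      cases this
    rw [hself, hother .lr (by decide), hother .ll (by decide), hother .ur (by decide)]
    refine (comulSum_congr (fun x w => comulSum_congr (fun y z => congrArg L ?_) w) c).trans
      ((hout _ (P (Leg.out t l.left .lr).point ⊗ₜ P (Leg.out t l.left .ll).point)
        (1 ⊗ₜ P (Leg.out t l.left .ur).point) _
        (push_ul g hQ hp c)).trans (congrArg L ?_))
    · rw [← hgroup]
      simp [hsend, Leg.cw, hll, hlr, hur, turn, hP]
    · rw [← hgr]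
      simp
  | ur =>
    have hp : ¬ Even b.pow := fun h => by
      have := hpar.2 h
      rw [hup] at this
      cases this
    rw [hself, hother .lr (by decide), hother .ll (by decide), hother .ul (by decide)]
    refine (comulSum_congr (fun x w => comulSum_congr (fun y z => congrArg L ?_) w) c).trans
      ((hout _ (P (Leg.out t l.left .lr).point ⊗ₜ P (Leg.out t l.left .ll).point)
        (P (Leg.out t l.left .ul).point ⊗ₜ 1) _
        (push_ur g hQ hp c)).trans (congrArg L ?_))
    · rw [← hgroup]
      simp [hsend, Leg.cw, hll, hlr, hul, turn, hP, sub_eq_add_neg]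
    · rw [← hgr]
      simp

/-- A pair of cancelling beads. -/
theorem IsTangle.evalPoints_addBead_cancel {b c : Bead} (hb : b.loc.Valid T) (h : Cancels b c)
    {P : ℕ × ℕ → A} (hP : P b.loc.point = 1) (a : A) :
    comulSum k (fun x y => evalPoints g e f tr T (addBead g b x (addBead g c y P))) a =
      Coalgebra.counit (R := k) a • evalPoints g e f tr T P := by
  obtain ⟨hloc, h⟩ := h
  have hpt : c.loc.point = b.loc.point := by rw [hloc]; rfl
  -- Both directions give this form. In the second, `n = c.pow - 1` is odd, and reversing the
  -- product puts the two factors in coproduct order.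
  obtain ⟨n, hn⟩ : ∃ n : ℤ, ∀ x y, addBead g b x (addBead g c y P) =
      Function.update P b.loc.point ((g.s ^ n) (x * g.s y)) := by
    rcases h with ⟨hup, hev, hpow⟩ | ⟨hup, hev, hpow⟩
    · have hup' : c.loc.up = false := by rw [hloc]; simp [hup]
      refine ⟨b.pow, fun x y => ?_⟩
      rw [addBead, addBead, hpt, Function.update_idem, Function.update_self, hP, hpow]
      rw [g.zpow_mul_of_even hev, zpow_succ_apply]
      simp [hup, hup']
    · have hup' : b.loc.up = false := by
        rw [hloc] at hup
        simpa using hup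
      have hodd : ¬ Even (c.pow - 1) := by
        rw [Int.even_sub_one]
        exact not_not.2 hev
      refine ⟨c.pow - 1, fun x y => ?_⟩
      rw [addBead, addBead, hpt, Function.update_idem, Function.update_self, hP, hpow]
      rw [g.zpow_mul_of_odd hodd, zpow_succ_apply, sub_add_cancel]
      simp [hup, hup']
  obtain ⟨L, hL⟩ := hT.evalPoints_update g e f hb tr P
  have h1 : evalPoints g e f tr T P = L 1 := by
    rw [← hL, ← hP, Function.update_eq_self]
  simp only [hn, hL]
  rw [h1, ← map_smul, ← comulSum_antipode_right g n a]
  simp only [comulSum, map_sum]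

end Value

end BeadPush

/-! ### Invariance of the value, and the positions reachable by pushing -/

namespace BeadPush

section Steps

variable {k A ι : Type*} [CommRing k] [Ring A] [HopfAlgebra k A] [Fintype ι]
  (g : Augmentation k A) (e f : ι → A) (tr : ℕ × ℕ → A →ₗ[k] k)
variable {T : List Layer} (hT : IsTangle 1 T 1)
include hT

/-- Replacing consecutive beads. -/
theorem IsTangle.value_replace {x m m' y : List Bead}
    (hnd : ((x ++ (m ++ y)).map Bead.loc).Nodup) (hnd' : ((x ++ (m' ++ y)).map Bead.loc).Nodup)
    (hv : ∀ b ∈ x ++ (m ++ y), b.loc.Valid T) (hv' : ∀ b ∈ x ++ (m' ++ y), b.loc.Valid T)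
    (h : ∀ u w, u.length = x.length → w.length = y.length → ∀ c,
      IsMultilinear k m.length (fun v =>
        evalTangle g e f tr T (decoration g (x ++ (m ++ y)) (u ++ (v ++ w)))) →
      IsMultilinear k m'.length (fun v =>
        evalTangle g e f tr T (decoration g (x ++ (m' ++ y)) (u ++ (v ++ w)))) →
      sweedler k m.length c (fun v =>
        evalTangle g e f tr T (decoration g (x ++ (m ++ y)) (u ++ (v ++ w)))) =
      sweedler k m'.length c fun v =>
        evalTangle g e f tr T (decoration g (x ++ (m' ++ y)) (u ++ (v ++ w)))) (a : A) :
    value g e f tr T a (x ++ (m ++ y)) = value g e f tr T a (x ++ (m' ++ y)) := by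
  have hm := hT.evalTangle_multilinear g e f tr hnd hv
  have hm' := hT.evalTangle_multilinear g e f tr hnd' hv'
  unfold value
  rw [List.length_append, List.length_append] at hm hm' ⊢
  rw [List.length_append (as := x), List.length_append (as := m')]
  exact sweedler_replace hm hm' (fun u w hu hw c =>
    h u w hu hw c ((hm.append_left hu).append_right hw) ((hm'.append_left hu).append_right hw)) a

theorem IsTangle.evalTangle_insert {x y : List Bead} {b : Bead} {u w : List A} {c : A}
    (hnd : ((x ++ b :: y).map Bead.loc).Nodup) (hu : u.length = x.length) :
    evalTangle g e f tr T (decoration g (x ++ b :: y) (u ++ c :: w)) =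
      evalPoints g e f tr T (addBead g b c (pointBeads (decoration g (x ++ y) (u ++ w)))) := by
  rw [hT.evalTangle_decoration g e f tr hnd, pointBeads_insert g hnd hu]

variable {tr} (htr : ∀ p, IsTrace k (tr p))
include htr

/-- By distinctness and `hfree` the bead is alone at its point, so it may be moved off freely. The
identity is needed only for the consecutive factors that the push changes. -/
theorem IsTangle.value_push {C : Finset (ℕ × ℕ)}
    (hρ : IsQuasitriangular k (∑ i, e i ⊗ₜ[k] f i)) {x y bs : List Bead} {b : Bead}
    (hnd : ((x ++ b :: y).map Bead.loc).Nodup) (hnd' : ((x ++ bs ++ y).map Bead.loc).Nodup)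
    (hv : ∀ c ∈ x ++ b :: y, c.loc.Valid T) (hv' : ∀ c ∈ x ++ bs ++ y, c.loc.Valid T)
    (hpar : b.loc.up = true ↔ Even b.pow) (hfree : b.loc.rev ∉ (x ++ y).map Bead.loc)
    (hadv : advance T C b = some bs) (a : A) :
    value g e f tr T a (x ++ b :: y) = value g e f tr T a (x ++ bs ++ y) := by
  have hb := hv b (by simp)
  have hmem : b.loc ∉ (x ++ y).map Bead.loc := by
    rw [List.map_append, List.map_cons, List.nodup_middle, List.nodup_cons] at hnd
    rw [List.map_append]
    exact hnd.1
  rw [List.append_assoc] at hnd' hv' ⊢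
  refine hT.value_replace g e f tr (m := [b]) hnd hnd' hv hv' (fun u w hu hw c h1 h2 => ?_) a
  have hP := pointBeads_eq_one g hmem hfree (u ++ w)
  have hslide : ∀ (b' : Bead) (δ : ℤ), bs = [b'] → next T b.loc = some (b'.loc, δ) →
      b'.pow = b.pow + δ →
      (∀ t l leg, passage T b.loc = .node t l leg → l.gen.isCrossing = false) →
      sweedler k [b].length c (fun v =>
        evalTangle g e f tr T (decoration g (x ++ ([b] ++ y)) (u ++ (v ++ w)))) =
      sweedler k bs.length c fun v =>
        evalTangle g e f tr T (decoration g (x ++ (bs ++ y)) (u ++ (v ++ w))) := by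
    rintro b' δ rfl hn hpow hcr
    rw [List.length_singleton, List.length_singleton, sweedler_one h1, sweedler_one h2]
    exact (hT.evalTangle_insert g e f tr hnd hu).trans
      ((hT.evalPoints_addBead_slide g e f htr hb hn hpow hcr hP c).trans
        (hT.evalTangle_insert g e f tr hnd' hu).symm)
  unfold advance at hadv
  split_ifs at hadv with hC
  split at hadv
  · cases hadv
  · rename_i z hz
    simp only [Option.some.injEq] at hadv
    refine hslide _ 0 hadv.symm (by simp [next, hz]) (by simp) fun t l leg h => ?_
    rw [hz] at h
    cases h
  · rename_i t l leg hn
    simp only [Option.some.injEq, pushNode] at hadv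
    split_ifs at hadv with hc
    · subst hadv
      rw [List.length_singleton, sweedler_one h1]
      simp only [List.length_cons, List.length_nil, Nat.zero_add, Nat.reduceAdd] at h2 ⊢
      rw [sweedler_three h2]
      refine (hT.evalTangle_insert g e f tr (w := w) hnd hu).trans ?_
      rw [← hT.evalPoints_addBead_crossing g e f htr hρ hb hn hc hpar hP c]
      have hsub : ∀ {z z' : List Bead}, z'.Sublist z → ((x ++ z).map Bead.loc).Nodup →
          ((x ++ z').map Bead.loc).Nodup := fun h h' =>
        h'.sublist ((List.Sublist.append_left h x).map _)
      simp only [List.cons_append, List.nil_append] at hnd' ⊢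
      have hnd2 := hsub (List.sublist_cons_self _ _) hnd'
      have hnd3 := hsub (List.sublist_cons_self _ _) hnd2
      unfold comulSum
      refine Finset.sum_congr rfl fun i _ => Finset.sum_congr rfl fun j _ => ?_
      rw [hT.evalTangle_insert g e f tr hnd' hu, pointBeads_insert g hnd2 hu,
        pointBeads_insert g hnd3 hu]
    · refine hslide _ _ hadv.symm (by simp [next, hn, sendBead]; rfl) (by simp [sendBead]) ?_
      intro t' l' leg' h
      rw [hn] at h
      cases h
      simpa using hc

omit htr in
theorem IsTangle.value_cancel {x y : List Bead} {b c : Bead}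
    (hnd : ((x ++ b :: c :: y).map Bead.loc).Nodup)
    (hv : ∀ c' ∈ x ++ b :: c :: y, c'.loc.Valid T) (h : Cancels b c) (a : A) :
    value g e f tr T a (x ++ b :: c :: y) = value g e f tr T a (x ++ y) := by
  have hsub : (x ++ y).Sublist (x ++ b :: c :: y) :=
    List.Sublist.append_left (((List.Sublist.refl y).cons c).cons b) x
  have hnd' := hnd.sublist (hsub.map Bead.loc)
  have hnd2 : ((x ++ c :: y).map Bead.loc).Nodup :=
    hnd.sublist ((List.Sublist.append_left (List.sublist_cons_self _ _) x).map Bead.loc)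
  have hmem : b.loc ∉ (x ++ y).map Bead.loc := by
    have h1 := hnd
    rw [List.map_append, List.map_cons, List.nodup_middle, List.nodup_cons] at h1
    intro h2
    refine h1.1 ?_
    rw [List.map_append, List.mem_append] at h2
    rw [List.mem_append, List.map_cons, List.mem_cons]
    exact h2.imp id Or.inr
  have hfree : b.loc.rev ∉ (x ++ y).map Bead.loc := by
    rw [List.map_append, List.map_cons, List.nodup_middle, List.nodup_cons] at hnd2
    rw [← show c.loc = b.loc.rev from h.1, List.map_append]
    exact hnd2.1
  refine hT.value_replace g e f tr (m := [b, c]) (m' := []) hnd hnd' hv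
    (fun c' hc' => hv c' (hsub.subset hc')) (fun u w hu hw d h1 h2 => ?_) a
  have hP := pointBeads_eq_one g hmem hfree (u ++ w)
  simp only [List.length_cons, List.length_nil, Nat.zero_add, Nat.reduceAdd] at h1 ⊢
  rw [sweedler_two h1, sweedler]
  simp only [List.cons_append, List.nil_append]
  rw [hT.evalTangle_decoration g e f tr hnd',
    ← hT.evalPoints_addBead_cancel g e f (hv b (by simp)) h hP d]
  unfold comulSum
  refine Finset.sum_congr rfl fun i _ => ?_
  rw [hT.evalTangle_insert g e f tr hnd hu, pointBeads_insert g hnd2 hu]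

end Steps

section Reachable

variable {T : List Layer} {C : Finset (ℕ × ℕ)} (hT : IsTangle 1 T 1)
include hT

theorem IsTangle.even_kid {x : Loc} (hx : x.Valid T) : ∀ q ∈ kids T C x,
    (Even q.2.1 ↔ q.1.up = x.up) := by
  intro q hq
  rcases hT.kids_links (C := C) hx with h0 | ⟨k, h0, -, -, -, -, h⟩ |
    ⟨k₁, k₂, k₃, h0, -, -, -, -, -, -, -, -, -, -, -, -, -, -, p1, p2, p3⟩
  · simp [h0] at hq
  · rw [h0, List.mem_singleton] at hq
    rwa [hq]
  · rw [h0] at hq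
    simp only [List.mem_cons, List.not_mem_nil, or_false] at hq
    rcases hq with rfl | rfl | rfl <;> assumption

variable (hC : IsTreeCut T C)
include hC

theorem IsTreeCut.push_parity {l m : List Bead} (h : Relation.ReflTransGen (Push T C) l m)
    (hl : ∀ b ∈ l, Outward T C b.loc) (hpar : ∀ b ∈ l, (b.loc.up = true ↔ Even b.pow)) :
    ∀ b ∈ m, (b.loc.up = true ↔ Even b.pow) := by
  obtain ⟨N, hN⟩ := exists_vdepth_lt T C
  induction h with
  | refl => exact hpar
  | tail h1 h2 ih =>
    have hout := (hC.push_star_invariant hT hN h1 hl).1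
    obtain ⟨x, b, bs, y, h⟩ := h2
    obtain ⟨-, rfl⟩ := advance_eq_some.1 h
    intro c hc
    simp only [List.mem_append] at hc
    rcases hc with (hc | hc) | hc
    · exact ih c (by simp [hc])
    · obtain ⟨q, hq, rfl⟩ := List.mem_map.1 hc
      have hb := ih b (by simp)
      have hq' := hT.even_kid (hout b (by simp)).1 q hq
      simp only [Bead.step]
      rw [Int.even_add, hq', ← hb]
      generalize q.1.up = u, b.loc.up = w
      revert u w
      decide
    · exact ih c (by simp [hc])

/-- Trails of different beads are disjoint. A pushable bead has both directions of its point on its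
trail, while any bead has its reversed position on its own; so no other bead lies at that point. -/
theorem IsTreeCut.reachable_nodup {m : List Bead}
    (h : Relation.ReflTransGen (Push T C) [startBead] m) : (m.map Bead.loc).Nodup ∧
      ∀ x b y, m = x ++ b :: y → kids T C b.loc ≠ [] → b.loc.rev ∉ (x ++ y).map Bead.loc := by
  obtain ⟨N, hN⟩ := exists_vdepth_lt T C
  have hs : ∀ b ∈ [startBead], Outward T C b.loc := by
    intro b hb
    rw [List.mem_singleton.1 hb]
    exact hC.outward_start
  have hout := (hC.push_star_invariant hT hN h hs).1
  have hnd : (m.flatMap (Bead.trail T C N)).Nodup := by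
    refine List.Nodup.sublist (hC.trail_push_star hT hN h hs) ?_
    simpa [Bead.trail] using hC.nodup_contour hT hN (hs startBead (by simp))
  have hdisj : m.Pairwise fun b c => ∀ z ∈ b.trail T C N, z ∉ c.trail T C N := by
    refine (List.nodup_flatMap.1 hnd).2.imp fun hd z hz hz' => ?_
    exact hd hz hz'
  have hrev : ∀ b : Bead, b.loc.rev ∈ b.trail T C N := fun b => by simp [Bead.trail]
  refine ⟨?_, ?_⟩
  · rw [List.Nodup, List.pairwise_map]
    refine hdisj.imp fun {b c} hd hbc => hd _ (hrev b) ?_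
    rw [hbc]
    exact hrev c
  · rintro x b y rfl hk hmem
    have hself : b.loc ∈ b.trail T C N := by
      rw [hC.trail_step hT hN (hout b (by simp)) hk]
      simp
    obtain ⟨c, hc, hcl⟩ := List.mem_map.1 hmem
    have hcr : b.loc ∈ c.trail T C N := by
      have := hrev c
      rwa [hcl, Loc.rev_rev] at this
    rw [List.pairwise_append, List.pairwise_cons] at hdisj
    rcases List.mem_append.1 hc with hc | hc
    · exact hdisj.2.2 c hc b (by simp) _ hcr hself
    · exact hdisj.2.1.1 c hc _ hself hcr

end Reachable

end BeadPush
namespace BeadPush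

theorem Cancel.sublist {l m : List Bead} (h : Cancel l m) : m.Sublist l := by
  obtain ⟨x, b, c, y, -⟩ := h
  exact List.Sublist.append_left (((List.Sublist.refl y).cons c).cons b) x

theorem Cancel.sublist_star {l m : List Bead} (h : Relation.ReflTransGen Cancel l m) :
    m.Sublist l := by
  induction h with
  | refl => exact .refl _
  | tail _ h ih => exact h.sublist.trans ih

end BeadPush

open BeadPush
/-- Bead-pushing centrality for 1-1 tangles. -/
theorem mainTheorem6 {k A ι : Type*} [CommRing k] [Ring A] [HopfAlgebra k A] [Fintype ι]
    (g : Augmentation k A) (e f : ι → A) (hρ : IsQuasitriangular k (∑ i, e i ⊗ₜ[k] f i))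
    (tr : ℕ × ℕ → A →ₗ[k] k) (htr : ∀ p, IsTrace k (tr p))
    (T : List Layer) (hT : IsTangle 1 T 1) (C : Finset (ℕ × ℕ)) (hC : IsTreeCut T C) :
    ∃ (ends u v : List Bead) (z : Bead),
      -- every way of pushing leads to the same final position
      Relation.ReflTransGen (Push T C) [startBead] ends ∧
      (∀ bs, Relation.ReflTransGen (Push T C) [startBead] bs →
        Relation.ReflTransGen (Push T C) bs ends) ∧
      (∀ bs, ¬ Push T C ends bs) ∧
      -- with one bead on each twig, in lexicographic order
      (ends.map Bead.loc).Nodup ∧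
      (∀ x : Loc, x ∈ ends.map Bead.loc ↔ x = topLoc T ∨ x.point ∈ C) ∧
      ends.Pairwise (fun b c => b.label < c.label) ∧
      -- paired beads differ by exactly one power of the antipode
      (∀ b ∈ ends, ∀ c ∈ ends, Paired b c → |b.pow - c.pow| = 1) ∧
      -- the pairs form well-nested parentheses on both sides of the bead `z` on the upper leg
      ends = u ++ z :: v ∧ z.loc = topLoc T ∧ z.pow = 0 ∧
      WellNested Paired u ∧ WellNested Paired v ∧
      -- the pairs cancel in sequence
      Relation.ReflTransGen Cancel ends [z] ∧
      -- the steps are equalities in `A` and together prove centrality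
      ∀ a : A,
        value g e f tr T a [startBead] = a * tangleElement g e f tr T ∧
        (∀ bs cs, Relation.ReflTransGen (Push T C) [startBead] bs → Push T C bs cs →
          value g e f tr T a bs = value g e f tr T a cs) ∧
        (∀ bs cs, Relation.ReflTransGen Cancel ends bs → Cancel bs cs →
          value g e f tr T a bs = value g e f tr T a cs) ∧
        value g e f tr T a [z] = tangleElement g e f tr T * a ∧
        a * tangleElement g e f tr T = tangleElement g e f tr T * a := by
  obtain ⟨N, hN⟩ := exists_vdepth_lt T C
  have hs : Outward T C startBead.loc := hC.outward_start
  have hs' : ∀ b ∈ [startBead], Outward T C b.loc := fun b hb => by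
    rw [List.mem_singleton.1 hb]
    exact hs
  have hspar : startBead.loc.up = true ↔ Even startBead.pow := by simp [startBead]
  have hspar' : ∀ b ∈ [startBead], (b.loc.up = true ↔ Even b.pow) := fun b hb => by
    rw [List.mem_singleton.1 hb]
    exact hspar
  obtain ⟨z, -, hztop, hzpow, hcol⟩ := hC.final_collapse hT hN
  obtain ⟨u, v, huv, hu, hv⟩ := wellNested_of_collapse hcol
  obtain ⟨-, -, -, hlabel, hpar⟩ := hC.pushOut_linked hT hN hs
  have hnd := hC.nodup_final hT hN
  have hpush := hC.push_pushOut hT hN hs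
  have hcancel := cancel_of_collapse hcol (hpar hspar)
  have hend : ∀ b ∈ pushOut T C N startBead, b.loc.Valid T := fun b hb =>
    (hC.pushOut_stopped hT hN hs b hb).1.1
  refine ⟨pushOut T C N startBead, u, v, z, hpush, fun bs hbs => ?_, fun bs hbs => ?_, hnd,
    hC.mem_final_iff hT hN, hlabel, abs_pow_sub_of_collapse hcol hnd, huv, hztop, hzpow, hu, hv,
    hcancel, fun a => ?_⟩
  -- Pushing all beads of `bs` to the end gives the position predicted from the start.
  · obtain ⟨h1, h2⟩ := hC.push_star_invariant hT hN hbs hs'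
    have h3 := Push.flatMap (T := T) (C := C) (F := pushOut T C N) (l := bs)
      fun c hc => hC.push_pushOut hT hN (h1 c hc)
    rw [← h2] at h3
    simpa using h3
  · generalize hm : pushOut T C N startBead = m at hbs
    obtain ⟨x, b, bs, y, h⟩ := hbs
    exact (advance_eq_some.1 h).1 (hC.pushOut_stopped hT hN hs b (by rw [hm]; simp)).2
  · have hstep : ∀ bs cs, Relation.ReflTransGen (Push T C) [startBead] bs → Push T C bs cs →
        value g e f tr T a bs = value g e f tr T a cs := by
      intro bs cs hbs hcs
      have hout := (hC.push_star_invariant hT hN hbs hs').1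
      have hout' := (hC.push_star_invariant hT hN (hbs.tail hcs) hs').1
      have hnd' := (hC.reachable_nodup hT (hbs.tail hcs)).1
      have hpar' := hC.push_parity hT hbs hs' hspar'
      obtain ⟨hnd, hfree⟩ := hC.reachable_nodup hT hbs
      obtain ⟨x, b, bs, y, h⟩ := hcs
      exact hT.value_push g e f htr hρ hnd hnd' (fun c hc => (hout c hc).1)
        (fun c hc => (hout' c hc).1) (hpar' b (by simp))
        (hfree x b y rfl (advance_eq_some.1 h).1) h a
    have hcstep : ∀ bs cs, Relation.ReflTransGen Cancel (pushOut T C N startBead) bs →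
        Cancel bs cs → value g e f tr T a bs = value g e f tr T a cs := by
      intro bs cs hbs hcs
      -- Cancelling only deletes beads, so distinctness and validity are inherited from the final
      -- position.
      have hsub := Cancel.sublist_star hbs
      obtain ⟨x, b, c, y, h⟩ := hcs
      exact hT.value_cancel g e f (tr := tr) (hnd.sublist (hsub.map Bead.loc))
        (fun d hd => hend d (hsub.subset hd)) h a
    have hstart : value g e f tr T a [startBead] = a * tangleElement g e f tr T := by
      rw [hT.value_single g e f tr hs.1 rfl rfl]
      exact hT.evalPoints_start g e f tr a
    have hfinal : value g e f tr T a [z] = tangleElement g e f tr T * a := by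
      rw [hT.value_single g e f tr (by rw [hztop]; exact hT.topLoc_valid) hzpow
        (by rw [hztop]; rfl), hztop, hT.evalPoints_top]
    refine ⟨hstart, hstep, hcstep, hfinal, ?_⟩
    rw [← hstart, ← hfinal]
    have h1 : ∀ bs, Relation.ReflTransGen (Push T C) [startBead] bs →
        value g e f tr T a [startBead] = value g e f tr T a bs := by
      intro bs hbs
      induction hbs with
      | refl => rfl
      | tail h h' ih => exact ih.trans (hstep _ _ h h')
    have h2 : ∀ bs, Relation.ReflTransGen Cancel (pushOut T C N startBead) bs →
        value g e f tr T a (pushOut T C N startBead) = value g e f tr T a bs := by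
      intro bs hbs
      induction hbs with
      | refl => rfl
      | tail h h' ih => exact ih.trans (hcstep _ _ h h')
    exact (h1 _ hpush).trans (h2 _ hcancel)
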